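/- Let $\Pi=\{z=x+iy\in\mathbb C:\ y>0\}$, let $dA$ be Lebesgue measure, $\partial=\frac12(\partial_x-i\partial_y)$, $\bar\partial=\frac12(\partial_x+i\partial_y)$, $\Delta=\partial_x^2+\partial_y^2$. For $n\ge 0$ let $\mathcal A_n$ be the space of $u\in L^2(\Pi,dA)$ that are smooth with $\bar\partial^n u=0$ (so $\mathcal A_0=0$ and $\mathcal A_1$ is the Bergman space), and for $n\ge1$ let $\mathcal A_{(n)}=\mathcal A_n\cap\mathcal A_{n-1}^{\perp}$ be the true poly-Bergman space, so $\mathcal A_{(1)}=\mathcal A_1$. For smooth $f$ put $S_\Pi^jf=\partial^j[(z-\bar z)^jf]/j!$. Let $\mathcal L$ be the linear span of the functions $$e_n(z)=2\sqrt{\tfrac{n+1}{\pi}}\,\frac{(z-i)^n}{(1-iz)^{n+2}},\qquad n\ge0,$$ the standard orthonormal basis of $\mathcal A_1$. A *symbol* is a distribution on $\Pi$ defined at least on $C^\infty(\overline\Pi)\cap L^1(\Pi)$, i.e. a linear functional $a$ on a space $\mathrm{dom}(a)$ of smooth functions on $\Pi$ that contains $C^\infty(\overline\Pi)\cap L^1(\Pi)$,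 whose restriction to the test functions on $\Pi$ is a distribution. Write $(a,\varphi)$ for its value at $\varphi$. Differential operators $D$ with smooth coefficients act on such functionals by transposition: $(Da,\varphi)=(a,D^{t}\varphi)$ for all smooth $\varphi$ with $D^t\varphi\in \mathrm{dom}(a)$. For $j\ge0$ and such a functional $a$, the Toeplitz operator $T_a$ on $\mathcal A_{(j+1)}$ is *bounded* if $(a,u\bar v)$ is defined and $|(a,u\bar v)|\le C\|u\|\|v\|$ for all $u=S_\Pi^jf$, $v=S_\Pi^jg$, $f,g\in\mathcal L$, with some constant $C$; $T_a=T_a(\mathcal A_{(j+1)})$ is then the bounded operator on $\mathcal A_{(j+1)}$ with $\langle T_au,v\rangle=(a,u\bar v)$ for all such $u,v$. **Theorem.** Let $j\ge0$. Then $S_\Pi^j$ maps $\mathcal A_1$ isometrically onto $\mathcal A_{(j+1)}$, and there is a polynomial $P_j$ of degree $j$ in three noncommuting variables such that, with the differential operator $$K_{(j)}=P_j\bigl(\Delta(y^2\,\cdot),\ \bar\partial(y\,\cdot),\ \partial(y\,\cdot)\bigr),$$ the following holds for every symbol $a$. 1. For all $f,g\in\mathcal L$ both sides of $(a,S_\Pi^jf\,\overline{S_\Pi^jg})=(K_{(j)}a,f\bar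 g)$ are defined, and they are equal. 2. $T_a$ on $\mathcal A_{(j+1)}$ is bounded if and only if $T_{K_{(j)}a}$ on $\mathcal A_1$ is bounded. 3. If they are bounded, then both operators exist and are uniquely determined, and they are unitarily equivalent through $S_\Pi^j$: $T_a(\mathcal A_{(j+1)})\,S_\Pi^ju=S_\Pi^j\,T_{K_{(j)}a}(\mathcal A_1)\,u$ for all $u\in\mathcal A_1$. One of them is compact, or belongs to the Schatten class $\mathfrak S_p$ (for any given $0<p<\infty$, meaning $\sum_n s_n^p<\infty$ for the singular numbers $s_n$), or is of finite rank, or is zero, if and only if the same holds for the other. -/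

import Mathlib

open MeasureTheory Complex
open scoped ContDiff Distributions InnerProductSpace ENNReal NNReal

noncomputable section

namespace PolyBergman

/-! ### The half-plane and smooth functions on it -/

/-- The open upper half-plane `Π` as an open subset of `ℂ`. -/
def halfPlane : TopologicalSpace.Opens ℂ :=
  ⟨{z : ℂ | 0 < z.im}, isOpen_lt continuous_const Complex.continuous_im⟩

/-- The Lebesgue area measure `dA` on `Π`. -/
abbrev area : Measure ℂ := volume.restrict (halfPlane : Set ℂ)

/-- The space `L²(Π, dA)`. -/
abbrev L2 : Type := Lp ℂ 2 area

/-- The space `C^∞(Π)` of complex valued functions that are smooth in the real sense on `Π`.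
A function on `Π` is represented by its extension by zero to `ℂ`, so that two elements are equal
exactly when they agree on `Π`. -/
def smoothFun : Submodule ℂ (ℂ → ℂ) where
  carrier := {f | ContDiffOn ℝ ∞ f halfPlane ∧ ∀ z ∉ halfPlane, f z = 0}
  add_mem' := by
    rintro f g ⟨hf, hf'⟩ ⟨hg, hg'⟩
    exact ⟨hf.add hg, fun z hz => by simp [hf' z hz, hg' z hz]⟩
  zero_mem' := ⟨contDiffOn_const, fun _ _ => rfl⟩
  smul_mem' := by
    rintro c f ⟨hf, hf'⟩
    exact ⟨hf.const_smul c, fun z hz => by simp [hf' z hz]⟩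

/-- The element of `C^∞(Π)` given by a function on `ℂ` which is smooth on `Π`. -/
def smoothFun.mk (f : ℂ → ℂ) (hf : ContDiffOn ℝ ∞ f halfPlane) : smoothFun :=
  ⟨(halfPlane : Set ℂ).indicator f,
    hf.congr fun _ hz => Set.indicator_of_mem hz f,
    fun _ hz => Set.indicator_of_notMem hz f⟩

theorem smoothFun.mk_apply {f : ℂ → ℂ} (hf : ContDiffOn ℝ ∞ f halfPlane) {z : ℂ}
    (hz : z ∈ halfPlane) : (smoothFun.mk f hf : ℂ → ℂ) z = f z :=
  Set.indicator_of_mem hz f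

theorem smoothFun.ext' {f g : smoothFun} (h : ∀ z ∈ halfPlane, (f : ℂ → ℂ) z = (g : ℂ → ℂ) z) :
    f = g := by
  ext z
  by_cases hz : z ∈ halfPlane
  · exact h z hz
  · rw [f.2.2 z hz, g.2.2 z hz]

theorem differentiableAt_smoothFun (f : smoothFun) {z : ℂ} (hz : z ∈ halfPlane) :
    DifferentiableAt ℝ (f : ℂ → ℂ) z :=
  ((f.2.1 z hz).contDiffAt (halfPlane.isOpen.mem_nhds hz)).differentiableAt (by simp)

theorem contDiffOn_fderiv_smoothFun (f : smoothFun) (v : ℂ) :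
    ContDiffOn ℝ ∞ (fun z => fderiv ℝ (f : ℂ → ℂ) z v) halfPlane :=
  (f.2.1.fderiv_of_isOpen halfPlane.isOpen (by simp)).clm_apply contDiffOn_const

/-- The directional derivative along `v`, as a linear operator on `C^∞(Π)`. -/
def dirDeriv (v : ℂ) : Module.End ℂ smoothFun where
  toFun f := smoothFun.mk (fun z => fderiv ℝ (f : ℂ → ℂ) z v) (contDiffOn_fderiv_smoothFun f v)
  map_add' f g := smoothFun.ext' fun z hz => by
    have h := fderiv_add (differentiableAt_smoothFun f hz) (differentiableAt_smoothFun g hz)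
    refine (smoothFun.mk_apply _ hz).trans (Eq.trans ?_ (congrArg₂ (· + ·)
      (smoothFun.mk_apply (contDiffOn_fderiv_smoothFun f v) hz)
      (smoothFun.mk_apply (contDiffOn_fderiv_smoothFun g v) hz)).symm)
    exact congrArg (fun L : ℂ →L[ℝ] ℂ => L v) h
  map_smul' c f := smoothFun.ext' fun z hz => by
    have h := fderiv_const_smul (differentiableAt_smoothFun f hz) c
    refine (smoothFun.mk_apply _ hz).trans (Eq.trans ?_ (congrArg (c * ·)
      (smoothFun.mk_apply (contDiffOn_fderiv_smoothFun f v) hz)).symm)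
    exact congrArg (fun L : ℂ →L[ℝ] ℂ => L v) h

/-- The Wirtinger derivative `∂ = (∂_x - i ∂_y) / 2`. -/
def del : Module.End ℂ smoothFun := (1 / 2 : ℂ) • (dirDeriv 1 - I • dirDeriv I)

/-- The Wirtinger derivative `∂̄ = (∂_x + i ∂_y) / 2`. -/
def delbar : Module.End ℂ smoothFun := (1 / 2 : ℂ) • (dirDeriv 1 + I • dirDeriv I)

/-- The Laplacian `Δ = ∂_x² + ∂_y²`. -/
def laplace : Module.End ℂ smoothFun := dirDeriv 1 ^ 2 + dirDeriv I ^ 2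

theorem contDiffOn_im_mul (f : smoothFun) :
    ContDiffOn ℝ ∞ (fun z : ℂ => (z.im : ℂ) * (f : ℂ → ℂ) z) halfPlane :=
  (Complex.ofRealCLM.comp Complex.imCLM).contDiff.contDiffOn.mul f.2.1

/-- Multiplication by the coordinate `y = Im z`. -/
def mulY : Module.End ℂ smoothFun where
  toFun f := smoothFun.mk (fun z => (z.im : ℂ) * (f : ℂ → ℂ) z) (contDiffOn_im_mul f)
  map_add' f g := smoothFun.ext' fun z hz => by
    refine (smoothFun.mk_apply _ hz).trans (Eq.trans ?_ (congrArg₂ (· + ·)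
      (smoothFun.mk_apply (contDiffOn_im_mul f) hz)
      (smoothFun.mk_apply (contDiffOn_im_mul g) hz)).symm)
    exact mul_add _ _ _
  map_smul' c f := smoothFun.ext' fun z hz => by
    refine (smoothFun.mk_apply _ hz).trans (Eq.trans ?_ (congrArg (c * ·)
      (smoothFun.mk_apply (contDiffOn_im_mul f) hz)).symm)
    exact mul_left_comm _ _ _

/-- The product `f ḡ`. -/
def mulConj (f g : smoothFun) : smoothFun :=
  smoothFun.mk (fun z => (f : ℂ → ℂ) z * (starRingEnd ℂ) ((g : ℂ → ℂ) z))
    (f.2.1.mul (Complex.conjCLE.contDiff.comp_contDiffOn g.2.1))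

/-! ### Poly-Bergman spaces and the creation operator -/

/-- The poly-Bergman space `A_n`: the square integrable `f` on `Π` with `∂̄ⁿ f = 0`. -/
def polyBergman (n : ℕ) : Submodule ℂ L2 where
  carrier := {u | ∃ f : smoothFun, (delbar ^ n) f = 0 ∧ (u : ℂ → ℂ) =ᵐ[area] f}
  add_mem' := by
    rintro u v ⟨f, hf, huf⟩ ⟨g, hg, hvg⟩
    exact ⟨f + g, by simp [hf, hg], (Lp.coeFn_add u v).trans (huf.add hvg)⟩
  zero_mem' := ⟨0, by simp, Lp.coeFn_zero ℂ 2 area⟩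
  smul_mem' := by
    rintro c u ⟨f, hf, huf⟩
    exact ⟨c • f, by simp [hf], (Lp.coeFn_smul c u).trans (huf.const_smul c)⟩

/-- The true poly-Bergman space `A_(n) = A_n ⊖ A_{n-1}`, for `n ≥ 1`.
Since `A_0 = 0`, this gives `A_(1) = A_1`. -/
def trueBergman (n : ℕ) : Submodule ℂ L2 := polyBergman n ⊓ (polyBergman (n - 1))ᗮ

theorem polyBergman_zero : polyBergman 0 = ⊥ := by
  refine (Submodule.eq_bot_iff _).2 ?_
  rintro u ⟨f, hf, huf⟩
  have hf' : f = 0 := by simpa using hf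
  subst hf'
  exact Lp.ext (huf.trans (Lp.coeFn_zero ℂ 2 area).symm)

theorem trueBergman_one : trueBergman 1 = polyBergman 1 := by
  simp [trueBergman, polyBergman_zero]

/-- The creation operator `S^j f = ∂^j [(z - z̄)^j f] / j!`, where `z - z̄ = 2 i y`. -/
def creation (j : ℕ) : Module.End ℂ smoothFun :=
  ((j.factorial : ℂ)⁻¹) • (del ^ j * ((2 * I) • mulY) ^ j)

theorem one_sub_ne_zero {z : ℂ} (hz : z ∈ halfPlane) : 1 - I * z ≠ 0 := by
  intro h
  have h1 : 0 < z.im := hz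
  have h2 := congrArg Complex.re h
  simp at h2
  linarith

/-- The standard orthonormal basis `e_n(z) = 2 √((n+1)/π) (z - i)^n / (1 - i z)^(n+2)` of `A_1`,
the image of the normalized monomials on the disk under the Möbius transform. -/
def basisFun (n : ℕ) : smoothFun :=
  smoothFun.mk
    (fun z => ((2 * Real.sqrt ((n + 1) / Real.pi) : ℝ) : ℂ) * (z - I) ^ n / (1 - I * z) ^ (n + 2))
    (by
      have h1 : ContDiff ℂ ∞ fun z : ℂ =>
          ((2 * Real.sqrt ((n + 1) / Real.pi) : ℝ) : ℂ) * (z - I) ^ n := by fun_prop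
      have h2 : ContDiff ℂ ∞ fun z : ℂ => (1 - I * z) ^ (n + 2) := by fun_prop
      exact (h1.contDiffOn.div h2.contDiffOn
        fun z hz => pow_ne_zero _ (one_sub_ne_zero hz)).restrict_scalars ℝ)

/-- The linear span of the standard basis. -/
def basisSpan : Submodule ℂ smoothFun := Submodule.span ℂ (Set.range basisFun)

/-! ### Symbols: distributions acting on a larger space of functions -/

/-- The space `C^∞(closure Π) ∩ L¹(Π)`. -/
def smoothL1 : Submodule ℂ smoothFun where
  carrier := {f | (∃ g : ℂ → ℂ, ContDiffOn ℝ ∞ g {z | 0 ≤ z.im} ∧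
      ∀ z ∈ halfPlane, (f : ℂ → ℂ) z = g z) ∧ Integrable (f : ℂ → ℂ) area}
  add_mem' := by
    rintro f f' ⟨⟨g, hg, hfg⟩, hf⟩ ⟨⟨g', hg', hfg'⟩, hf'⟩
    exact ⟨⟨g + g', hg.add hg', fun z hz => by simp [hfg z hz, hfg' z hz]⟩, hf.add hf'⟩
  zero_mem' := ⟨⟨0, contDiffOn_const, fun _ _ => rfl⟩, integrable_zero ℂ ℂ area⟩
  smul_mem' := by
    rintro c f ⟨⟨g, hg, hfg⟩, hf⟩
    exact ⟨⟨c • g, hg.const_smul c, fun z hz => by simp [hfg z hz]⟩, hf.smul c⟩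

/-- A real test function on `Π`, seen as an element of `C^∞(Π)`. -/
def ofTest (φ : 𝓓(halfPlane, ℝ)) : smoothFun :=
  smoothFun.mk (fun z => ((φ z : ℝ) : ℂ))
    (Complex.ofRealCLM.contDiff.comp φ.contDiff).contDiffOn

/-- A distribution on `Π` which is defined at least on `C^∞(closure Π) ∩ L¹(Π)`: a linear
functional `a` on a space of smooth functions that contains `C^∞(closure Π) ∩ L¹(Π)`, and whose
restriction to the test functions is a distribution (an element of `𝓓'(Π)`). -/
structure IsSymbol (a : smoothFun →ₗ.[ℂ] ℂ) : Prop where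
  le_domain : smoothL1 ≤ a.domain
  exists_distribution : ∃ T : 𝓓'(halfPlane, ℂ), ∀ φ : 𝓓(halfPlane, ℝ),
    ∃ h : ofTest φ ∈ a.domain, a ⟨ofTest φ, h⟩ = T φ

/-- The functional `φ ↦ (a, D φ)`, with the domain of all `φ` for which `(a, D φ)` is defined. -/
def transposeAct (D : Module.End ℂ smoothFun) (a : smoothFun →ₗ.[ℂ] ℂ) :
    smoothFun →ₗ.[ℂ] ℂ where
  domain := a.domain.comap D
  toFun := a.toFun ∘ₗ D.restrict (p := a.domain.comap D) (q := a.domain) fun _ h => h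

/-- The transposes (on functions) of the operators `a ↦ Δ(y² a)`, `a ↦ ∂̄(y a)`, `a ↦ ∂(y a)`
(on distributions): these are `y² Δ`, `-y ∂̄`, `-y ∂`. -/
def genTranspose : Fin 3 → Module.End ℂ smoothFun :=
  ![mulY ^ 2 * laplace, -(mulY * delbar), -(mulY * del)]

/-- The transpose of the differential operator `P(Δ(y² ·), ∂̄(y ·), ∂(y ·))`, for a polynomial `P`
in three noncommuting variables. Transposition reverses the order of the factors, so this is the
value of an algebra homomorphism to the opposite algebra. -/
def polyTranspose (P : FreeAlgebra ℂ (Fin 3)) : Module.End ℂ smoothFun :=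
  (FreeAlgebra.lift ℂ (fun i => MulOpposite.op (genTranspose i)) P).unop

/-- The distribution `K a`, with `K = P(Δ(y² ·), ∂̄(y ·), ∂(y ·))`. -/
def polyAct (P : FreeAlgebra ℂ (Fin 3)) (a : smoothFun →ₗ.[ℂ] ℂ) : smoothFun →ₗ.[ℂ] ℂ :=
  transposeAct (polyTranspose P) a

/-- The degree of a polynomial in noncommuting variables: the largest length of a monomial. -/
def ncDegree (P : FreeAlgebra ℂ (Fin 3)) : ℕ :=
  (FreeAlgebra.equivMonoidAlgebraFreeMonoid P).coeff.support.sup FreeMonoid.length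

/-! ### Toeplitz operators -/

/-- The sesquilinear form `F_a[u, v] = (a, u v̄)`, for `u = S^j f`, `v = S^j g` with `f, g` in the
linear span of the standard basis of `A_1`, is defined and bounded. -/
def FormBounded (j : ℕ) (a : smoothFun →ₗ.[ℂ] ℂ) : Prop :=
  ∃ C : ℝ≥0, ∀ f ∈ basisSpan, ∀ g ∈ basisSpan,
    ∃ h : mulConj (creation j f) (creation j g) ∈ a.domain,
      ‖a ⟨mulConj (creation j f) (creation j g), h⟩‖ₑ ≤
        C * eLpNorm (creation j f : ℂ → ℂ) 2 area * eLpNorm (creation j g : ℂ → ℂ) 2 area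

/-- The bounded operator `T` is the Toeplitz operator `T_a` on `A_(j+1)`: it satisfies
`⟨T u, v⟩ = (a, u v̄)` for all `u = S^j f`, `v = S^j g` with `f, g` in the linear span of the
standard basis of `A_1`. -/
def IsToeplitz (j : ℕ) (a : smoothFun →ₗ.[ℂ] ℂ)
    (T : trueBergman (j + 1) →L[ℂ] trueBergman (j + 1)) : Prop :=
  ∀ f ∈ basisSpan, ∀ g ∈ basisSpan, ∀ u v : trueBergman (j + 1),
    ((u : L2) : ℂ → ℂ) =ᵐ[area] creation j f → ((v : L2) : ℂ → ℂ) =ᵐ[area] creation j g →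
      ∃ h : mulConj (creation j f) (creation j g) ∈ a.domain,
        ⟪v, T u⟫_ℂ = a ⟨mulConj (creation j f) (creation j g), h⟩

/-! ### Operator classes -/

section OperatorClasses

variable {H : Type*} [NormedAddCommGroup H] [InnerProductSpace ℂ H]

/-- The operator has finite rank. -/
def IsFiniteRank (T : H →L[ℂ] H) : Prop :=
  FiniteDimensional ℂ (LinearMap.range (T : H →ₗ[ℂ] H))

/-- The singular number `s_n(T)`, `n = 0, 1, …`: the distance from `T` to the operators of rank at
most `n`. -/
def singularNumber (T : H →L[ℂ] H) (n : ℕ) : ℝ :=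
  sInf {r : ℝ | ∃ F : H →L[ℂ] H, IsFiniteRank F ∧
    Module.finrank ℂ (LinearMap.range (F : H →ₗ[ℂ] H)) ≤ n ∧ r = ‖T - F‖}

/-- The operator belongs to the Schatten class `𝔖_p`, `0 < p < ∞`: `∑ s_n(T)^p < ∞`. -/
def IsSchatten (p : ℝ) (T : H →L[ℂ] H) : Prop :=
  Summable fun n : ℕ => singularNumber T n ^ p

end OperatorClasses

end PolyBergman

end

open PolyBergman

/-!
Everything rests on one pointwise identity. For holomorphic `f` and `g`, moving the powers of `y` to
the left of those of `∂` turns `S^j f` into a combination of the terms `y^k ∂^k f`, `k ≤ j`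
(`creation_eq_sum`). Hence `S^j f \overline{S^j g}` is a combination of the mixed terms
`y^(k+m) ∂^k f \overline{∂^m g}`, and the transposed generators `y² Δ`, `-y ∂̄`, `-y ∂` act on these
by raising `k`, or `m`, or both, up to terms of lower order. Inverting these recursions gives a
polynomial in the generators which maps `f ḡ` to a given mixed term (`mixedPoly`), and so a
polynomial `P_j` with `P_j^t (f ḡ) = S^j f \overline{S^j g}` (`polyTranspose_creationPoly`). Its
degree is `j`, because the word `(y² Δ)^j` occurs in the mixed term `k = m = j` alone. The values of
`a` and `K_(j) a` on these products therefore agree for every symbol `a`.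

It remains to see that `S^j` is unitary from `A_1` onto `A_(j+1)`.

* Isometry. The span of the standard basis is also the span of the functions `(z + i)^(-a)`,
  `a ≥ 2` (`basisSpan_eq`). On these, integration by parts in `x` and in `y` reduces all inner
  products of `S^j f` and `S^k g` to that of `f` and `g`, with a numerical factor which is an
  alternating sum of binomial coefficients, equal to `1` for `j = k` and to `0` otherwise
  (`integral_creation_poleFun`).
* Completeness. The functions `y^s (z + i)^(-a)` with `s ≤ N` are combinations of `S^k f`, `k ≤ N`.
  An element of `A_(N+1)` orthogonal to all of them vanishes (`eq_zero_of_inner_ratFun`): the Cayley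
  transform makes it a polyanalytic function on the disk, orthogonal to the monomials `w^p w̄^q`
  with `q ≤ N`. On the circle of radius `r` each Fourier coefficient of such a function is a polynomial
  in `r`, orthogonal to every monomial that occurs in it, hence zero.
* Extension to `A_1`. The mean value property bounds point evaluations, so convergence in `L²(Π)` of
  holomorphic functions implies pointwise convergence of all their derivatives
  (`exists_holomorphic_limit`). Thus `A_1` is the closure of the span of the standard basis, and the
  continuous extension of `S^j` is still given by the differential operator. The spaces `S^k A_1`
  are mutually orthogonal, and `A_n` is the sum of those with `k < n` (`eq_sum_starProjection`), whence
  `S^j A_1 = A_(j+1)`.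

A bounded form on a dense subspace of a Hilbert space is given by a unique bounded operator, so
conjugation by `S^j` identifies the two Toeplitz operators, and it preserves each of the operator
classes.
-/

noncomputable section

namespace PolyBergman

/-! ### Calculus on the half-plane -/

theorem mem_halfPlane {z : ℂ} : z ∈ halfPlane ↔ 0 < z.im := Iff.rfl

theorem measurableSet_halfPlane : MeasurableSet (halfPlane : Set ℂ) :=
  halfPlane.isOpen.measurableSet

theorem fderiv_eq_of_eqOn_halfPlane {f g : ℂ → ℂ} (h : ∀ z ∈ halfPlane, f z = g z) {z : ℂ}
    (hz : z ∈ halfPlane) : fderiv ℝ f z = fderiv ℝ g z :=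
  Filter.EventuallyEq.fderiv_eq (Filter.eventually_of_mem (halfPlane.isOpen.mem_nhds hz) h)

theorem dirDeriv_apply (v : ℂ) (f : smoothFun) {z : ℂ} (hz : z ∈ halfPlane) :
    (dirDeriv v f : ℂ → ℂ) z = fderiv ℝ (f : ℂ → ℂ) z v :=
  smoothFun.mk_apply (contDiffOn_fderiv_smoothFun f v) hz

theorem mulY_apply (f : smoothFun) {z : ℂ} (hz : z ∈ halfPlane) :
    (mulY f : ℂ → ℂ) z = z.im * (f : ℂ → ℂ) z :=
  smoothFun.mk_apply (contDiffOn_im_mul f) hz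

theorem mulConj_apply (f g : smoothFun) {z : ℂ} (hz : z ∈ halfPlane) :
    (mulConj f g : ℂ → ℂ) z = (f : ℂ → ℂ) z * (starRingEnd ℂ) ((g : ℂ → ℂ) z) :=
  smoothFun.mk_apply _ hz

theorem mulY_pow_apply (n : ℕ) (f : smoothFun) {z : ℂ} (hz : z ∈ halfPlane) :
    ((mulY ^ n) f : ℂ → ℂ) z = (z.im : ℂ) ^ n * (f : ℂ → ℂ) z := by
  induction n with
  | zero => simp
  | succ n ih => rw [pow_succ', Module.End.mul_apply, mulY_apply _ hz, ih]; ring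

theorem del_apply (f : smoothFun) {z : ℂ} (hz : z ∈ halfPlane) :
    (del f : ℂ → ℂ) z =
      1 / 2 * (fderiv ℝ (f : ℂ → ℂ) z 1 - I * fderiv ℝ (f : ℂ → ℂ) z I) := by
  rw [← dirDeriv_apply 1 f hz, ← dirDeriv_apply I f hz]; rfl

theorem delbar_apply (f : smoothFun) {z : ℂ} (hz : z ∈ halfPlane) :
    (delbar f : ℂ → ℂ) z =
      1 / 2 * (fderiv ℝ (f : ℂ → ℂ) z 1 + I * fderiv ℝ (f : ℂ → ℂ) z I) := by
  rw [← dirDeriv_apply 1 f hz, ← dirDeriv_apply I f hz]; rfl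

theorem dirDeriv_comm (v w : ℂ) (f : smoothFun) :
    dirDeriv v (dirDeriv w f) = dirDeriv w (dirDeriv v f) := by
  have key : ∀ v w : ℂ, ∀ z ∈ halfPlane, (dirDeriv v (dirDeriv w f) : ℂ → ℂ) z =
      fderiv ℝ (fderiv ℝ (f : ℂ → ℂ)) z v w := by
    intro v w z hz
    rw [dirDeriv_apply v _ hz, fderiv_eq_of_eqOn_halfPlane (fun z hz => dirDeriv_apply w f hz) hz]
    have hd : DifferentiableAt ℝ (fderiv ℝ (f : ℂ → ℂ)) z :=
      (((f.2.1.fderiv_of_isOpen halfPlane.isOpen (by simp) :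
        ContDiffOn ℝ ∞ (fderiv ℝ (f : ℂ → ℂ)) halfPlane) z hz).contDiffAt
        (halfPlane.isOpen.mem_nhds hz)).differentiableAt (by simp)
    rw [fderiv_clm_apply hd (differentiableAt_const w)]
    simp
  refine smoothFun.ext' fun z hz => ?_
  rw [key v w z hz, key w v z hz]
  have hc : ContDiffAt ℝ ∞ (f : ℂ → ℂ) z := (f.2.1 z hz).contDiffAt (halfPlane.isOpen.mem_nhds hz)
  exact (hc.isSymmSndFDerivAt (by
    rw [minSmoothness_of_isRCLikeNormedField]
    exact WithTop.coe_le_coe.2 (le_top : (2 : ℕ∞) ≤ ⊤))) v w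

theorem del_delbar (f : smoothFun) : del (delbar f) = (1 / 4 : ℂ) • laplace f := by
  simp only [del, delbar, laplace, LinearMap.smul_apply, LinearMap.sub_apply, LinearMap.add_apply,
    map_smul, map_add, pow_two, Module.End.mul_apply]
  rw [dirDeriv_comm I 1 f]
  match_scalars
  · norm_num
  · ring
  · linear_combination (-1 / 4 : ℂ) * I_mul_I

theorem delbar_del (f : smoothFun) : delbar (del f) = (1 / 4 : ℂ) • laplace f := by
  simp only [del, delbar, laplace, LinearMap.smul_apply, LinearMap.sub_apply, LinearMap.add_apply,
    map_smul, map_sub, pow_two, Module.End.mul_apply]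
  rw [dirDeriv_comm I 1 f]
  match_scalars
  · norm_num
  · ring
  · linear_combination (-1 / 4 : ℂ) * I_mul_I

theorem del_delbar_comm (f : smoothFun) : del (delbar f) = delbar (del f) := by
  rw [del_delbar, delbar_del]

theorem laplace_eq (f : smoothFun) : laplace f = (4 : ℂ) • delbar (del f) := by
  rw [delbar_del, smul_smul]; norm_num

theorem fderiv_mulY (f : smoothFun) {z : ℂ} (hz : z ∈ halfPlane) (v : ℂ) :
    fderiv ℝ (mulY f : ℂ → ℂ) z v =
      v.im * (f : ℂ → ℂ) z + z.im * fderiv ℝ (f : ℂ → ℂ) z v := by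
  rw [fderiv_eq_of_eqOn_halfPlane (fun z hz => mulY_apply f hz) hz]
  have h1 : HasFDerivAt (fun z : ℂ => (z.im : ℂ)) (Complex.ofRealCLM.comp Complex.imCLM) z :=
    (Complex.ofRealCLM.comp Complex.imCLM).hasFDerivAt
  have h2 := (h1.mul (differentiableAt_smoothFun f hz).hasFDerivAt).fderiv
  change fderiv ℝ (fun z : ℂ => (z.im : ℂ) * (f : ℂ → ℂ) z) z = _ at h2
  rw [h2]
  simp
  ring

theorem del_mulY (f : smoothFun) : del (mulY f) = mulY (del f) - (I / 2) • f := by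
  refine smoothFun.ext' fun z hz => ?_
  change _ = (mulY (del f) : ℂ → ℂ) z - I / 2 * (f : ℂ → ℂ) z
  rw [del_apply _ hz, mulY_apply _ hz, del_apply _ hz, fderiv_mulY f hz, fderiv_mulY f hz]
  simp
  ring

theorem delbar_mulY (f : smoothFun) : delbar (mulY f) = mulY (delbar f) + (I / 2) • f := by
  refine smoothFun.ext' fun z hz => ?_
  change _ = (mulY (delbar f) : ℂ → ℂ) z + I / 2 * (f : ℂ → ℂ) z
  rw [delbar_apply _ hz, mulY_apply _ hz, delbar_apply _ hz, fderiv_mulY f hz, fderiv_mulY f hz]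
  simp
  ring

theorem fderiv_mulConj (f g : smoothFun) {z : ℂ} (hz : z ∈ halfPlane) (v : ℂ) :
    fderiv ℝ (mulConj f g : ℂ → ℂ) z v =
      fderiv ℝ (f : ℂ → ℂ) z v * (starRingEnd ℂ) ((g : ℂ → ℂ) z) +
        (f : ℂ → ℂ) z * (starRingEnd ℂ) (fderiv ℝ (g : ℂ → ℂ) z v) := by
  rw [fderiv_eq_of_eqOn_halfPlane (fun z hz => mulConj_apply f g hz) hz]
  have h1 := (Complex.conjCLE : ℂ →L[ℝ] ℂ).hasFDerivAt.comp z
    (differentiableAt_smoothFun g hz).hasFDerivAt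
  have h2 := (differentiableAt_smoothFun f hz).hasFDerivAt.mul h1
  have h3 := h2.fderiv
  change fderiv ℝ (fun z => (f : ℂ → ℂ) z * (starRingEnd ℂ) ((g : ℂ → ℂ) z)) z = _ at h3
  rw [h3]
  simp
  ring

theorem del_mulConj (f g : smoothFun) :
    del (mulConj f g) = mulConj (del f) g + mulConj f (delbar g) := by
  refine smoothFun.ext' fun z hz => ?_
  change _ = (mulConj (del f) g : ℂ → ℂ) z + (mulConj f (delbar g) : ℂ → ℂ) z
  rw [del_apply _ hz, mulConj_apply _ _ hz, mulConj_apply _ _ hz, del_apply _ hz,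
    delbar_apply _ hz, fderiv_mulConj f g hz, fderiv_mulConj f g hz]
  have h2 : (starRingEnd ℂ) 2 = 2 := map_ofNat _ 2
  simp [h2]
  ring

theorem delbar_mulConj (f g : smoothFun) :
    delbar (mulConj f g) = mulConj (delbar f) g + mulConj f (del g) := by
  refine smoothFun.ext' fun z hz => ?_
  change _ = (mulConj (delbar f) g : ℂ → ℂ) z + (mulConj f (del g) : ℂ → ℂ) z
  rw [delbar_apply _ hz, mulConj_apply _ _ hz, mulConj_apply _ _ hz, del_apply _ hz,
    delbar_apply _ hz, fderiv_mulConj f g hz, fderiv_mulConj f g hz]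
  have h2 : (starRingEnd ℂ) 2 = 2 := map_ofNat _ 2
  simp [h2]
  ring

theorem mulConj_add_left (f f' g : smoothFun) :
    mulConj (f + f') g = mulConj f g + mulConj f' g := by
  refine smoothFun.ext' fun z hz => ?_
  change _ = (mulConj f g : ℂ → ℂ) z + (mulConj f' g : ℂ → ℂ) z
  simp only [mulConj_apply _ _ hz]
  exact add_mul _ _ _

theorem mulConj_add_right (f g g' : smoothFun) :
    mulConj f (g + g') = mulConj f g + mulConj f g' := by
  refine smoothFun.ext' fun z hz => ?_
  change _ = (mulConj f g : ℂ → ℂ) z + (mulConj f g' : ℂ → ℂ) z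
  simp only [mulConj_apply _ _ hz]
  change _ * (starRingEnd ℂ) ((g : ℂ → ℂ) z + (g' : ℂ → ℂ) z) = _
  rw [map_add, mul_add]

theorem mulConj_smul_left (c : ℂ) (f g : smoothFun) :
    mulConj (c • f) g = c • mulConj f g := by
  refine smoothFun.ext' fun z hz => ?_
  change _ = c * (mulConj f g : ℂ → ℂ) z
  simp only [mulConj_apply _ _ hz]
  exact mul_assoc _ _ _

theorem mulConj_smul_right (c : ℂ) (f g : smoothFun) :
    mulConj f (c • g) = (starRingEnd ℂ) c • mulConj f g := by
  refine smoothFun.ext' fun z hz => ?_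
  change _ = (starRingEnd ℂ) c * (mulConj f g : ℂ → ℂ) z
  simp only [mulConj_apply _ _ hz]
  change _ * (starRingEnd ℂ) (c * (g : ℂ → ℂ) z) = _
  rw [map_mul]; ring

/-- The sesquilinear map `(f, g) ↦ f ḡ`. -/
def mulConjₛₗ : smoothFun →ₗ[ℂ] smoothFun →ₛₗ[starRingEnd ℂ] smoothFun :=
  LinearMap.mk₂'ₛₗ (RingHom.id ℂ) (starRingEnd ℂ) mulConj mulConj_add_left mulConj_smul_left
    mulConj_add_right mulConj_smul_right

theorem mulConjₛₗ_apply (f g : smoothFun) : mulConjₛₗ f g = mulConj f g := rfl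

theorem mulConj_zero_left (g : smoothFun) : mulConj 0 g = 0 := by
  rw [← mulConjₛₗ_apply, map_zero, LinearMap.zero_apply]

theorem mulConj_zero_right (f : smoothFun) : mulConj f 0 = 0 := by
  rw [← mulConjₛₗ_apply, map_zero]

theorem mulConj_mulY_pow (k m : ℕ) (f g : smoothFun) :
    mulConj ((mulY ^ k) f) ((mulY ^ m) g) = (mulY ^ (k + m)) (mulConj f g) := by
  refine smoothFun.ext' fun z hz => ?_
  rw [mulConj_apply _ _ hz, mulY_pow_apply _ _ hz, mulY_pow_apply _ _ hz, mulY_pow_apply _ _ hz,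
    mulConj_apply _ _ hz]
  simp
  ring

theorem del_mulY_pow (s : ℕ) (f : smoothFun) :
    del ((mulY ^ (s + 1)) f) = (mulY ^ (s + 1)) (del f) - ((s + 1) * (I / 2)) • (mulY ^ s) f := by
  induction s generalizing f with
  | zero => simp [del_mulY]
  | succ s ih =>
    rw [pow_succ mulY (s + 1), Module.End.mul_apply, ih, del_mulY, map_sub, map_smul,
      Module.End.mul_apply, ← Module.End.mul_apply (mulY ^ s), ← pow_succ]
    push_cast
    module

theorem delbar_mulY_pow (s : ℕ) (f : smoothFun) :
    delbar ((mulY ^ (s + 1)) f) =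
      (mulY ^ (s + 1)) (delbar f) + ((s + 1) * (I / 2)) • (mulY ^ s) f := by
  induction s generalizing f with
  | zero => simp [delbar_mulY]
  | succ s ih =>
    rw [pow_succ mulY (s + 1), Module.End.mul_apply, ih, delbar_mulY, map_add, map_smul,
      Module.End.mul_apply, ← Module.End.mul_apply (mulY ^ s), ← pow_succ]
    push_cast
    module

theorem mulY_del_mulY_pow (s : ℕ) (f : smoothFun) :
    mulY (del ((mulY ^ s) f)) = (mulY ^ (s + 1)) (del f) - (s * (I / 2)) • (mulY ^ s) f := by
  cases s with
  | zero => simp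
  | succ s =>
    rw [del_mulY_pow, map_sub, map_smul, ← Module.End.mul_apply, ← Module.End.mul_apply mulY,
      ← pow_succ', ← pow_succ']
    push_cast
    rfl

theorem mulY_delbar_mulY_pow (s : ℕ) (f : smoothFun) :
    mulY (delbar ((mulY ^ s) f)) =
      (mulY ^ (s + 1)) (delbar f) + (s * (I / 2)) • (mulY ^ s) f := by
  cases s with
  | zero => simp
  | succ s =>
    rw [delbar_mulY_pow, map_add, map_smul, ← Module.End.mul_apply, ← Module.End.mul_apply mulY,
      ← pow_succ', ← pow_succ']
    push_cast
    rfl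

/-- The Cauchy–Riemann equation. -/
theorem delbar_eq_zero_iff (f : smoothFun) :
    delbar f = 0 ↔ DifferentiableOn ℂ (f : ℂ → ℂ) halfPlane := by
  constructor
  · intro h z hz
    refine (differentiableAt_complex_iff_differentiableAt_real.2
      ⟨differentiableAt_smoothFun f hz, ?_⟩).differentiableWithinAt
    have h1 := delbar_apply f hz
    rw [h] at h1
    have h2 : fderiv ℝ (f : ℂ → ℂ) z 1 + I * fderiv ℝ (f : ℂ → ℂ) z I = 0 := by
      have : (0 : ℂ) = 1 / 2 * (fderiv ℝ (f : ℂ → ℂ) z 1 + I * fderiv ℝ (f : ℂ → ℂ) z I) := h1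
      linear_combination -2 * this
    rw [smul_eq_mul]
    linear_combination -I * h2 + (fderiv ℝ (f : ℂ → ℂ) z I) * I_mul_I
  · intro h
    refine smoothFun.ext' fun z hz => ?_
    have h1 := (differentiableAt_complex_iff_differentiableAt_real.1
      ((h z hz).differentiableAt (halfPlane.isOpen.mem_nhds hz))).2
    rw [delbar_apply f hz, h1, smul_eq_mul]
    change _ = (0 : ℂ)
    linear_combination (1 / 2) * (fderiv ℝ (f : ℂ → ℂ) z 1) * I_mul_I

theorem del_eq_deriv {f : smoothFun} (hf : delbar f = 0) {z : ℂ} (hz : z ∈ halfPlane) :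
    (del f : ℂ → ℂ) z = deriv (f : ℂ → ℂ) z := by
  have h0 := ((delbar_eq_zero_iff f).1 hf z hz).differentiableAt (halfPlane.isOpen.mem_nhds hz)
  have h1 := (differentiableAt_complex_iff_differentiableAt_real.1 h0).2
  rw [del_apply f hz, h1, smul_eq_mul]
  have h2 : fderiv ℝ (f : ℂ → ℂ) z 1 = deriv (f : ℂ → ℂ) z := by
    rw [h0.fderiv_restrictScalars ℝ]; simp
  rw [h2]
  linear_combination (-1 / 2) * (deriv (f : ℂ → ℂ) z) * I_mul_I

theorem delbar_del_pow {f : smoothFun} (hf : delbar f = 0) (k : ℕ) :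
    delbar ((del ^ k) f) = 0 := by
  induction k with
  | zero => simpa using hf
  | succ k ih => rw [pow_succ', Module.End.mul_apply, ← del_delbar_comm, ih, map_zero]

/-- A holomorphic function on the half-plane, as an element of `C^∞(Π)`. -/
def smoothFun.ofHolo (f : ℂ → ℂ) (hf : DifferentiableOn ℂ f halfPlane) : smoothFun :=
  smoothFun.mk f ((hf.contDiffOn halfPlane.isOpen).restrict_scalars ℝ)

theorem smoothFun.ofHolo_apply {f : ℂ → ℂ} (hf : DifferentiableOn ℂ f halfPlane) {z : ℂ}
    (hz : z ∈ halfPlane) : (smoothFun.ofHolo f hf : ℂ → ℂ) z = f z :=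
  smoothFun.mk_apply _ hz

theorem delbar_ofHolo {f : ℂ → ℂ} (hf : DifferentiableOn ℂ f halfPlane) :
    delbar (smoothFun.ofHolo f hf) = 0 :=
  (delbar_eq_zero_iff _).2 (hf.congr fun _ hz => smoothFun.ofHolo_apply hf hz)

/-! ### The creation operator in normal order -/

/-- The coefficient of `y^k ∂^k` in the operator `S^j = ∂^j (2iy)^j / j!`, written with the powers
of `y` to the left of those of `∂`. -/
def creationCoeff (j k : ℕ) : ℂ := (j.choose k : ℂ) * (2 * I) ^ k / (k.factorial : ℂ)

/-- The Leibniz rule for `∂^n (y^m f)`, with `∂ y = -i/2`. -/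
theorem del_pow_mulY_pow (n m : ℕ) (f : smoothFun) :
    (del ^ n) ((mulY ^ m) f) = ∑ p ∈ Finset.HasAntidiagonal.antidiagonal n, n.choose p.1 •
      (((m.descFactorial p.1 : ℂ) * (-I / 2) ^ p.1) • (mulY ^ (m - p.1)) ((del ^ p.2) f)) := by
  induction n with
  | zero => simp
  | succ n ih =>
    rw [Finset.sum_antidiagonal_choose_succ_nsmul (fun i k =>
      ((m.descFactorial i : ℂ) * (-I / 2) ^ i) • (mulY ^ (m - i)) ((del ^ k) f)) n,
      pow_succ' del n, Module.End.mul_apply, ih, map_sum, ← Finset.sum_add_distrib]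
    refine Finset.sum_congr rfl fun p hp => ?_
    have hch : n.choose p.2 = n.choose p.1 :=
      (n.choose_symm_of_eq_add (Finset.HasAntidiagonal.mem_antidiagonal.1 hp).symm).symm
    rw [hch, map_nsmul, ← smul_add, map_smul, pow_succ' del p.2, Module.End.mul_apply]
    congr 1
    rw [Nat.descFactorial_succ]
    rcases Nat.lt_or_ge p.1 m with h | h
    · obtain ⟨s, hs⟩ := Nat.exists_eq_add_of_lt h
      have h1 : m - p.1 = s + 1 := by omega
      have h2 : m - (p.1 + 1) = s := by omega
      rw [h1, h2, del_mulY_pow]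
      push_cast
      module
    · have h1 : m - p.1 = 0 := by omega
      simp [h1]

/-- The normal ordered form of `S^j`. -/
theorem creation_eq_sum (j : ℕ) (f : smoothFun) :
    creation j f =
      ∑ k ∈ Finset.range (j + 1), creationCoeff j k • (mulY ^ k) ((del ^ k) f) := by
  have h0 : creation j f =
      ((j.factorial : ℂ)⁻¹ * (2 * I) ^ j) • (del ^ j) ((mulY ^ j) f) := by
    simp only [creation, LinearMap.smul_apply, Module.End.mul_apply, smul_pow, map_smul, smul_smul]
  rw [h0, del_pow_mulY_pow, ← Finset.Nat.sum_antidiagonal_swap,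
    Finset.Nat.sum_antidiagonal_eq_sum_range_succ_mk, Finset.smul_sum]
  refine Finset.sum_congr rfl fun k hk => ?_
  have hk' : k ≤ j := Nat.lt_succ_iff.1 (Finset.mem_range.1 hk)
  obtain ⟨i, rfl⟩ := Nat.exists_eq_add_of_le hk'
  simp only [Prod.swap]
  have e1 : k + i - k = i := by omega
  have e2 : k + i - (k + i - k) = k := by omega
  rw [e2, e1, ← Nat.cast_smul_eq_nsmul ℂ, smul_smul, smul_smul]
  congr 1
  have hd : (k.factorial : ℂ) * ((k + i).descFactorial i : ℂ) = ((k + i).factorial : ℂ) := by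
    have := Nat.factorial_mul_descFactorial (show i ≤ k + i by omega)
    rw [show k + i - i = k by omega] at this
    exact_mod_cast this
  have hc : (k + i).choose i = (k + i).choose k := by
    rw [add_comm, Nat.choose_symm_add]
  have hk0 : (k.factorial : ℂ) ≠ 0 := by exact_mod_cast k.factorial_ne_zero
  have hj0 : ((k + i).factorial : ℂ) ≠ 0 := by exact_mod_cast (k + i).factorial_ne_zero
  have hI : (2 * I) ^ i * (-I / 2) ^ i = 1 := by
    rw [← mul_pow, show 2 * I * (-I / 2) = 1 by linear_combination -I_mul_I, one_pow]
  have hd' : ((k + i).descFactorial i : ℂ) = (k + i).factorial * (k.factorial : ℂ)⁻¹ := by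
    rw [← hd]; field_simp
  have hj1 := mul_inv_cancel₀ hj0
  rw [creationCoeff, hc, pow_add, hd', div_eq_mul_inv]
  calc _ = ((k + i).choose k : ℂ) * (2 * I) ^ k * (k.factorial : ℂ)⁻¹ *
        (((k + i).factorial : ℂ) * ((k + i).factorial : ℂ)⁻¹) *
        ((2 * I) ^ i * (-I / 2) ^ i) := by ring
    _ = _ := by rw [hj1, hI, mul_one, mul_one, div_eq_mul_inv]

theorem creation_zero : creation 0 = 1 := by
  simp [creation]

/-! ### Polynomials in three noncommuting variables -/

/-- The coefficient of the word `w` in a polynomial in noncommuting variables. -/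
def ncCoeff (w : FreeMonoid (Fin 3)) : FreeAlgebra ℂ (Fin 3) →ₗ[ℂ] ℂ where
  toFun P := (FreeAlgebra.equivMonoidAlgebraFreeMonoid P).coeff w
  map_add' P Q := by simp
  map_smul' c P := by simp

theorem ncCoeff_mul_ι (P : FreeAlgebra ℂ (Fin 3)) (u : FreeMonoid (Fin 3)) (x y : Fin 3) :
    ncCoeff (u * .of y) (P * FreeAlgebra.ι ℂ x) = if x = y then ncCoeff u P else 0 := by
  have h : FreeAlgebra.equivMonoidAlgebraFreeMonoid (P * FreeAlgebra.ι ℂ x) =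
      FreeAlgebra.equivMonoidAlgebraFreeMonoid P * MonoidAlgebra.single (.of x) 1 := by
    rw [map_mul]; simp [FreeAlgebra.equivMonoidAlgebraFreeMonoid]
  simp only [ncCoeff, LinearMap.coe_mk, AddHom.coe_mk, h]
  split_ifs with hxy
  · subst hxy
    rw [MonoidAlgebra.coeff_mul_single_mul, mul_one]
  · refine MonoidAlgebra.coeff_mul_single_of_forall_mul_ne _ _ fun d hd => hxy ?_
    have h2 := congrArg FreeMonoid.toList hd
    simp only [FreeMonoid.toList_mul, FreeMonoid.toList_of] at h2
    have h3 := congrArg List.getLast? h2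
    simpa using h3

/-- The polynomials in noncommuting variables without monomials of length more than `n`. -/
def ncDegreeLE (n : ℕ) : Submodule ℂ (FreeAlgebra ℂ (Fin 3)) :=
  ⨅ w : {w : FreeMonoid (Fin 3) // n < w.length}, LinearMap.ker (ncCoeff w)

theorem mem_ncDegreeLE {n : ℕ} {P : FreeAlgebra ℂ (Fin 3)} :
    P ∈ ncDegreeLE n ↔ ∀ w : FreeMonoid (Fin 3), n < w.length → ncCoeff w P = 0 := by
  simp [ncDegreeLE, Submodule.mem_iInf]

theorem ncDegreeLE_mono {n m : ℕ} (h : n ≤ m) : ncDegreeLE n ≤ ncDegreeLE m := fun _ hP =>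
  mem_ncDegreeLE.2 fun w hw => mem_ncDegreeLE.1 hP w (h.trans_lt hw)

theorem mul_ι_mem_ncDegreeLE {n : ℕ} {P : FreeAlgebra ℂ (Fin 3)} (hP : P ∈ ncDegreeLE n)
    (x : Fin 3) : P * FreeAlgebra.ι ℂ x ∈ ncDegreeLE (n + 1) := by
  refine mem_ncDegreeLE.2 fun w hw => ?_
  obtain ⟨u, y, rfl⟩ : ∃ (u : FreeMonoid (Fin 3)) (y : Fin 3), w = u * .of y := by
    rcases List.eq_nil_or_concat w.toList with h | ⟨l, y, h⟩
    · have : w.length = 0 := congrArg List.length h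
      omega
    · exact ⟨.ofList l, y, FreeMonoid.toList.injective (by simpa using h)⟩
  rw [ncCoeff_mul_ι]
  split_ifs
  · refine mem_ncDegreeLE.1 hP u ?_
    simpa [FreeMonoid.length_mul] using hw
  · rfl

theorem one_mem_ncDegreeLE (n : ℕ) : (1 : FreeAlgebra ℂ (Fin 3)) ∈ ncDegreeLE n := by
  refine mem_ncDegreeLE.2 fun w hw => ?_
  have hw' : (1 : FreeMonoid (Fin 3)) ≠ w := by
    rintro rfl
    simp at hw
  simp [ncCoeff, MonoidAlgebra.one_def, hw']

theorem ncDegree_eq {n : ℕ} {P : FreeAlgebra ℂ (Fin 3)} (hP : P ∈ ncDegreeLE n)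
    {w : FreeMonoid (Fin 3)} (hw : w.length = n) (h0 : ncCoeff w P ≠ 0) : ncDegree P = n := by
  refine le_antisymm (Finset.sup_le fun v hv => ?_) ?_
  · by_contra hlt
    exact (Finsupp.mem_support_iff.1 hv) (mem_ncDegreeLE.1 hP v (not_le.1 hlt))
  · rw [← hw]
    exact Finset.le_sup (f := FreeMonoid.length) (Finsupp.mem_support_iff.2 h0)

theorem length_of_pow {α : Type*} (x : α) (n : ℕ) : (FreeMonoid.of x ^ n).length = n := by
  induction n with
  | zero => rfl
  | succ n ih => rw [pow_succ, FreeMonoid.length_mul, ih, FreeMonoid.length_of]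

theorem polyTranspose_one : polyTranspose 1 = 1 := by simp [polyTranspose]

theorem polyTranspose_mul_ι (P : FreeAlgebra ℂ (Fin 3)) (x : Fin 3) :
    polyTranspose (P * FreeAlgebra.ι ℂ x) = genTranspose x * polyTranspose P := by
  simp [polyTranspose]

theorem polyTranspose_add (P Q : FreeAlgebra ℂ (Fin 3)) :
    polyTranspose (P + Q) = polyTranspose P + polyTranspose Q := by
  simp [polyTranspose]

theorem polyTranspose_smul (c : ℂ) (P : FreeAlgebra ℂ (Fin 3)) :
    polyTranspose (c • P) = c • polyTranspose P := by
  simp [polyTranspose]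

/-- `polyTranspose` as a linear map. -/
def polyTransposeₗ : FreeAlgebra ℂ (Fin 3) →ₗ[ℂ] Module.End ℂ smoothFun where
  toFun := polyTranspose
  map_add' := polyTranspose_add
  map_smul' := polyTranspose_smul

/-! ### The operator `K` -/

/-- The term `y^(k+m) ∂^k f \overline{∂^m g}`. -/
def mixedTerm (f g : smoothFun) (k m : ℕ) : smoothFun :=
  (mulY ^ (k + m)) (mulConj ((del ^ k) f) ((del ^ m) g))

theorem mulY_del_mixedTerm (f : smoothFun) {g : smoothFun} (hg : delbar g = 0) (k m : ℕ) :
    mulY (del (mixedTerm f g k m)) =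
      mixedTerm f g (k + 1) m - ((k + m : ℕ) * (I / 2)) • mixedTerm f g k m := by
  rw [mixedTerm, mulY_del_mulY_pow, del_mulConj, delbar_del_pow hg, mulConj_zero_right, add_zero,
    ← Module.End.mul_apply del, ← pow_succ', mixedTerm, add_right_comm]

theorem mulY_delbar_mixedTerm {f : smoothFun} (hf : delbar f = 0) (g : smoothFun) (k m : ℕ) :
    mulY (delbar (mixedTerm f g k m)) =
      mixedTerm f g k (m + 1) + ((k + m : ℕ) * (I / 2)) • mixedTerm f g k m := by
  rw [mixedTerm, mulY_delbar_mulY_pow, delbar_mulConj, delbar_del_pow hf, mulConj_zero_left,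
    zero_add, ← Module.End.mul_apply del, ← pow_succ', mixedTerm, add_assoc]

theorem mulY_sq_laplace_mixedTerm {f g : smoothFun} (hf : delbar f = 0) (hg : delbar g = 0)
    (k m : ℕ) :
    (mulY ^ 2) (laplace (mixedTerm f g k m)) = (4 : ℂ) • mixedTerm f g (k + 1) (m + 1) -
      (2 * I * (k + m : ℕ)) • mixedTerm f g k (m + 1) +
      (2 * I * (k + m : ℕ)) • mixedTerm f g (k + 1) m +
      ((k + m : ℕ) * ((k + m : ℕ) - 1) : ℂ) • mixedTerm f g k m := by
  -- `y² ∂̄ ∂ = (y ∂̄ - i/2) (y ∂)`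
  have h1 : ∀ h : smoothFun, (mulY ^ 2) (laplace h) =
      (4 : ℂ) • (mulY (delbar (mulY (del h))) - (I / 2) • mulY (del h)) := by
    intro h
    rw [laplace_eq, delbar_mulY, map_smul, map_add, map_smul, pow_two, Module.End.mul_apply]
    module
  rw [h1, mulY_del_mixedTerm f hg, map_sub, map_sub, map_smul, map_smul,
    mulY_delbar_mixedTerm hf, mulY_delbar_mixedTerm hf]
  push_cast
  match_scalars
  · ring
  · ring
  · ring
  · linear_combination (-((k : ℂ) + m) * (k + m - 1)) * I_mul_I

/-- The polynomial that produces `y^(k+m) ∂^k f \overline{∂^m g}` from `f ḡ`; the recursion inverts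
the formulas for the action of the generators on the mixed terms. -/
def mixedPoly : ℕ → ℕ → FreeAlgebra ℂ (Fin 3)
  | 0, 0 => 1
  | k + 1, 0 => -(mixedPoly k 0 * FreeAlgebra.ι ℂ 2) + (k * (I / 2)) • mixedPoly k 0
  | 0, m + 1 => -(mixedPoly 0 m * FreeAlgebra.ι ℂ 1) - (m * (I / 2)) • mixedPoly 0 m
  | k + 1, m + 1 => (1 / 4 : ℂ) • (mixedPoly k m * FreeAlgebra.ι ℂ 0 +
      (2 * I * (k + m : ℕ)) • mixedPoly k (m + 1) -
      (2 * I * (k + m : ℕ)) • mixedPoly (k + 1) m -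
      ((k + m : ℕ) * ((k + m : ℕ) - 1) : ℂ) • mixedPoly k m)
termination_by k m => (k, m)

theorem polyTranspose_mixedPoly {f g : smoothFun} (hf : delbar f = 0) (hg : delbar g = 0)
    (k m : ℕ) : polyTransposeₗ (mixedPoly k m) (mulConj f g) = mixedTerm f g k m := by
  have hmul : ∀ (P : FreeAlgebra ℂ (Fin 3)) (x : Fin 3),
      polyTransposeₗ (P * FreeAlgebra.ι ℂ x) (mulConj f g) =
        genTranspose x (polyTransposeₗ P (mulConj f g)) := fun P x => by
    simp only [polyTransposeₗ, LinearMap.coe_mk, AddHom.coe_mk, polyTranspose_mul_ι,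
      Module.End.mul_apply]
  fun_induction mixedPoly k m with
  | case1 => simp [polyTransposeₗ, polyTranspose_one, mixedTerm]
  | case2 k ih =>
    simp only [map_add, map_neg, map_smul, LinearMap.add_apply, LinearMap.neg_apply,
      LinearMap.smul_apply, hmul, ih]
    simp only [genTranspose, Matrix.cons_val, LinearMap.neg_apply, Module.End.mul_apply,
      mulY_del_mixedTerm f hg]
    simp only [add_zero]
    module
  | case3 m ih =>
    simp only [map_sub, map_neg, map_smul, LinearMap.sub_apply, LinearMap.neg_apply,
      LinearMap.smul_apply, hmul, ih]
    simp only [genTranspose, Matrix.cons_val, LinearMap.neg_apply, Module.End.mul_apply,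
      mulY_delbar_mixedTerm hf]
    simp only [zero_add]
    module
  | case4 k m ih1 ih2 ih3 =>
    simp only [map_add, map_sub, map_smul, LinearMap.add_apply, LinearMap.sub_apply,
      LinearMap.smul_apply, hmul, ih1, ih2, ih3]
    simp only [genTranspose, Matrix.cons_val, Module.End.mul_apply,
      mulY_sq_laplace_mixedTerm hf hg]
    module

theorem mixedPoly_mem (k m : ℕ) : mixedPoly k m ∈ ncDegreeLE (max k m) := by
  fun_induction mixedPoly k m with
  | case1 => exact one_mem_ncDegreeLE _
  | case2 k ih =>
    rw [max_eq_left (Nat.zero_le _)] at ih ⊢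
    exact add_mem (neg_mem (mul_ι_mem_ncDegreeLE ih _))
      (Submodule.smul_mem _ _ (ncDegreeLE_mono (Nat.le_succ k) ih))
  | case3 m ih =>
    rw [max_eq_right (Nat.zero_le _)] at ih ⊢
    exact sub_mem (neg_mem (mul_ι_mem_ncDegreeLE ih _))
      (Submodule.smul_mem _ _ (ncDegreeLE_mono (Nat.le_succ m) ih))
  | case4 k m ih1 ih2 ih3 =>
    have h1 : max (k + 1) (m + 1) = max k m + 1 := by omega
    rw [h1]
    refine Submodule.smul_mem _ _ (sub_mem (sub_mem (add_mem (mul_ι_mem_ncDegreeLE ih1 _)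
      (Submodule.smul_mem _ _ (ncDegreeLE_mono ?_ ih2)))
      (Submodule.smul_mem _ _ (ncDegreeLE_mono ?_ ih3)))
      (Submodule.smul_mem _ _ (ncDegreeLE_mono ?_ ih1))) <;> omega

/-- In `mixedPoly k m`, whose degree is at most `n = max k m`, the `n`-th power of the first
variable occurs only if `k = m`. -/
theorem ncCoeff_mixedPoly (k m : ℕ) :
    ncCoeff (FreeMonoid.of 0 ^ max k m) (mixedPoly k m) = if k = m then (1 / 4) ^ k else 0 := by
  have hlow : ∀ {k m n : ℕ}, max k m < n →
      ncCoeff (FreeMonoid.of 0 ^ n) (mixedPoly k m) = 0 := fun {k m n} h =>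
    mem_ncDegreeLE.1 (mixedPoly_mem k m) _ (by rwa [length_of_pow])
  fun_induction mixedPoly k m with
  | case1 => simp [ncCoeff, MonoidAlgebra.one_def]
  | case2 k ih =>
    have h := hlow (k := k) (m := 0) (n := k + 1) (by simp)
    rw [max_eq_left (Nat.zero_le _), map_add, map_neg, map_smul, h, pow_succ, ncCoeff_mul_ι]
    simp
  | case3 m ih =>
    have h := hlow (k := 0) (m := m) (n := m + 1) (by simp)
    rw [max_eq_right (Nat.zero_le _), map_sub, map_neg, map_smul, h, pow_succ, ncCoeff_mul_ι]
    simp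
  | case4 k m ih1 ih2 ih3 =>
    have h1 : max (k + 1) (m + 1) = max k m + 1 := by omega
    have h2 : ncCoeff (FreeMonoid.of 0 ^ (max k m + 1)) (mixedPoly k (m + 1)) = 0 := by
      rcases Nat.lt_or_ge m k with h | h
      · exact hlow (by omega)
      · rw [show max k m + 1 = max k (m + 1) by omega, ih2, if_neg (by omega)]
    have h3 : ncCoeff (FreeMonoid.of 0 ^ (max k m + 1)) (mixedPoly (k + 1) m) = 0 := by
      rcases Nat.lt_or_ge k m with h | h
      · exact hlow (by omega)
      · rw [show max k m + 1 = max (k + 1) m by omega, ih3, if_neg (by omega)]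
    have h4 : ncCoeff (FreeMonoid.of 0 ^ (max k m + 1)) (mixedPoly k m) = 0 := hlow (by omega)
    rw [h1, map_smul, map_sub, map_sub, map_add, map_smul, map_smul, map_smul, h2, h3, h4,
      pow_succ, ncCoeff_mul_ι, if_pos rfl, ih1]
    by_cases hkm : k = m
    · simp [hkm, pow_succ, mul_comm]
    · simp [hkm]

/-- The polynomial `P_j` of the differential operator `K_(j)`. -/
def creationPoly (j : ℕ) : FreeAlgebra ℂ (Fin 3) :=
  ∑ k ∈ Finset.range (j + 1), ∑ m ∈ Finset.range (j + 1),
    (creationCoeff j k * (starRingEnd ℂ) (creationCoeff j m)) • mixedPoly k m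

theorem creationCoeff_self_ne_zero (j : ℕ) : creationCoeff j j ≠ 0 := by
  have : (j.factorial : ℂ) ≠ 0 := by exact_mod_cast j.factorial_ne_zero
  simp [creationCoeff, this]

theorem ncDegree_creationPoly (j : ℕ) : ncDegree (creationPoly j) = j := by
  refine ncDegree_eq (w := FreeMonoid.of 0 ^ j) ?_ (length_of_pow 0 j) ?_
  · refine Submodule.sum_mem _ fun k hk => Submodule.sum_mem _ fun m hm =>
      Submodule.smul_mem _ _ (ncDegreeLE_mono ?_ (mixedPoly_mem k m))
    have := Finset.mem_range.1 hk
    have := Finset.mem_range.1 hm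
    omega
  · -- only the summand `k = m = j` contributes to the coefficient of the word `0^j`
    have hterm : ∀ k ∈ Finset.range (j + 1), ∀ m ∈ Finset.range (j + 1), (k ≠ j ∨ m ≠ j) →
        ncCoeff (FreeMonoid.of 0 ^ j) (mixedPoly k m) = 0 := by
      intro k hk m hm h
      have h1 := Finset.mem_range.1 hk
      have h2 := Finset.mem_range.1 hm
      rcases Nat.lt_or_ge (max k m) j with h3 | h3
      · exact mem_ncDegreeLE.1 (mixedPoly_mem k m) _ (by rwa [length_of_pow])
      · have h4 : j = max k m := by omega
        rw [h4, ncCoeff_mixedPoly, if_neg (by omega)]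
    have hj : j ∈ Finset.range (j + 1) := Finset.self_mem_range_succ j
    rw [creationPoly, map_sum, Finset.sum_eq_single_of_mem j hj, map_sum,
      Finset.sum_eq_single_of_mem j hj, map_smul]
    · have h := ncCoeff_mixedPoly j j
      rw [max_self, if_pos rfl] at h
      rw [h]
      simp [creationCoeff_self_ne_zero]
    · intro m hm hne
      rw [map_smul, hterm j hj m hm (Or.inr hne), smul_zero]
    · intro k hk hne
      rw [map_sum]
      refine Finset.sum_eq_zero fun m hm => ?_
      rw [map_smul, hterm k hk m hm (Or.inl hne), smul_zero]

theorem mulConj_sum_sum {ι κ : Type*} (s : Finset ι) (t : Finset κ) (F : ι → smoothFun)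
    (G : κ → smoothFun) : mulConj (∑ k ∈ s, F k) (∑ m ∈ t, G m) =
      ∑ k ∈ s, ∑ m ∈ t, mulConj (F k) (G m) := by
  rw [← mulConjₛₗ_apply, map_sum mulConjₛₗ, LinearMap.sum_apply]
  exact Finset.sum_congr rfl fun k _ => map_sum (mulConjₛₗ (F k)) G t

/-- The pointwise identity behind the theorem: on products `f ḡ` of a holomorphic and an
antiholomorphic function, the transpose of `K_(j)` acts as `f ḡ ↦ S^j f \overline{S^j g}`. -/
theorem polyTranspose_creationPoly (j : ℕ) {f g : smoothFun} (hf : delbar f = 0)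
    (hg : delbar g = 0) : polyTranspose (creationPoly j) (mulConj f g) =
      mulConj (creation j f) (creation j g) := by
  change polyTransposeₗ (creationPoly j) (mulConj f g) = _
  rw [creation_eq_sum, creation_eq_sum, mulConj_sum_sum, creationPoly, map_sum,
    LinearMap.sum_apply]
  refine Finset.sum_congr rfl fun k _ => ?_
  rw [map_sum, LinearMap.sum_apply]
  refine Finset.sum_congr rfl fun m _ => ?_
  rw [map_smul, LinearMap.smul_apply, polyTranspose_mixedPoly hf hg,
    mulConj_smul_left, mulConj_smul_right, mulConj_mulY_pow, smul_smul, mixedTerm]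

/-! ### Square integrable smooth functions -/

theorem aestronglyMeasurable_smoothFun (f : smoothFun) :
    AEStronglyMeasurable (f : ℂ → ℂ) area :=
  f.2.1.continuousOn.aestronglyMeasurable measurableSet_halfPlane

theorem ae_eq_of_eqOn_halfPlane {f g : ℂ → ℂ} (h : ∀ z ∈ halfPlane, f z = g z) :
    f =ᵐ[area] g :=
  (ae_restrict_iff' measurableSet_halfPlane).2 (Filter.Eventually.of_forall h)

theorem eq_of_ae_eq {f g : smoothFun} (h : (f : ℂ → ℂ) =ᵐ[area] g) : f = g :=
  smoothFun.ext' fun _ hz => MeasureTheory.Measure.eqOn_open_of_ae_eq h halfPlane.isOpen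
    f.2.1.continuousOn g.2.1.continuousOn hz

/-- The smooth functions that are square integrable on `Π`. -/
def smoothL2 : Submodule ℂ smoothFun where
  carrier := {f | MemLp (f : ℂ → ℂ) 2 area}
  add_mem' hf hg := hf.add hg
  zero_mem' := MemLp.zero
  smul_mem' c _ hf := hf.const_smul c

theorem mem_smoothL2 {f : smoothFun} : f ∈ smoothL2 ↔ MemLp (f : ℂ → ℂ) 2 area := Iff.rfl

/-- The class in `L²(Π)` of a square integrable smooth function. -/
def toL2 : smoothL2 →ₗ[ℂ] L2 where
  toFun f := f.2.toLp
  map_add' _ _ := rfl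
  map_smul' _ _ := rfl

theorem coeFn_toL2 (f : smoothL2) : (toL2 f : ℂ → ℂ) =ᵐ[area] (f : smoothFun) :=
  MemLp.coeFn_toLp f.2

theorem toL2_eq_iff {f : smoothL2} {u : L2} :
    toL2 f = u ↔ (u : ℂ → ℂ) =ᵐ[area] (f : smoothFun) :=
  ⟨fun h => h ▸ coeFn_toL2 f, fun h => Lp.ext ((coeFn_toL2 f).trans h.symm)⟩

theorem toL2_sub (f g : smoothL2) : toL2 (f - g) = toL2 f - toL2 g := rfl

theorem inner_toL2 (f g : smoothL2) :
    ⟪toL2 g, toL2 f⟫_ℂ = ∫ z, (mulConj f g : ℂ → ℂ) z ∂area := by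
  rw [L2.inner_def]
  refine integral_congr_ae ?_
  filter_upwards [coeFn_toL2 f, coeFn_toL2 g, ae_restrict_mem measurableSet_halfPlane]
    with z hf hg hz
  rw [hf, hg, mulConj_apply _ _ hz]
  rfl

theorem enorm_toL2 (f : smoothL2) : ‖toL2 f‖ₑ = eLpNorm ((f : smoothFun) : ℂ → ℂ) 2 area := by
  rw [Lp.enorm_def, eLpNorm_congr_ae (coeFn_toL2 f)]

/-! ### The rational functions `y^s (z + i)^(-a)` -/

/-- The function `(z + i)^(-a)`. -/
def pole (a : ℕ) (z : ℂ) : ℂ := ((z + I) ^ a)⁻¹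

theorem add_I_ne_zero {z : ℂ} (hz : 0 ≤ z.im) : z + I ≠ 0 := fun h => by
  have := congrArg Complex.im h
  simp at this
  linarith

theorem hasDerivAt_pole (a : ℕ) {z : ℂ} (hz : 0 ≤ z.im) :
    HasDerivAt (pole a) (-a * pole (a + 1) z) z := by
  have h0 := add_I_ne_zero hz
  have h1 : HasDerivAt (fun z : ℂ => (z + I) ^ a) (a * (z + I) ^ (a - 1) * 1) z :=
    ((hasDerivAt_id z).add_const I).pow a
  have h2 := h1.inv (pow_ne_zero a h0)
  refine h2.congr_deriv ?_
  rw [pole]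
  cases a with
  | zero => simp
  | succ a =>
    simp only [Nat.add_sub_cancel]
    field_simp
    ring

theorem differentiableOn_pole (a : ℕ) : DifferentiableOn ℂ (pole a) halfPlane := fun _ hz =>
  (hasDerivAt_pole a (le_of_lt hz)).differentiableAt.differentiableWithinAt

/-- The function `(z + i)^(-a)` as an element of `C^∞(Π)`. -/
def poleFun (a : ℕ) : smoothFun := smoothFun.ofHolo (pole a) (differentiableOn_pole a)

theorem poleFun_apply (a : ℕ) {z : ℂ} (hz : z ∈ halfPlane) :
    (poleFun a : ℂ → ℂ) z = pole a z := smoothFun.ofHolo_apply _ hz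

theorem delbar_poleFun (a : ℕ) : delbar (poleFun a) = 0 := delbar_ofHolo _

theorem del_poleFun (a : ℕ) : del (poleFun a) = (-a : ℂ) • poleFun (a + 1) := by
  refine smoothFun.ext' fun z hz => ?_
  rw [del_eq_deriv (delbar_poleFun a) hz]
  have h : deriv (poleFun a : ℂ → ℂ) z = deriv (pole a) z :=
    Filter.EventuallyEq.deriv_eq (Filter.eventually_of_mem (halfPlane.isOpen.mem_nhds hz)
      fun w hw => poleFun_apply a hw)
  rw [h, (hasDerivAt_pole a (le_of_lt hz)).deriv]
  change _ = (-a : ℂ) * (poleFun (a + 1) : ℂ → ℂ) z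
  rw [poleFun_apply _ hz]

theorem del_pow_poleFun (a k : ℕ) :
    (del ^ k) (poleFun a) = ((-1) ^ k * (a.ascFactorial k : ℂ)) • poleFun (a + k) := by
  induction k with
  | zero => simp
  | succ k ih =>
    rw [pow_succ', Module.End.mul_apply, ih, map_smul, del_poleFun, smul_smul,
      Nat.ascFactorial_succ, add_assoc]
    congr 1
    push_cast
    ring

/-- The function `y^s (z + i)^(-a)`. -/
def ratFun (s a : ℕ) : smoothFun := (mulY ^ s) (poleFun a)

theorem ratFun_apply (s a : ℕ) {z : ℂ} (hz : z ∈ halfPlane) :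
    (ratFun s a : ℂ → ℂ) z = (z.im : ℂ) ^ s * pole a z := by
  rw [ratFun, mulY_pow_apply _ _ hz, poleFun_apply _ hz]

theorem creation_poleFun (j a : ℕ) : creation j (poleFun a) = ∑ k ∈ Finset.range (j + 1),
    (creationCoeff j k * ((-1) ^ k * (a.ascFactorial k : ℂ))) • ratFun k (a + k) := by
  rw [creation_eq_sum]
  refine Finset.sum_congr rfl fun k _ => ?_
  rw [del_pow_poleFun, map_smul, smul_smul]
  rfl

theorem one_le_norm_add_I {z : ℂ} (hz : 0 ≤ z.im) : 1 ≤ ‖z + I‖ := by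
  have h := Complex.abs_im_le_norm (z + I)
  rw [abs_of_nonneg (by simp; linarith)] at h
  simp at h
  linarith

theorem im_le_norm_add_I {z : ℂ} (hz : 0 ≤ z.im) : z.im ≤ ‖z + I‖ := by
  have h := Complex.abs_im_le_norm (z + I)
  rw [abs_of_nonneg (by simp; linarith)] at h
  simp at h
  linarith

theorem norm_le_norm_add_I {z : ℂ} (hz : 0 ≤ z.im) : ‖z‖ ≤ ‖z + I‖ := by
  rw [← sq_le_sq₀ (norm_nonneg _) (norm_nonneg _), ← Complex.normSq_eq_norm_sq,
    ← Complex.normSq_eq_norm_sq, Complex.normSq_apply, Complex.normSq_apply]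
  simp
  nlinarith

theorem norm_pole (a : ℕ) (z : ℂ) : ‖pole a z‖ = (‖z + I‖ ^ a)⁻¹ := by
  rw [pole, norm_inv, norm_pow]

/-- The integrand `y^s (z + i)^(-a) (z̄ - i)^(-b)`. -/
def poleProd (s a b : ℕ) (z : ℂ) : ℂ := (z.im : ℂ) ^ s * pole a z * (starRingEnd ℂ) (pole b z)

theorem norm_poleProd_le {s a b d : ℕ} (h : s + d ≤ a + b) {z : ℂ} (hz : 0 ≤ z.im) :
    ‖poleProd s a b z‖ ≤ (‖z + I‖ ^ d)⁻¹ := by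
  have h1 := one_le_norm_add_I hz
  have h2 := im_le_norm_add_I hz
  have h0 : 0 < ‖z + I‖ := by linarith
  rw [poleProd, norm_mul, norm_mul, RCLike.norm_conj, norm_pole, norm_pole, norm_pow,
    Complex.norm_real, Real.norm_of_nonneg hz, mul_assoc, ← mul_inv, ← pow_add, ← div_eq_mul_inv,
    div_le_iff₀ (by positivity), ← div_eq_inv_mul, le_div_iff₀ (by positivity)]
  calc z.im ^ s * ‖z + I‖ ^ d ≤ ‖z + I‖ ^ s * ‖z + I‖ ^ d := by gcongr
    _ = ‖z + I‖ ^ (s + d) := (pow_add _ _ _).symm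
    _ ≤ _ := pow_le_pow_right₀ h1 h

theorem integrable_norm_add_I_inv : Integrable (fun z : ℂ => (‖z + I‖ ^ 3)⁻¹) area := by
  have h := (integrable_one_add_norm (E := ℂ) (μ := volume) (r := 3)
    (by rw [Complex.finrank_real_complex]; norm_num)).restrict (s := (halfPlane : Set ℂ))
  refine (h.const_mul 8).mono' (by fun_prop) ?_
  filter_upwards [ae_restrict_mem measurableSet_halfPlane] with z hz
  have hz' : 0 ≤ z.im := le_of_lt hz
  have h1 := one_le_norm_add_I hz'
  have h2 := norm_le_norm_add_I hz'
  have h0 : 0 < ‖z + I‖ := by linarith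
  have h3 : 1 + ‖z‖ ≤ 2 * ‖z + I‖ := by linarith
  have h4 : 0 < 1 + ‖z‖ := by positivity
  rw [Real.norm_of_nonneg (by positivity), Real.rpow_neg h4.le,
    show (3 : ℝ) = ((3 : ℕ) : ℝ) by norm_num, Real.rpow_natCast, ← div_eq_mul_inv,
    le_div_iff₀ (by positivity), ← div_eq_inv_mul, div_le_iff₀ (by positivity)]
  calc (1 + ‖z‖) ^ 3 ≤ (2 * ‖z + I‖) ^ 3 := by gcongr
    _ = _ := by ring

theorem continuousOn_pole (a : ℕ) : ContinuousOn (pole a) halfPlane :=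
  (differentiableOn_pole a).continuousOn

theorem continuousOn_poleProd (s a b : ℕ) : ContinuousOn (poleProd s a b) halfPlane :=
  ((Continuous.continuousOn (by fun_prop)).mul (continuousOn_pole a)).mul
    (Complex.continuous_conj.comp_continuousOn (continuousOn_pole b))

theorem integrable_poleProd {s a b : ℕ} (h : s + 3 ≤ a + b) :
    Integrable (poleProd s a b) area := by
  refine integrable_norm_add_I_inv.mono'
    ((continuousOn_poleProd s a b).aestronglyMeasurable measurableSet_halfPlane) ?_
  filter_upwards [ae_restrict_mem measurableSet_halfPlane] with z hz
  exact norm_poleProd_le h (le_of_lt hz)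

theorem ratFun_mem_smoothL2 {s a : ℕ} (h : s + 2 ≤ a) : ratFun s a ∈ smoothL2 := by
  rw [mem_smoothL2, memLp_two_iff_integrable_sq_norm (aestronglyMeasurable_smoothFun _)]
  refine ((integrable_poleProd (s := 2 * s) (a := a) (b := a) (by omega)).norm).congr ?_
  filter_upwards [ae_restrict_mem measurableSet_halfPlane] with z hz
  rw [ratFun_apply _ _ hz, poleProd, norm_mul, norm_mul, norm_mul, RCLike.norm_conj, pow_mul,
    norm_pow, norm_pow, norm_pow]
  ring

/-- The functions in `L²(Π)` that are smooth up to the boundary. -/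
def closureL2 : Submodule ℂ smoothFun where
  carrier := {f | (∃ g : ℂ → ℂ, ContDiffOn ℝ ∞ g {z | 0 ≤ z.im} ∧
      ∀ z ∈ halfPlane, (f : ℂ → ℂ) z = g z) ∧ f ∈ smoothL2}
  add_mem' := by
    rintro f f' ⟨⟨g, hg, hfg⟩, hf⟩ ⟨⟨g', hg', hfg'⟩, hf'⟩
    exact ⟨⟨g + g', hg.add hg', fun z hz => by simp [hfg z hz, hfg' z hz]⟩, add_mem hf hf'⟩
  zero_mem' := ⟨⟨0, contDiffOn_const, fun _ _ => rfl⟩, zero_mem _⟩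
  smul_mem' := by
    rintro c f ⟨⟨g, hg, hfg⟩, hf⟩
    exact ⟨⟨c • g, hg.const_smul c, fun z hz => by simp [hfg z hz]⟩, Submodule.smul_mem _ c hf⟩

theorem mulConj_mem_smoothL1 {f g : smoothFun} (hf : f ∈ closureL2) (hg : g ∈ closureL2) :
    mulConj f g ∈ smoothL1 := by
  obtain ⟨⟨F, hF, hfF⟩, hf2⟩ := hf
  obtain ⟨⟨G, hG, hgG⟩, hg2⟩ := hg
  refine ⟨⟨fun z => F z * (starRingEnd ℂ) (G z),
    hF.mul (Complex.conjCLE.contDiff.comp_contDiffOn hG), fun z hz => ?_⟩, ?_⟩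
  · rw [mulConj_apply _ _ hz, hfF z hz, hgG z hz]
  · have h : MemLp (fun z => (starRingEnd ℂ) ((g : ℂ → ℂ) z)) 2 area := (mem_smoothL2.1 hg2).star
    refine (MemLp.integrable_mul (mem_smoothL2.1 hf2) h).congr ?_
    filter_upwards [ae_restrict_mem measurableSet_halfPlane] with z hz
    rw [mulConj_apply _ _ hz]
    rfl

theorem ratFun_mem_closureL2 {s a : ℕ} (h : s + 2 ≤ a) : ratFun s a ∈ closureL2 := by
  refine ⟨⟨fun z => (z.im : ℂ) ^ s * pole a z, ?_, fun z hz => ratFun_apply s a hz⟩,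
    ratFun_mem_smoothL2 h⟩
  have h1 : ContDiff ℝ ∞ fun z : ℂ => (z.im : ℂ) ^ s :=
    (Complex.ofRealCLM.comp Complex.imCLM).contDiff.pow s
  have h2 : ContDiff ℝ ∞ fun z : ℂ => (z + I) ^ a := (contDiff_id.add contDiff_const).pow a
  exact h1.contDiffOn.mul (h2.contDiffOn.inv fun z hz => pow_ne_zero a (add_I_ne_zero hz))

/-! ### Integration by parts on the half-plane -/

theorem integral_area_eq (F : ℂ → ℂ) :
    ∫ z, F z ∂area = ∫ p in (Set.univ ×ˢ Set.Ioi (0 : ℝ)), F ⟨p.1, p.2⟩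
      ∂((volume : Measure ℝ).prod volume) := by
  have h := (Complex.volume_preserving_equiv_real_prod.symm _).setIntegral_preimage_emb
    measurableEquivRealProd.symm.measurableEmbedding F (halfPlane : Set ℂ)
  have hs : measurableEquivRealProd.symm ⁻¹' (halfPlane : Set ℂ) =
      Set.univ ×ˢ Set.Ioi (0 : ℝ) := by
    ext p
    simp [mem_halfPlane, measurableEquivRealProd]
  rw [hs] at h
  exact h.symm

theorem integrableOn_prod_of_integrable_area {F : ℂ → ℂ} (hF : Integrable F area) :
    IntegrableOn (fun p : ℝ × ℝ => F ⟨p.1, p.2⟩) (Set.univ ×ˢ Set.Ioi (0 : ℝ))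
      ((volume : Measure ℝ).prod volume) := by
  have h := (Complex.volume_preserving_equiv_real_prod.symm _).integrableOn_comp_preimage
    measurableEquivRealProd.symm.measurableEmbedding (f := F) (s := (halfPlane : Set ℂ))
  have hs : measurableEquivRealProd.symm ⁻¹' (halfPlane : Set ℂ) =
      Set.univ ×ˢ Set.Ioi (0 : ℝ) := by
    ext p
    simp [mem_halfPlane, measurableEquivRealProd]
  rw [hs] at h
  exact h.2 hF

/-- The integral over `Π` of a derivative in `x` vanishes, if the function decays horizontally. -/
theorem integral_deriv_re_eq_zero {h h' : ℂ → ℂ} (hint : Integrable h' area)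
    (hd : ∀ x y : ℝ, 0 < y → HasDerivAt (fun t : ℝ => h ⟨t, y⟩) (h' ⟨x, y⟩) x)
    (htop : ∀ y : ℝ, 0 < y → Filter.Tendsto (fun t : ℝ => h ⟨t, y⟩) Filter.atTop (nhds 0))
    (hbot : ∀ y : ℝ, 0 < y → Filter.Tendsto (fun t : ℝ => h ⟨t, y⟩) Filter.atBot (nhds 0)) :
    ∫ z, h' z ∂area = 0 := by
  have h1 := integrableOn_prod_of_integrable_area hint
  rw [integral_area_eq, ← Measure.prod_restrict]
  rw [IntegrableOn, ← Measure.prod_restrict] at h1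
  rw [integral_prod_symm _ h1]
  refine integral_eq_zero_of_ae ?_
  filter_upwards [h1.prod_left_ae, ae_restrict_mem measurableSet_Ioi] with y hy hy0
  rw [Measure.restrict_univ] at hy ⊢
  rw [integral_of_hasDerivAt_of_tendsto (fun x => hd x y hy0) hy (hbot y hy0) (htop y hy0)]
  simp

/-- The integral over `Π` of a derivative in `y` vanishes, if the function vanishes on the real
axis and decays vertically. -/
theorem integral_deriv_im_eq_zero {h h' : ℂ → ℂ} (hint : Integrable h' area)
    (hd : ∀ x y : ℝ, 0 ≤ y → HasDerivAt (fun t : ℝ => h ⟨x, t⟩) (h' ⟨x, y⟩) y)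
    (h0 : ∀ x : ℝ, h ⟨x, 0⟩ = 0)
    (htop : ∀ x : ℝ, Filter.Tendsto (fun t : ℝ => h ⟨x, t⟩) Filter.atTop (nhds 0)) :
    ∫ z, h' z ∂area = 0 := by
  have h1 := integrableOn_prod_of_integrable_area hint
  rw [integral_area_eq, ← Measure.prod_restrict]
  rw [IntegrableOn, ← Measure.prod_restrict] at h1
  rw [integral_prod _ h1]
  refine integral_eq_zero_of_ae ?_
  filter_upwards [h1.prod_right_ae] with x hx
  rw [integral_Ioi_of_hasDerivAt_of_tendsto' (fun y hy => hd x y hy) hx (htop x), h0]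
  simp

theorem hasDerivAt_pole_comp (a : ℕ) {c : ℝ → ℂ} {v : ℂ} {t : ℝ} (hc : HasDerivAt c v t)
    (h0 : 0 ≤ (c t).im) :
    HasDerivAt (fun t => pole a (c t)) (v * (-a * pole (a + 1) (c t))) t :=
  (hasDerivAt_pole a h0).scomp t hc

theorem hasDerivAt_conj_pole_comp (a : ℕ) {c : ℝ → ℂ} {v : ℂ} {t : ℝ} (hc : HasDerivAt c v t)
    (h0 : 0 ≤ (c t).im) :
    HasDerivAt (fun t => (starRingEnd ℂ) (pole a (c t)))
      ((starRingEnd ℂ) v * (-a * (starRingEnd ℂ) (pole (a + 1) (c t)))) t := by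
  have h := (Complex.conjCLE : ℂ →L[ℝ] ℂ).hasFDerivAt.comp_hasDerivAt t
    (hasDerivAt_pole_comp a hc h0)
  refine h.congr_deriv ?_
  simp

theorem hasDerivAt_mk_re (x y : ℝ) : HasDerivAt (fun t : ℝ => (⟨t, y⟩ : ℂ)) 1 x := by
  have h : HasDerivAt (fun t : ℝ => (t : ℂ) + y * I) 1 x :=
    (hasDerivAt_id x).ofReal_comp.add_const _
  exact h.congr_of_eventuallyEq (Filter.Eventually.of_forall fun t => mk_eq_add_mul_I t y)

theorem hasDerivAt_mk_im (x y : ℝ) : HasDerivAt (fun t : ℝ => (⟨x, t⟩ : ℂ)) I y := by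
  have h : HasDerivAt (fun t : ℝ => (x : ℂ) + t * I) (1 * I) y :=
    ((hasDerivAt_id y).ofReal_comp.mul_const I).const_add _
  rw [one_mul] at h
  exact h.congr_of_eventuallyEq (Filter.Eventually.of_forall fun t => mk_eq_add_mul_I x t)

theorem tendsto_poleProd {α : Type*} {l : Filter α} {s a b : ℕ} (h : s + 1 ≤ a + b) {c : α → ℂ}
    (hc : ∀ᶠ t in l, 0 ≤ (c t).im) (hl : Filter.Tendsto (fun t => ‖c t‖) l Filter.atTop) :
    Filter.Tendsto (fun t => poleProd s a b (c t)) l (nhds 0) := by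
  refine squeeze_zero_norm' (a := fun t => ‖c t‖⁻¹) ?_ (tendsto_inv_atTop_zero.comp hl)
  filter_upwards [hc, hl.eventually_gt_atTop 0] with t ht h0
  refine (norm_poleProd_le h ht).trans ?_
  rw [pow_one]
  exact inv_anti₀ h0 (norm_le_norm_add_I ht)

theorem tendsto_norm_mk_re_atTop (y : ℝ) :
    Filter.Tendsto (fun t : ℝ => ‖(⟨t, y⟩ : ℂ)‖) Filter.atTop Filter.atTop :=
  Filter.tendsto_atTop_mono (fun t => Complex.abs_re_le_norm ⟨t, y⟩) Filter.tendsto_abs_atTop_atTop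

theorem tendsto_norm_mk_re_atBot (y : ℝ) :
    Filter.Tendsto (fun t : ℝ => ‖(⟨t, y⟩ : ℂ)‖) Filter.atBot Filter.atTop :=
  Filter.tendsto_atTop_mono (fun t => Complex.abs_re_le_norm ⟨t, y⟩) Filter.tendsto_abs_atBot_atTop

theorem tendsto_norm_mk_im_atTop (x : ℝ) :
    Filter.Tendsto (fun t : ℝ => ‖(⟨x, t⟩ : ℂ)‖) Filter.atTop Filter.atTop :=
  Filter.tendsto_atTop_mono (fun t => Complex.abs_im_le_norm ⟨x, t⟩) Filter.tendsto_abs_atTop_atTop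

/-- The integral `∫ y^s (z + i)^(-a) (z̄ - i)^(-b) dA` over `Π`. -/
def poleInt (s a b : ℕ) : ℂ := ∫ z, poleProd s a b z ∂area

/-- Integration by parts in `x`. -/
theorem poleInt_re {s a b : ℕ} (h : s + 2 ≤ a + b) :
    a * poleInt s (a + 1) b + b * poleInt s a (b + 1) = 0 := by
  have h1 := (integrable_poleProd (s := s) (a := a + 1) (b := b) (by omega)).const_mul (-a : ℂ)
  have h2 := (integrable_poleProd (s := s) (a := a) (b := b + 1) (by omega)).const_mul (-b : ℂ)
  have key := integral_deriv_re_eq_zero (h := poleProd s a b) (h1.add h2) ?_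
    (fun y hy => tendsto_poleProd (by omega) (Filter.Eventually.of_forall fun t => hy.le)
      (tendsto_norm_mk_re_atTop y))
    (fun y hy => tendsto_poleProd (by omega) (Filter.Eventually.of_forall fun t => hy.le)
      (tendsto_norm_mk_re_atBot y))
  · simp only [Pi.add_apply] at key
    rw [integral_add h1 h2, integral_const_mul, integral_const_mul] at key
    rw [poleInt, poleInt]
    linear_combination -key
  · intro x y hy
    have h3 := hasDerivAt_mk_re x y
    have h4 := ((hasDerivAt_pole_comp a h3 hy.le).mul
      (hasDerivAt_conj_pole_comp b h3 hy.le)).const_mul ((y : ℂ) ^ s)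
    refine (h4.congr_of_eventuallyEq (Filter.Eventually.of_forall fun t => ?_)).congr_deriv ?_
    · simp only [poleProd, mul_assoc]
      rfl
    · simp only [poleProd, Pi.add_apply, map_one]
      ring

/-- Integration by parts in `y`; the factor `y^(s+1)` removes the boundary term. -/
theorem poleInt_im {s a b : ℕ} (h : s + 3 ≤ a + b) :
    (s + 1) * poleInt s a b - I * a * poleInt (s + 1) (a + 1) b +
      I * b * poleInt (s + 1) a (b + 1) = 0 := by
  have h0 := (integrable_poleProd (s := s) (a := a) (b := b) (by omega)).const_mul (s + 1 : ℂ)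
  have h1 := (integrable_poleProd (s := s + 1) (a := a + 1) (b := b)
    (by omega)).const_mul (-(I * a) : ℂ)
  have h2 := (integrable_poleProd (s := s + 1) (a := a) (b := b + 1)
    (by omega)).const_mul (I * b : ℂ)
  have key := integral_deriv_im_eq_zero (h := poleProd (s + 1) a b) ((h0.add h1).add h2) ?_ ?_
    (fun x => tendsto_poleProd (by omega) (Filter.eventually_ge_atTop 0)
      (tendsto_norm_mk_im_atTop x))
  · simp only [Pi.add_apply] at key
    rw [integral_add (by exact h0.add h1) h2, integral_add h0 h1, integral_const_mul,
      integral_const_mul, integral_const_mul] at key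
    rw [poleInt, poleInt, poleInt]
    linear_combination key
  · intro x y hy
    have h3 := hasDerivAt_mk_im x y
    have h4 : HasDerivAt (fun t : ℝ => (t : ℂ) ^ (s + 1)) ((s + 1) * (y : ℂ) ^ s) y := by
      refine ((hasDerivAt_id y).ofReal_comp.pow (s + 1)).congr_deriv ?_
      simp
    have h5 := (h4.mul (hasDerivAt_pole_comp a h3 hy)).mul (hasDerivAt_conj_pole_comp b h3 hy)
    refine (h5.congr_of_eventuallyEq (Filter.Eventually.of_forall fun t => ?_)).congr_deriv ?_
    · rfl
    · simp only [poleProd, Pi.add_apply, Pi.mul_apply, conj_I]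
      ring
  · intro x
    simp [poleProd]

theorem poleInt_succ_right {s a b : ℕ} (h : s + 3 ≤ a + b) :
    b * poleInt (s + 1) a (b + 1) = I / 2 * (s + 1) * poleInt s a b := by
  have h1 := poleInt_re (s := s + 1) (a := a) (b := b) (by omega)
  have h2 := poleInt_im h
  linear_combination (1 / 2) * h1 - (I / 2) * h2 +
    (1 / 2) * (b * poleInt (s + 1) a (b + 1) - a * poleInt (s + 1) (a + 1) b) * I_mul_I

theorem poleInt_succ_left {s a b : ℕ} (h : s + 3 ≤ a + b) :
    a * poleInt (s + 1) (a + 1) b = -I / 2 * (s + 1) * poleInt s a b := by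
  have h1 := poleInt_re (s := s + 1) (a := a) (b := b) (by omega)
  have h2 := poleInt_succ_right h
  linear_combination h1 - h2

/-- Repeated integration by parts reduces all integrals of the products of the terms of `S^j f` and
`S^k g`, for `f = (z + i)^(-a)` and `g = (z + i)^(-b)`, to the one for `j = k = 0`. -/
theorem poleInt_add_add {a b : ℕ} (h : 3 ≤ a + b) (l m : ℕ) :
    (a.ascFactorial l : ℂ) * b.ascFactorial m * poleInt (l + m) (a + l) (b + m) =
      (-I / 2) ^ l * (I / 2) ^ m * (l + m).factorial * poleInt 0 a b := by
  induction m with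
  | zero =>
    induction l with
    | zero => simp
    | succ l ih =>
      have h1 := poleInt_succ_left (s := l) (a := a + l) (b := b) (by omega)
      simp only [add_zero, Nat.ascFactorial_zero, Nat.cast_one, mul_one, pow_zero] at ih ⊢
      rw [Nat.ascFactorial_succ, Nat.factorial_succ, pow_succ]
      push_cast at h1 ⊢
      rw [← add_assoc]
      linear_combination (a.ascFactorial l : ℂ) * h1 + (-I / 2) * (l + 1) * ih
  | succ m ih =>
    have h1 := poleInt_succ_right (s := l + m) (a := a + l) (b := b + m) (by omega)
    rw [← add_assoc l m 1, ← add_assoc b m 1, Nat.ascFactorial_succ, Nat.factorial_succ, pow_succ]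
    push_cast at h1 ⊢
    linear_combination (a.ascFactorial l : ℂ) * (b.ascFactorial m : ℂ) * h1 +
      (I / 2) * (l + m + 1) * ih

theorem fwdDiff_iterate_choose (n k y : ℕ) :
    (fwdDiff (1 : ℕ))^[n] (fun x : ℕ => (x.choose k : ℤ)) y =
      if n ≤ k then (y.choose (k - n) : ℤ) else 0 := by
  induction n generalizing k with
  | zero => simp
  | succ n ih =>
    rw [Function.iterate_succ_apply]
    cases k with
    | zero =>
      have h0 : fwdDiff (1 : ℕ) (fun x : ℕ => (x.choose 0 : ℤ)) = 0 := by
        ext x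
        simp [fwdDiff]
      have h1 : ∀ n : ℕ, (fwdDiff (1 : ℕ))^[n] (0 : ℕ → ℤ) = 0 := fun n =>
        Function.iterate_fixed (by ext x; simp [fwdDiff]) n
      rw [h0, h1]
      simp
    | succ k =>
      rw [fwdDiff_choose, ih]
      simp

/-- The `n`-th difference of the polynomial `x ↦ x.choose k`. -/
theorem sum_neg_one_pow_choose_mul_choose (n k y : ℕ) :
    ∑ l ∈ Finset.range (n + 1), (-1 : ℤ) ^ l * n.choose l * (y + l).choose k =
      (-1) ^ n * if n ≤ k then (y.choose (k - n) : ℤ) else 0 := by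
  rw [← fwdDiff_iterate_choose, fwdDiff_iter_eq_sum_shift, Finset.mul_sum]
  refine Finset.sum_congr rfl fun l hl => ?_
  have hl' : l ≤ n := Nat.lt_succ_iff.1 (Finset.mem_range.1 hl)
  obtain ⟨i, rfl⟩ := Nat.exists_eq_add_of_le hl'
  have h3 : ((-1 : ℤ) ^ i) * (-1) ^ i = 1 := by rw [← mul_pow]; simp
  simp only [Nat.add_sub_cancel_left, smul_eq_mul, mul_one, pow_add]
  linear_combination (-(-1 : ℤ) ^ l * (l + i).choose l * (y + l).choose k) * h3

/-- The combinatorial identity behind the orthogonality of the ranges of `S^j` and `S^k`. -/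
theorem sum_sum_neg_one_pow_choose (j k : ℕ) :
    ∑ l ∈ Finset.range (j + 1), ∑ m ∈ Finset.range (k + 1),
      (-1 : ℤ) ^ l * (-1) ^ m * j.choose l * k.choose m * (l + m).choose l =
      if j = k then 1 else 0 := by
  rw [Finset.sum_comm]
  have h1 : ∀ m : ℕ, ∑ l ∈ Finset.range (j + 1),
      (-1 : ℤ) ^ l * (-1) ^ m * j.choose l * k.choose m * (l + m).choose l =
      (-1) ^ j * ((-1) ^ m * k.choose m * (0 + m).choose j) := by
    intro m
    have h2 := sum_neg_one_pow_choose_mul_choose j m m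
    have h3 : (if j ≤ m then (m.choose (m - j) : ℤ) else 0) = m.choose j := by
      split_ifs with h
      · rw [Nat.choose_symm h]
      · rw [Nat.choose_eq_zero_of_lt (not_le.1 h), Nat.cast_zero]
    rw [h3] at h2
    rw [zero_add]
    calc _ = (-1) ^ m * k.choose m * ∑ l ∈ Finset.range (j + 1),
          (-1 : ℤ) ^ l * j.choose l * (m + l).choose m := by
          rw [Finset.mul_sum]
          refine Finset.sum_congr rfl fun l _ => ?_
          rw [add_comm l m, Nat.choose_symm_add]
          ring
      _ = _ := by rw [h2]; ring
  simp_rw [h1]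
  rw [← Finset.mul_sum, sum_neg_one_pow_choose_mul_choose]
  rcases lt_trichotomy j k with h | rfl | h
  · simp [h.ne, h]
  · have h3 : ((-1 : ℤ) ^ j) * (-1) ^ j = 1 := by rw [← mul_pow]; simp
    simp [h3]
  · have h4 : 0 < j - k := Nat.sub_pos_of_lt h
    simp [h.ne', Nat.choose_eq_zero_of_lt h4]

/-- The powers of `2i` in the coefficients of `S^j` cancel those of `i/2` from the integrations by
parts. -/
theorem creationCoeff_mul_conj (j k l m : ℕ) :
    creationCoeff j l * (starRingEnd ℂ) (creationCoeff k m) * ((-I / 2) ^ l * (I / 2) ^ m) =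
      (j.choose l : ℂ) * k.choose m / (l.factorial * m.factorial) := by
  have h1 : (2 * I) ^ l * (-I / 2) ^ l = 1 := by
    rw [← mul_pow, show 2 * I * (-I / 2) = 1 by linear_combination -I_mul_I, one_pow]
  have h2 : (2 * -I) ^ m * (I / 2) ^ m = 1 := by
    rw [← mul_pow, show 2 * -I * (I / 2) = 1 by linear_combination -I_mul_I, one_pow]
  have h3 : (starRingEnd ℂ) 2 = 2 := map_ofNat _ 2
  simp only [creationCoeff, map_div₀, map_mul, map_pow, conj_I, map_natCast, h3]
  calc _ = ((2 * I) ^ l * (-I / 2) ^ l) * ((2 * -I) ^ m * (I / 2) ^ m) *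
        ((j.choose l : ℂ) * k.choose m / (l.factorial * m.factorial)) := by
        simp only [div_eq_mul_inv, mul_inv]
        ring
    _ = _ := by rw [h1, h2, one_mul, one_mul]

/-- The functions `S^j (z + i)^(-a)` and `S^k (z + i)^(-b)` are orthogonal for `j ≠ k`, and `S^j`
preserves the inner products of the functions `(z + i)^(-a)`. -/
theorem integral_creation_poleFun (j k : ℕ) {a b : ℕ} (ha : 2 ≤ a) (hb : 2 ≤ b) :
    ∫ z, (mulConj (creation j (poleFun a)) (creation k (poleFun b)) : ℂ → ℂ) z ∂area =
      if j = k then ∫ z, (mulConj (poleFun a) (poleFun b) : ℂ → ℂ) z ∂area else 0 := by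
  have h0 : ∫ z, (mulConj (poleFun a) (poleFun b) : ℂ → ℂ) z ∂area = poleInt 0 a b := by
    refine integral_congr_ae (ae_eq_of_eqOn_halfPlane fun z hz => ?_)
    rw [mulConj_apply _ _ hz, poleFun_apply _ hz, poleFun_apply _ hz, poleProd, pow_zero, one_mul]
  have h1 : ∀ z ∈ halfPlane,
      (mulConj (creation j (poleFun a)) (creation k (poleFun b)) : ℂ → ℂ) z =
      ∑ l ∈ Finset.range (j + 1), ∑ m ∈ Finset.range (k + 1),
        (creationCoeff j l * ((-1) ^ l * (a.ascFactorial l : ℂ))) *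
        (starRingEnd ℂ) (creationCoeff k m * ((-1) ^ m * (b.ascFactorial m : ℂ))) *
        poleProd (l + m) (a + l) (b + m) z := by
    intro z hz
    rw [creation_poleFun, creation_poleFun, mulConj_sum_sum]
    simp only [mulConj_smul_left, mulConj_smul_right, Submodule.coe_sum, Finset.sum_apply,
      Submodule.coe_smul, Pi.smul_apply, smul_eq_mul]
    refine Finset.sum_congr rfl fun l _ => Finset.sum_congr rfl fun m _ => ?_
    rw [mulConj_apply _ _ hz, ratFun_apply _ _ hz, ratFun_apply _ _ hz, poleProd, pow_add]
    simp only [map_mul, map_pow, conj_ofReal]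
    ring
  rw [h0, integral_congr_ae (ae_eq_of_eqOn_halfPlane h1), integral_finsetSum]
  swap
  · intro l _
    exact integrable_finsetSum _ fun m _ => (integrable_poleProd (by omega)).const_mul _
  have h2 : ∀ l m : ℕ, ∫ z, (creationCoeff j l * ((-1) ^ l * (a.ascFactorial l : ℂ))) *
        (starRingEnd ℂ) (creationCoeff k m * ((-1) ^ m * (b.ascFactorial m : ℂ))) *
        poleProd (l + m) (a + l) (b + m) z ∂area =
      (((-1 : ℤ) ^ l * (-1) ^ m * j.choose l * k.choose m * (l + m).choose l : ℤ) : ℂ) *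
        poleInt 0 a b := by
    intro l m
    rw [integral_const_mul]
    change _ * poleInt (l + m) (a + l) (b + m) = _
    have h3 := poleInt_add_add (a := a) (b := b) (by omega) l m
    have h4 := creationCoeff_mul_conj j k l m
    have h5 : ((l + m).factorial : ℂ) = (l + m).choose l * (l.factorial * m.factorial) := by
      rw [← mul_assoc]
      rw [Nat.choose_symm_add]
      exact_mod_cast (Nat.add_choose_mul_factorial_mul_factorial l m).symm
    have h6 : (l.factorial : ℂ) * m.factorial ≠ 0 := by
      exact_mod_cast mul_ne_zero l.factorial_ne_zero m.factorial_ne_zero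
    rw [eq_div_iff h6] at h4
    simp only [map_mul, map_pow, map_neg, map_one, map_natCast]
    push_cast
    rw [h5] at h3
    linear_combination (creationCoeff j l * (starRingEnd ℂ) (creationCoeff k m) * (-1) ^ l *
      (-1) ^ m) * h3 + ((-1) ^ l * (-1) ^ m * (l + m).choose l * poleInt 0 a b) * h4
  have h7 : ∀ l ∈ Finset.range (j + 1), ∫ z, ∑ m ∈ Finset.range (k + 1),
        (creationCoeff j l * ((-1) ^ l * (a.ascFactorial l : ℂ))) *
        (starRingEnd ℂ) (creationCoeff k m * ((-1) ^ m * (b.ascFactorial m : ℂ))) *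
        poleProd (l + m) (a + l) (b + m) z ∂area = ∑ m ∈ Finset.range (k + 1),
      (((-1 : ℤ) ^ l * (-1) ^ m * j.choose l * k.choose m * (l + m).choose l : ℤ) : ℂ) *
        poleInt 0 a b := by
    intro l _
    rw [integral_finsetSum _ fun m _ => (integrable_poleProd (by omega)).const_mul _]
    exact Finset.sum_congr rfl fun m _ => h2 l m
  rw [Finset.sum_congr rfl h7]
  simp_rw [← Finset.sum_mul]
  have h8 := sum_sum_neg_one_pow_choose j k
  have h9 : ∑ l ∈ Finset.range (j + 1), ∑ m ∈ Finset.range (k + 1),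
      (((-1 : ℤ) ^ l * (-1) ^ m * j.choose l * k.choose m * (l + m).choose l : ℤ) : ℂ) =
      if j = k then 1 else 0 := by
    have h10 := congrArg (Int.cast : ℤ → ℂ) h8
    push_cast at h10 ⊢
    exact h10
  rw [h9]
  split_ifs <;> simp

/-! ### The span of the standard basis -/

/-- `(z - i)^n (1 - iz)^(-n-2)` in terms of `z + i`, up to a constant. -/
def mobiusPole (n : ℕ) (z : ℂ) : ℂ := (z - I) ^ n * pole (n + 2) z

theorem exists_basisFun_eq (n : ℕ) : ∃ c : ℂ, c ≠ 0 ∧ ∀ z ∈ halfPlane,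
    (basisFun n : ℂ → ℂ) z = c * mobiusPole n z := by
  refine ⟨((2 * Real.sqrt ((n + 1) / Real.pi) : ℝ) : ℂ) * ((-I) ^ (n + 2))⁻¹, ?_, fun z hz => ?_⟩
  · refine mul_ne_zero ?_ (inv_ne_zero (pow_ne_zero _ (neg_ne_zero.2 I_ne_zero)))
    have : 0 < Real.sqrt ((n + 1) / Real.pi) := Real.sqrt_pos.2 (by positivity)
    exact_mod_cast (by positivity : (2 * Real.sqrt ((n + 1) / Real.pi) : ℝ) ≠ 0)
  · have h : 1 - I * z = -I * (z + I) := by linear_combination I_mul_I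
    refine (smoothFun.mk_apply _ hz).trans ?_
    rw [h, mul_pow, mobiusPole, pole, div_eq_mul_inv, mul_inv]
    ring

theorem mobiusPole_eq_sum (n : ℕ) {z : ℂ} (hz : z ∈ halfPlane) :
    mobiusPole n z = ∑ k ∈ Finset.range (n + 1), ((-2 * I) ^ k * n.choose k) * pole (k + 2) z := by
  have h0 := add_I_ne_zero (le_of_lt (mem_halfPlane.1 hz))
  rw [mobiusPole, show z - I = -2 * I + (z + I) by ring, add_pow, Finset.sum_mul]
  refine Finset.sum_congr rfl fun k hk => ?_
  obtain ⟨i, rfl⟩ := Nat.exists_eq_add_of_le (Nat.lt_succ_iff.1 (Finset.mem_range.1 hk))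
  rw [pole, pole, Nat.add_sub_cancel_left, show k + i + 2 = i + (k + 2) by ring, pow_add _ i,
    mul_inv]
  have h1 : (z + I) ^ i * ((z + I) ^ i)⁻¹ = 1 := mul_inv_cancel₀ (pow_ne_zero i h0)
  linear_combination ((-2 * I) ^ k * (k + i).choose k * ((z + I) ^ (k + 2))⁻¹) * h1

theorem pole_eq_sum (n : ℕ) {z : ℂ} (hz : z ∈ halfPlane) :
    (-2 * I) ^ n * pole (n + 2) z =
      ∑ k ∈ Finset.range (n + 1), ((-1) ^ (n - k) * n.choose k) * mobiusPole k z := by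
  have h0 := add_I_ne_zero (le_of_lt (mem_halfPlane.1 hz))
  rw [show -2 * I = (z - I) + -(z + I) by ring, add_pow, Finset.sum_mul]
  refine Finset.sum_congr rfl fun k hk => ?_
  obtain ⟨i, rfl⟩ := Nat.exists_eq_add_of_le (Nat.lt_succ_iff.1 (Finset.mem_range.1 hk))
  rw [mobiusPole, pole, pole, Nat.add_sub_cancel_left, show k + i + 2 = i + (k + 2) by ring,
    pow_add _ i, mul_inv, neg_pow]
  have h1 : (z + I) ^ i * ((z + I) ^ i)⁻¹ = 1 := mul_inv_cancel₀ (pow_ne_zero i h0)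
  linear_combination ((z - I) ^ k * (-1) ^ i * (k + i).choose k * ((z + I) ^ (k + 2))⁻¹) * h1

/-- The standard basis has the same span as the functions `(z + i)^(-k-2)`. -/
theorem basisSpan_eq : basisSpan = Submodule.span ℂ (Set.range fun k : ℕ => poleFun (k + 2)) := by
  refine le_antisymm (Submodule.span_le.2 ?_) (Submodule.span_le.2 ?_)
  · rintro _ ⟨n, rfl⟩
    obtain ⟨c, -, hc⟩ := exists_basisFun_eq n
    have h : basisFun n = c • ∑ k ∈ Finset.range (n + 1),
        ((-2 * I) ^ k * n.choose k) • poleFun (k + 2) := by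
      refine smoothFun.ext' fun z hz => ?_
      rw [hc z hz, mobiusPole_eq_sum n hz]
      simp only [Submodule.coe_smul, Submodule.coe_sum, Pi.smul_apply, Finset.sum_apply,
        smul_eq_mul, poleFun_apply _ hz]
    rw [h]
    exact Submodule.smul_mem _ _ (Submodule.sum_mem _ fun k _ => Submodule.smul_mem _ _
      (Submodule.subset_span ⟨k, rfl⟩))
  · rintro _ ⟨n, rfl⟩
    choose c hc0 hc using exists_basisFun_eq
    have h2 : (-2 * I) ^ n ≠ 0 := pow_ne_zero _ (by simp)
    have h : poleFun (n + 2) = ((-2 * I) ^ n)⁻¹ • ∑ k ∈ Finset.range (n + 1),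
        ((-1) ^ (n - k) * n.choose k * (c k)⁻¹) • basisFun k := by
      refine smoothFun.ext' fun z hz => ?_
      simp only [Submodule.coe_smul, Submodule.coe_sum, Pi.smul_apply, Finset.sum_apply,
        smul_eq_mul, poleFun_apply _ hz]
      rw [eq_inv_mul_iff_mul_eq₀ h2, pole_eq_sum n hz]
      refine Finset.sum_congr rfl fun k _ => ?_
      rw [hc k z hz, mul_assoc _ (c k)⁻¹, inv_mul_cancel_left₀ (hc0 k)]
    simp only [SetLike.mem_coe]
    rw [h]
    exact Submodule.smul_mem _ _ (Submodule.sum_mem _ fun k _ => Submodule.smul_mem _ _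
      (Submodule.subset_span ⟨k, rfl⟩))

theorem poleFun_mem_basisSpan {a : ℕ} (ha : 2 ≤ a) : poleFun a ∈ basisSpan := by
  obtain ⟨k, rfl⟩ := Nat.exists_eq_add_of_le' ha
  rw [basisSpan_eq]
  exact Submodule.subset_span ⟨k, rfl⟩

theorem basisSpan_le_of_poleFun_mem {N : Submodule ℂ smoothFun}
    (h : ∀ a, 2 ≤ a → poleFun a ∈ N) : basisSpan ≤ N := by
  rw [basisSpan_eq]
  refine Submodule.span_le.2 ?_
  rintro _ ⟨k, rfl⟩
  exact h _ (by omega)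

theorem delbar_eq_zero_of_mem_basisSpan {f : smoothFun} (hf : f ∈ basisSpan) : delbar f = 0 :=
  LinearMap.mem_ker.1 (basisSpan_le_of_poleFun_mem (N := LinearMap.ker delbar)
    (fun a _ => delbar_poleFun a) hf)

theorem creation_mem_closureL2 (j : ℕ) {f : smoothFun} (hf : f ∈ basisSpan) :
    creation j f ∈ closureL2 := by
  refine basisSpan_le_of_poleFun_mem (N := closureL2.comap (creation j)) (fun a ha => ?_) hf
  rw [Submodule.mem_comap, creation_poleFun]
  exact Submodule.sum_mem _ fun k _ => Submodule.smul_mem _ _ (ratFun_mem_closureL2 (by omega))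

theorem creation_mem_smoothL2 (j : ℕ) {f : smoothFun} (hf : f ∈ basisSpan) :
    creation j f ∈ smoothL2 := (creation_mem_closureL2 j hf).2

theorem mem_smoothL2_of_mem_basisSpan {f : smoothFun} (hf : f ∈ basisSpan) : f ∈ smoothL2 := by
  have := creation_mem_smoothL2 0 hf
  rwa [creation_zero] at this

/-- The operator `S^j` on the span of the standard basis, with values in `L²(Π)`. -/
def creationSpan (j : ℕ) : basisSpan →ₗ[ℂ] L2 :=
  toL2 ∘ₗ (creation j).restrict (q := smoothL2) fun _ hf => creation_mem_smoothL2 j hf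

theorem creationSpan_apply (j : ℕ) (f : basisSpan) :
    creationSpan j f = toL2 ⟨creation j f, creation_mem_smoothL2 j f.2⟩ := rfl

theorem coeFn_creationSpan (j : ℕ) (f : basisSpan) :
    (creationSpan j f : ℂ → ℂ) =ᵐ[area] creation j f := coeFn_toL2 _

theorem basisSpan_induction {p : basisSpan → Prop}
    (pole : ∀ a (ha : 2 ≤ a), p ⟨poleFun a, poleFun_mem_basisSpan ha⟩)
    (add : ∀ x y, p x → p y → p (x + y)) (zero : p 0) (smul : ∀ (c : ℂ) x, p x → p (c • x))
    (x : basisSpan) : p x := by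
  let N : Submodule ℂ smoothFun :=
    { carrier := {f | ∃ h : f ∈ basisSpan, p ⟨f, h⟩}
      add_mem' := fun ⟨h, hp⟩ ⟨h', hp'⟩ => ⟨add_mem h h', add _ _ hp hp'⟩
      zero_mem' := ⟨zero_mem _, zero⟩
      smul_mem' := fun c _ ⟨h, hp⟩ => ⟨Submodule.smul_mem _ c h, smul c _ hp⟩ }
  exact (basisSpan_le_of_poleFun_mem (N := N)
    (fun a ha => ⟨poleFun_mem_basisSpan ha, pole a ha⟩) x.2).2

theorem inner_creationSpan (j k : ℕ) (f g : basisSpan) :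
    ⟪creationSpan k g, creationSpan j f⟫_ℂ =
      if j = k then ⟪creationSpan 0 g, creationSpan 0 f⟫_ℂ else 0 := by
  induction f using basisSpan_induction with
  | pole a ha =>
    induction g using basisSpan_induction with
    | pole b hb =>
      simp only [creationSpan_apply, inner_toL2, creation_zero, Module.End.one_apply]
      exact integral_creation_poleFun j k ha hb
    | add x y hx hy =>
      rw [map_add, map_add, inner_add_left, inner_add_left, hx, hy]
      split_ifs <;> simp
    | zero => simp
    | smul c x hx =>
      rw [map_smul, map_smul, inner_smul_left, inner_smul_left, hx]
      split_ifs <;> simp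
  | add x y hx hy =>
    rw [map_add, map_add, inner_add_right, inner_add_right, hx, hy]
    split_ifs <;> simp
  | zero => simp
  | smul c x hx =>
    rw [map_smul, map_smul, inner_smul_right, inner_smul_right, hx]
    split_ifs <;> simp

/-- The functions `y^s (z + i)^(-a)`, `a ≥ s + 2`, are obtained from the standard basis by the
operators `S^k`, `k ≤ s`. -/
theorem ratFun_mem_iSup_creation {n s a : ℕ} (hs : s < n) (ha : s + 2 ≤ a) :
    ratFun s a ∈ ⨆ k ∈ Finset.range n, basisSpan.map (creation k) := by
  induction s using Nat.strong_induction_on generalizing a with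
  | _ s ih =>
  obtain ⟨b, rfl⟩ := Nat.exists_eq_add_of_le' (show s ≤ a by omega)
  set N := ⨆ k ∈ Finset.range n, basisSpan.map (creation k)
  have h1 : creation s (poleFun b) ∈ N :=
    Submodule.mem_iSup_of_mem s (Submodule.mem_iSup_of_mem (Finset.mem_range.2 hs)
      (Submodule.mem_map_of_mem (poleFun_mem_basisSpan (by omega))))
  rw [creation_poleFun, Finset.sum_range_succ] at h1
  have h2 : ∑ k ∈ Finset.range s, (creationCoeff s k * ((-1) ^ k * (b.ascFactorial k : ℂ))) •
      ratFun k (b + k) ∈ N := Submodule.sum_mem _ fun k hk => by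
    have hk' := Finset.mem_range.1 hk
    exact Submodule.smul_mem _ _ (ih k hk' (by omega) (by omega))
  have h3 := (Submodule.add_mem_iff_right _ h2).1 h1
  refine (Submodule.smul_mem_iff _ ?_).1 h3
  refine mul_ne_zero (creationCoeff_self_ne_zero s) (mul_ne_zero (by simp) ?_)
  have : 0 < b.ascFactorial s := by
    obtain ⟨c, rfl⟩ := Nat.exists_eq_add_of_le' (show 1 ≤ b by omega)
    exact Nat.ascFactorial_pos c s
  exact_mod_cast this.ne'

theorem delbar_pow_mulY_pow {f : smoothFun} (hf : delbar f = 0) {k n : ℕ} (h : k < n) :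
    (delbar ^ n) ((mulY ^ k) f) = 0 := by
  induction k generalizing n with
  | zero =>
    obtain ⟨m, rfl⟩ := Nat.exists_eq_add_of_le' (show 1 ≤ n by omega)
    rw [pow_succ, Module.End.mul_apply, pow_zero, Module.End.one_apply, hf, map_zero]
  | succ k ih =>
    obtain ⟨m, rfl⟩ := Nat.exists_eq_add_of_le' (show 1 ≤ n by omega)
    rw [pow_succ, Module.End.mul_apply, delbar_mulY_pow, hf, map_zero, zero_add, map_smul,
      ih (by omega), smul_zero]

theorem delbar_pow_creation {f : smoothFun} (hf : delbar f = 0) {j n : ℕ} (h : j < n) :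
    (delbar ^ n) (creation j f) = 0 := by
  rw [creation_eq_sum, map_sum]
  refine Finset.sum_eq_zero fun k hk => ?_
  have := Finset.mem_range.1 hk
  rw [map_smul, delbar_pow_mulY_pow (delbar_del_pow hf k) (by omega), smul_zero]

/-! ### Polyanalytic functions on the disk -/

/-- The Fourier coefficient, up to the factor `2π`, of a function on the circle of radius `r`. -/
def circleMode (U : ℂ → ℂ) (m : ℤ) (r : ℝ) : ℂ :=
  ∫ θ in (-Real.pi)..Real.pi, U (circleMap 0 r θ) * Complex.exp (-(m * θ * I))

theorem circleMode_eq_integral (U : ℂ → ℂ) (m : ℤ) (r : ℝ) :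
    circleMode U m r =
      ∫ θ in (0 : ℝ)..2 * Real.pi, U (circleMap 0 r θ) * Complex.exp (-(m * θ * I)) := by
  have hp : Function.Periodic
      (fun θ : ℝ => U (circleMap 0 r θ) * Complex.exp (-(m * θ * I))) (2 * Real.pi) := by
    intro θ
    have h1 : circleMap 0 r (θ + 2 * Real.pi) = circleMap 0 r θ := periodic_circleMap 0 r θ
    have h2 : Complex.exp (-(m * (θ + 2 * Real.pi : ℝ) * I)) = Complex.exp (-(m * θ * I)) := by
      have : (-(m * (θ + 2 * Real.pi : ℝ) * I) : ℂ) =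
          -(m * θ * I) + ((-m : ℤ) : ℂ) * (2 * Real.pi * I) := by
        push_cast; ring
      rw [this, Complex.exp_add, Complex.exp_int_mul_two_pi_mul_I, mul_one]
    simp only [h1, h2]
  have h := hp.intervalIntegral_add_eq (-Real.pi) 0
  rw [zero_add, show -Real.pi + 2 * Real.pi = Real.pi by ring] at h
  exact h

/-- The Cauchy formula for the Taylor coefficients. -/
theorem circleMode_natCast {g : ℂ → ℂ} {r : ℝ} (hr0 : 0 < r)
    (hg : DiffContOnCl ℂ g (Metric.ball 0 r)) (n : ℕ) :
    circleMode g n r = 2 * Real.pi / n.factorial * iteratedDeriv n g 0 * r ^ n := by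
  have h1 := hg.circleIntegral_one_div_sub_center_pow_smul hr0 n
  have hr : (r : ℂ) ≠ 0 := by exact_mod_cast hr0.ne'
  have h2 : (∮ z in C(0, r), (1 / (z - 0) ^ (n + 1)) • g z) =
      I * ((r : ℂ) ^ n)⁻¹ * circleMode g n r := by
    rw [circleMode_eq_integral, circleIntegral, ← intervalIntegral.integral_const_mul]
    refine intervalIntegral.integral_congr fun θ _ => ?_
    have he : Complex.exp (θ * I) ≠ 0 := Complex.exp_ne_zero _
    have h3 : Complex.exp (-(((n : ℤ) : ℂ) * θ * I)) = (Complex.exp (θ * I) ^ n)⁻¹ := by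
      rw [← Complex.exp_nat_mul, ← Complex.exp_neg]
      push_cast
      ring_nf
    simp only [deriv_circleMap, smul_eq_mul, sub_zero, h3]
    simp only [circleMap, zero_add]
    field_simp
    ring
  rw [h2, smul_eq_mul] at h1
  have h4 : (r : ℂ) ^ n ≠ 0 := pow_ne_zero n hr
  have h5 : circleMode g n r = (r : ℂ) ^ n * (-I) * (I * ((r : ℂ) ^ n)⁻¹ *
      circleMode g n r) := by
    field_simp
    linear_combination (circleMode g n r) * I_sq
  rw [h5, h1]
  linear_combination (-(r : ℂ) ^ n * (2 * Real.pi / n.factorial * iteratedDeriv n g 0)) * I_sq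

/-- The Fourier coefficients of a holomorphic function on the circle of radius `r` are multiples of
`r^k` for `k ≥ 0`, and vanish for `k < 0`. -/
theorem circleMode_of_differentiableOn {g : ℂ → ℂ}
    (hg : DifferentiableOn ℂ g (Metric.ball 0 1)) (k : ℤ) :
    ∃ C : ℂ, ∀ r : ℝ, 0 < r → r < 1 →
      circleMode g k r = if 0 ≤ k then C * r ^ k.toNat else 0 := by
  have hd : ∀ r : ℝ, 0 < r → r < 1 → DiffContOnCl ℂ g (Metric.ball 0 r) := fun r _ hr =>
    (hg.mono (Metric.closure_ball_subset_closedBall.trans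
      (Metric.closedBall_subset_ball hr))).diffContOnCl
  cases k with
  | ofNat n =>
    refine ⟨2 * Real.pi / n.factorial * iteratedDeriv n g 0, fun r hr0 hr1 => ?_⟩
    simp only [Int.ofNat_eq_natCast, Int.natCast_nonneg, if_true, Int.toNat_natCast]
    exact circleMode_natCast hr0 (hd r hr0 hr1) n
  | negSucc l =>
    refine ⟨0, fun r hr0 hr1 => ?_⟩
    have hr : (r : ℂ) ≠ 0 := by exact_mod_cast hr0.ne'
    have h1 : (∮ z in C(0, r), z ^ l * g z) = 0 := by
      refine DiffContOnCl.circleIntegral_eq_zero hr0.le ?_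
      exact (Differentiable.diffContOnCl (differentiable_id.pow l)).smul (hd r hr0 hr1)
    have h2 : (∮ z in C(0, r), z ^ l * g z) =
        I * (r : ℂ) ^ (l + 1) * circleMode g (Int.negSucc l) r := by
      rw [circleMode_eq_integral, circleIntegral, ← intervalIntegral.integral_const_mul]
      refine intervalIntegral.integral_congr fun θ _ => ?_
      have h3 : Complex.exp (-(((Int.negSucc l : ℤ) : ℂ) * θ * I)) =
          Complex.exp (θ * I) ^ (l + 1) := by
        rw [← Complex.exp_nat_mul]
        push_cast
        ring_nf
      simp only [deriv_circleMap, smul_eq_mul, h3]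
      simp only [circleMap, zero_add]
      ring
    rw [h2] at h1
    have h4 : ¬ (0 ≤ Int.negSucc l) := by simp
    rw [if_neg h4]
    exact (mul_eq_zero.1 h1).resolve_left (mul_ne_zero I_ne_zero (pow_ne_zero _ hr))

theorem continuousOn_polyanalytic {n : ℕ} {g : ℕ → ℂ → ℂ}
    (hg : ∀ q, DifferentiableOn ℂ (g q) (Metric.ball 0 1)) :
    ContinuousOn (fun w => ∑ q ∈ Finset.range n, (starRingEnd ℂ) w ^ q * g q w)
      (Metric.ball 0 1) :=
  continuousOn_finsetSum _ fun q _ =>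
    (Complex.continuous_conj.pow q).continuousOn.mul (hg q).continuousOn

theorem circleMap_mem_ball_one {r : ℝ} (h0 : 0 < r) (h1 : r < 1) (θ : ℝ) :
    circleMap 0 r θ ∈ Metric.ball (0 : ℂ) 1 := by
  simp [abs_of_pos h0, h1]

theorem continuous_comp_circleMap {U : ℂ → ℂ} (hU : ContinuousOn U (Metric.ball 0 1)) {r : ℝ}
    (h0 : 0 < r) (h1 : r < 1) : Continuous fun θ => U (circleMap 0 r θ) :=
  hU.comp_continuous (continuous_circleMap 0 r) fun θ => circleMap_mem_ball_one h0 h1 θ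

/-- The Fourier coefficients of a polyanalytic function on the circle of radius `r` are polynomials
in `r` of a special form. -/
theorem circleMode_polyanalytic {n : ℕ} {g : ℕ → ℂ → ℂ}
    (hg : ∀ q, DifferentiableOn ℂ (g q) (Metric.ball 0 1)) (m : ℤ) :
    ∃ C : ℕ → ℂ, ∀ r : ℝ, 0 < r → r < 1 →
      circleMode (fun w => ∑ q ∈ Finset.range n, (starRingEnd ℂ) w ^ q * g q w) m r =
        ∑ q ∈ Finset.range n, if 0 ≤ q + m then C q * (r : ℂ) ^ (q + (q + m).toNat) else 0 := by
  choose C hC using fun q : ℕ => circleMode_of_differentiableOn (hg q) (q + m)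
  refine ⟨C, fun r hr0 hr1 => ?_⟩
  have h1 : ∀ θ : ℝ, (∑ q ∈ Finset.range n, (starRingEnd ℂ) (circleMap 0 r θ) ^ q *
      g q (circleMap 0 r θ)) * Complex.exp (-(m * θ * I)) =
      ∑ q ∈ Finset.range n, (r : ℂ) ^ q * (g q (circleMap 0 r θ) *
        Complex.exp (-(((q + m : ℤ) : ℂ) * θ * I))) := by
    intro θ
    rw [Finset.sum_mul]
    refine Finset.sum_congr rfl fun q _ => ?_
    have h2 : (starRingEnd ℂ) (circleMap 0 r θ) = r * Complex.exp (-(θ * I)) := by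
      simp [circleMap, ← Complex.exp_conj]
    have h3 : Complex.exp (-(((q + m : ℤ) : ℂ) * θ * I)) =
        Complex.exp (-(θ * I)) ^ q * Complex.exp (-(m * θ * I)) := by
      rw [← Complex.exp_nat_mul, ← Complex.exp_add]
      push_cast
      ring_nf
    rw [h2, h3]
    ring
  rw [circleMode]
  simp_rw [h1]
  rw [intervalIntegral.integral_finsetSum]
  · refine Finset.sum_congr rfl fun q _ => ?_
    rw [intervalIntegral.integral_const_mul]
    have h4 := hC q r hr0 hr1
    rw [circleMode] at h4
    rw [h4]
    split_ifs
    · rw [pow_add]; ring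
    · rw [mul_zero]
  · intro q _
    refine Continuous.intervalIntegrable ?_ _ _
    exact continuous_const.mul ((continuous_comp_circleMap (hg q).continuousOn hr0 hr1).mul
      (by fun_prop))

/-- A continuous function on the circle is determined by its Fourier coefficients. -/
theorem eq_zero_of_circleMode_eq_zero {U : ℂ → ℂ} (hU : ContinuousOn U (Metric.ball 0 1)) {r : ℝ}
    (h0 : 0 < r) (h1 : r < 1) (h : ∀ m : ℤ, circleMode U m r = 0) (θ : ℝ) :
    U (circleMap 0 r θ) = 0 := by
  have : Fact (0 < 2 * Real.pi) := ⟨Real.two_pi_pos⟩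
  have hex : ∀ (m : ℤ) (t : ℝ), fourier m (t : AddCircle (2 * Real.pi)) =
      Complex.exp (m * t * I) := by
    intro m t
    rw [fourier_coe_apply]
    congr 1
    have : (Real.pi : ℂ) ≠ 0 := by exact_mod_cast Real.pi_ne_zero
    push_cast
    field_simp
  have hcm : ∀ t : ℝ, (r : ℂ) * fourier 1 (t : AddCircle (2 * Real.pi)) = circleMap 0 r t := by
    intro t
    rw [hex]
    simp [circleMap]
  let F : C(AddCircle (2 * Real.pi), ℂ) :=
    ⟨fun x => U (r * fourier 1 x), hU.comp_continuous (by fun_prop) fun x => by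
      induction x using QuotientAddGroup.induction_on with
      | H t => rw [hcm]; exact circleMap_mem_ball_one h0 h1 t⟩
  have hF : ∀ t : ℝ, F (t : AddCircle (2 * Real.pi)) = U (circleMap 0 r t) := fun t => by
    change U _ = _
    rw [hcm]
  have hc : fourierCoeff F = 0 := by
    ext m
    rw [fourierCoeff_eq_intervalIntegral _ m (-Real.pi),
      show -Real.pi + 2 * Real.pi = Real.pi by ring]
    have h2 : (∫ x in (-Real.pi)..Real.pi, (fourier (-m) (x : AddCircle (2 * Real.pi))) •
        F (x : AddCircle (2 * Real.pi))) = circleMode U m r := by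
      refine intervalIntegral.integral_congr fun t _ => ?_
      simp only [hF, hex, smul_eq_mul]
      rw [mul_comm]
      push_cast
      ring_nf
    rw [h2, h m]
    simp
  have hs := has_pointwise_sum_fourier_series_of_summable (f := F) (by rw [hc]; exact summable_zero)
    (θ : AddCircle (2 * Real.pi))
  rw [hc, hF] at hs
  simpa using hs.unique (by simp)

theorem integrableOn_polarCoord_symm {F : ℂ → ℂ} (hF : Integrable F) :
    IntegrableOn (fun p : ℝ × ℝ => p.1 • F (circleMap 0 p.1 p.2))
      (Set.Ioi (0 : ℝ) ×ˢ Set.Ioo (-Real.pi) Real.pi) := by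
  have h1 : Integrable (F ∘ measurableEquivRealProd.symm) (volume : Measure (ℝ × ℝ)) :=
    ((Complex.volume_preserving_equiv_real_prod.symm).integrable_comp_emb
      measurableEquivRealProd.symm.measurableEmbedding).2 hF
  have h2 := (integrableOn_image_iff_integrableOn_abs_det_fderiv_smul volume
    polarCoord.open_target.measurableSet
    (fun p _ => (hasFDerivAt_polarCoord_symm p).hasFDerivWithinAt) polarCoord.symm.injOn
    (F ∘ measurableEquivRealProd.symm)).1 h1.integrableOn
  refine (h2.congr_fun ?_ polarCoord.open_target.measurableSet)
  intro p hp
  have hp1 : 0 < p.1 := hp.1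
  simp only [det_fderivPolarCoordSymm, abs_of_pos hp1, Function.comp_apply,
    measurableEquivRealProd_symm_polarCoord_symm_apply, Complex.polarCoord_symm_apply, circleMap,
    zero_add, Complex.exp_mul_I, ofReal_cos, ofReal_sin]

/-- Integration over the disk in polar coordinates, against a monomial. -/
theorem integral_disk_mul_monomial {U : ℂ → ℂ} (hU : IntegrableOn U (Metric.ball 0 1)) (p q : ℕ) :
    ∫ w in Metric.ball 0 1, U w * ((starRingEnd ℂ) w ^ p * w ^ q) =
      ∫ r in Set.Ioo (0 : ℝ) 1, (r : ℂ) ^ (p + q + 1) * circleMode U (p - q) r := by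
  have hint : IntegrableOn (fun w => U w * ((starRingEnd ℂ) w ^ p * w ^ q)) (Metric.ball 0 1) := by
    refine Integrable.mul_bdd (c := 1) hU (by fun_prop) ?_
    filter_upwards [ae_restrict_mem Metric.isOpen_ball.measurableSet] with w hw
    have hw1 : ‖w‖ ≤ 1 := by simpa using (mem_ball_zero_iff.1 hw).le
    rw [norm_mul, norm_pow, norm_pow, RCLike.norm_conj, ← pow_add]
    exact pow_le_one₀ (norm_nonneg w) hw1
  rw [← integral_indicator Metric.isOpen_ball.measurableSet, ← Complex.integral_comp_polarCoord_symm]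
  have h1 := integrableOn_polarCoord_symm
    ((integrable_indicator_iff Metric.isOpen_ball.measurableSet).2 hint)
  have h2 : ∀ x : ℝ × ℝ, Complex.polarCoord.symm x = circleMap 0 x.1 x.2 := fun x => by
    simp [circleMap, Complex.exp_mul_I]
  simp_rw [h2]
  change ∫ x in (Set.Ioi (0 : ℝ) ×ˢ Set.Ioo (-Real.pi) Real.pi), _ = _
  rw [Measure.volume_eq_prod] at h1 ⊢
  rw [setIntegral_prod _ h1]
  have h3 : ∀ r ∈ Set.Ioi (0 : ℝ), (∫ θ in Set.Ioo (-Real.pi) Real.pi, r •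
      (Metric.ball (0 : ℂ) 1).indicator (fun w => U w * ((starRingEnd ℂ) w ^ p * w ^ q))
        (circleMap 0 r θ)) =
      (Set.Ioo (0 : ℝ) 1).indicator
        (fun r : ℝ => (r : ℂ) ^ (p + q + 1) * circleMode U (p - q) r) r := by
    intro r hr
    have hr0 : (0 : ℝ) < r := hr
    by_cases hr1 : r < 1
    · rw [Set.indicator_of_mem (show r ∈ Set.Ioo (0 : ℝ) 1 from ⟨hr0, hr1⟩), circleMode,
        intervalIntegral.integral_of_le (by linarith [Real.pi_pos]), integral_Ioc_eq_integral_Ioo,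
        ← integral_const_mul]
      refine integral_congr_ae (Filter.Eventually.of_forall fun θ => ?_)
      simp only
      rw [Set.indicator_of_mem (circleMap_mem_ball_one hr0 hr1 θ), Complex.real_smul]
      have h4 : (starRingEnd ℂ) (circleMap 0 r θ) = r * Complex.exp (-(θ * I)) := by
        simp [circleMap, ← Complex.exp_conj]
      have h5 : Complex.exp (-(((p - q : ℤ) : ℂ) * θ * I)) =
          Complex.exp (-(θ * I)) ^ p * Complex.exp (θ * I) ^ q := by
        rw [← Complex.exp_nat_mul, ← Complex.exp_nat_mul, ← Complex.exp_add]
        push_cast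
        ring_nf
      rw [h4, h5]
      simp only [circleMap, zero_add]
      ring
    · rw [Set.indicator_of_notMem fun h => hr1 h.2]
      refine integral_eq_zero_of_ae (Filter.Eventually.of_forall fun θ => ?_)
      simp only
      rw [Set.indicator_of_notMem, smul_zero]
      · rfl
      · simpa [abs_of_pos hr0] using hr1
  rw [setIntegral_congr_fun measurableSet_Ioi h3, setIntegral_indicator measurableSet_Ioo,
    Set.inter_eq_right.2 Set.Ioo_subset_Ioi_self]

/-- An integrable polyanalytic function of order `n` on the disk vanishes away from the origin, if it is
orthogonal to the monomials `w^p w̄^q` with `q < n`. The origin is left out because it is on no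
circle of positive radius. -/
theorem polyanalytic_eq_zero_of_orthogonal {n : ℕ} {g : ℕ → ℂ → ℂ}
    (hg : ∀ q, DifferentiableOn ℂ (g q) (Metric.ball 0 1)) {U : ℂ → ℂ}
    (hUg : U = fun w => ∑ q ∈ Finset.range n, (starRingEnd ℂ) w ^ q * g q w)
    (hU : IntegrableOn U (Metric.ball 0 1))
    (h : ∀ p q, q < n → ∫ w in Metric.ball 0 1, U w * ((starRingEnd ℂ) w ^ p * w ^ q) = 0)
    {w : ℂ} (hw0 : w ≠ 0) (hw : w ∈ Metric.ball (0 : ℂ) 1) : U w = 0 := by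
  have hmode : ∀ (m : ℤ), ∀ r ∈ Set.Ioo (0 : ℝ) 1, circleMode U m r = 0 := by
    intro m
    obtain ⟨C, hC⟩ := circleMode_polyanalytic (n := n) hg m
    rw [← hUg] at hC
    set c : ℝ → ℂ := fun r => ∑ q ∈ Finset.range n,
      if 0 ≤ q + m then C q * (r : ℂ) ^ (q + (q + m).toNat) else 0 with hc
    have hcont : Continuous c := by
      refine continuous_finsetSum _ fun q _ => ?_
      split_ifs <;> fun_prop
    -- the `m`-th Fourier coefficient `c` is orthogonal, for the weight `r`, to each power
    -- of `r` that occurs in it, because the `m`-th mode of `w^(q+m) w̄^q` is `r^(2q+m)`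
    have hterm : ∀ q ∈ Finset.range n, 0 ≤ q + m →
        ∫ r in Set.Ioo (0 : ℝ) 1, (r : ℂ) ^ (q + (q + m).toNat + 1) * c r = 0 := by
      intro q hq hqm
      have h1 := h (q + m).toNat q (Finset.mem_range.1 hq)
      rw [integral_disk_mul_monomial hU, Int.toNat_of_nonneg hqm, add_sub_cancel_left] at h1
      rw [← h1]
      refine setIntegral_congr_fun measurableSet_Ioo fun r hr => ?_
      rw [hC r hr.1 hr.2, add_comm q]
    -- `\overline{c}` is a combination of these powers, so `c` is orthogonal to itself
    have hsq : ∫ r in Set.Ioo (0 : ℝ) 1, ((r * ‖c r‖ ^ 2 : ℝ) : ℂ) = 0 := by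
      have h2 : ∀ r : ℝ, ((r * ‖c r‖ ^ 2 : ℝ) : ℂ) = ∑ q ∈ Finset.range n, if 0 ≤ q + m then
          (starRingEnd ℂ) (C q) * ((r : ℂ) ^ (q + (q + m).toNat + 1) * c r) else 0 := by
        intro r
        have h3 : ((‖c r‖ ^ 2 : ℝ) : ℂ) = c r * (starRingEnd ℂ) (c r) := by
          rw [Complex.mul_conj, Complex.normSq_eq_norm_sq]
        rw [ofReal_mul, h3]
        nth_rw 2 [hc]
        rw [map_sum, Finset.mul_sum, Finset.mul_sum]
        refine Finset.sum_congr rfl fun q _ => ?_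
        split_ifs
        · simp only [map_mul, map_pow, conj_ofReal]
          ring
        · simp
      simp_rw [h2]
      rw [integral_finsetSum]
      · refine Finset.sum_eq_zero fun q hq => ?_
        split_ifs with hqm
        · rw [integral_const_mul, hterm q hq hqm, mul_zero]
        · simp
      · intro q _
        split_ifs
        · refine (Continuous.integrableOn_Icc (a := 0) (b := 1) ?_).mono_set Set.Ioo_subset_Icc_self
          fun_prop
        · exact integrable_zero _ _ _
    rw [integral_complex_ofReal, ofReal_eq_zero] at hsq
    have hae := (setIntegral_eq_zero_iff_of_nonneg_ae (s := Set.Ioo (0 : ℝ) 1)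
      (f := fun r => r * ‖c r‖ ^ 2) ?_ ?_).1 hsq
    · have h4 := MeasureTheory.Measure.eqOn_open_of_ae_eq hae isOpen_Ioo (by fun_prop)
        continuousOn_const
      intro r hr
      have h5 := h4 hr
      simp only [Pi.zero_apply, mul_eq_zero, hr.1.ne', false_or, pow_eq_zero_iff two_ne_zero,
        norm_eq_zero] at h5
      rw [hC r hr.1 hr.2]
      exact h5
    · filter_upwards [ae_restrict_mem measurableSet_Ioo] with r hr
      exact mul_nonneg hr.1.le (by positivity)
    · refine (Continuous.integrableOn_Icc (a := 0) (b := 1) ?_).mono_set Set.Ioo_subset_Icc_self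
      fun_prop
  have hr0 : 0 < ‖w‖ := norm_pos_iff.2 hw0
  have hr1 : ‖w‖ < 1 := mem_ball_zero_iff.1 hw
  have h6 : circleMap 0 ‖w‖ w.arg = w := by
    rw [circleMap, zero_add, Complex.norm_mul_exp_arg_mul_I]
  rw [← h6]
  exact eq_zero_of_circleMode_eq_zero (by rw [hUg]; exact continuousOn_polyanalytic hg) hr0 hr1
    (fun m => hmode m _ ⟨hr0, hr1⟩) _

/-! ### The Cayley transform -/

/-- The Möbius map `w ↦ i (1 + w) / (1 - w)` from the unit disk onto `Π`. -/
def cayley (w : ℂ) : ℂ := I * (1 + w) / (1 - w)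

theorem one_sub_ne_zero_of_mem_ball {w : ℂ} (hw : w ∈ Metric.ball (0 : ℂ) 1) : 1 - w ≠ 0 := by
  intro h
  have h1 : w = 1 := (sub_eq_zero.1 h).symm
  simp [h1] at hw

theorem one_sub_conj_ne_zero_of_mem_ball {w : ℂ} (hw : w ∈ Metric.ball (0 : ℂ) 1) :
    1 - (starRingEnd ℂ) w ≠ 0 := by
  have h := (map_ne_zero (starRingEnd ℂ)).2 (one_sub_ne_zero_of_mem_ball hw)
  rwa [map_sub, map_one] at h

theorem cayley_add_I {w : ℂ} (hw : w ∈ Metric.ball (0 : ℂ) 1) :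
    cayley w + I = 2 * I / (1 - w) := by
  have := one_sub_ne_zero_of_mem_ball hw
  rw [cayley]
  field_simp
  ring

theorem cayley_sub_I {w : ℂ} (hw : w ∈ Metric.ball (0 : ℂ) 1) :
    cayley w - I = w * (2 * I / (1 - w)) := by
  have := one_sub_ne_zero_of_mem_ball hw
  rw [cayley]
  field_simp
  ring

theorem conj_cayley (w : ℂ) :
    (starRingEnd ℂ) (cayley w) = -I * (1 + (starRingEnd ℂ) w) / (1 - (starRingEnd ℂ) w) := by
  simp [cayley]

theorem im_cayley {w : ℂ} (hw : w ∈ Metric.ball (0 : ℂ) 1) :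
    ((cayley w).im : ℂ) =
      (1 - w * (starRingEnd ℂ) w) / ((1 - w) * (1 - (starRingEnd ℂ) w)) := by
  have h1 := one_sub_ne_zero_of_mem_ball hw
  have h2 := one_sub_conj_ne_zero_of_mem_ball hw
  rw [Complex.im_eq_sub_conj, conj_cayley, cayley]
  field_simp
  ring

theorem cayley_mem_halfPlane {w : ℂ} (hw : w ∈ Metric.ball (0 : ℂ) 1) : cayley w ∈ halfPlane := by
  have h1 := one_sub_ne_zero_of_mem_ball hw
  have h2 : (cayley w).im = (1 - Complex.normSq w) / Complex.normSq (1 - w) := by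
    have h := im_cayley hw
    have h3 : (1 - w) * (1 - (starRingEnd ℂ) w) = (Complex.normSq (1 - w) : ℂ) := by
      rw [← Complex.mul_conj, map_sub, map_one]
    rw [Complex.mul_conj, h3] at h
    exact_mod_cast h
  rw [mem_halfPlane, h2]
  have h3 : Complex.normSq w < 1 := by
    have h4 : ‖w‖ < 1 := mem_ball_zero_iff.1 hw
    rw [Complex.normSq_eq_norm_sq]
    nlinarith [norm_nonneg w]
  exact div_pos (by linarith) (Complex.normSq_pos.2 h1)

theorem cayley_image : cayley '' Metric.ball (0 : ℂ) 1 = halfPlane := by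
  refine Set.Subset.antisymm (Set.image_subset_iff.2 fun w hw => cayley_mem_halfPlane hw) ?_
  intro z hz
  have hz0 : 0 < z.im := hz
  have h0 := add_I_ne_zero hz0.le
  refine ⟨(z - I) / (z + I), ?_, ?_⟩
  · rw [mem_ball_zero_iff, norm_div, div_lt_one (norm_pos_iff.2 h0),
      ← sq_lt_sq₀ (norm_nonneg _) (norm_nonneg _), ← Complex.normSq_eq_norm_sq,
      ← Complex.normSq_eq_norm_sq, Complex.normSq_apply, Complex.normSq_apply]
    simp
    nlinarith
  · have h1 : 1 - (z - I) / (z + I) = 2 * I / (z + I) := by field_simp; ring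
    have h2 : 1 + (z - I) / (z + I) = 2 * z / (z + I) := by field_simp; ring
    rw [cayley, h1, h2]
    field_simp

theorem cayley_injOn : Set.InjOn cayley (Metric.ball (0 : ℂ) 1) := by
  intro w hw w' hw' h
  have h1 := one_sub_ne_zero_of_mem_ball hw
  have h2 := one_sub_ne_zero_of_mem_ball hw'
  rw [cayley, cayley, div_eq_div_iff h1 h2] at h
  have h3 : 2 * I * (w - w') = 0 := by linear_combination h
  exact sub_eq_zero.1 ((mul_eq_zero.1 h3).resolve_left (by simp))

theorem hasDerivAt_cayley {w : ℂ} (hw : w ∈ Metric.ball (0 : ℂ) 1) :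
    HasDerivAt cayley (2 * I / (1 - w) ^ 2) w := by
  have h1 := one_sub_ne_zero_of_mem_ball hw
  have h2 := (((hasDerivAt_id w).const_add 1).const_mul I).div ((hasDerivAt_id w).const_sub 1) h1
  refine h2.congr_deriv ?_
  simp only [id]
  field_simp
  ring

/-- The Jacobian determinant of a holomorphic map. -/
theorem det_restrictScalars_toSpanSingleton (c : ℂ) :
    ((ContinuousLinearMap.toSpanSingleton ℂ c).restrictScalars ℝ : ℂ →L[ℝ] ℂ).det = ‖c‖ ^ 2 := by
  have h : ((ContinuousLinearMap.toSpanSingleton ℂ c).restrictScalars ℝ : ℂ →ₗ[ℝ] ℂ) =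
      Algebra.lmul ℝ ℂ c := by
    ext
    simp [mul_comm]
  rw [ContinuousLinearMap.det, h, ← Algebra.norm_apply, Algebra.norm_complex_apply,
    Complex.normSq_eq_norm_sq]

theorem hasFDerivWithinAt_cayley {w : ℂ} (hw : w ∈ Metric.ball (0 : ℂ) 1) :
    HasFDerivWithinAt cayley ((ContinuousLinearMap.toSpanSingleton ℂ
      (2 * I / (1 - w) ^ 2)).restrictScalars ℝ : ℂ →L[ℝ] ℂ) (Metric.ball 0 1) w :=
  ((hasDerivAt_cayley hw).hasFDerivAt.restrictScalars ℝ).hasFDerivWithinAt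

theorem integral_area_eq_integral_disk (F : ℂ → ℂ) :
    ∫ z, F z ∂area = ∫ w in Metric.ball (0 : ℂ) 1, ‖2 * I / (1 - w) ^ 2‖ ^ 2 • F (cayley w) := by
  have h := integral_image_eq_integral_abs_det_fderiv_smul volume
    Metric.isOpen_ball.measurableSet (fun w hw => hasFDerivWithinAt_cayley hw) cayley_injOn F
  rw [cayley_image] at h
  rw [h]
  simp only [det_restrictScalars_toSpanSingleton, abs_pow, abs_norm]

theorem integrable_area_iff (F : ℂ → ℝ) : Integrable F area ↔
    IntegrableOn (fun w => ‖2 * I / (1 - w) ^ 2‖ ^ 2 • F (cayley w)) (Metric.ball (0 : ℂ) 1) := by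
  have h := integrableOn_image_iff_integrableOn_abs_det_fderiv_smul volume
    Metric.isOpen_ball.measurableSet (fun w hw => hasFDerivWithinAt_cayley hw) cayley_injOn F
  rw [cayley_image] at h
  simp only [det_restrictScalars_toSpanSingleton, abs_pow, abs_norm] at h
  exact h

/-! ### Polyanalytic functions on the half-plane -/

theorem delbar_pow_mulY_pow_self {h : smoothFun} (hh : delbar h = 0) (n : ℕ) :
    (delbar ^ n) ((mulY ^ n) h) = (n.factorial * (I / 2) ^ n : ℂ) • h := by
  induction n with
  | zero => simp
  | succ n ih =>
    rw [pow_succ delbar, Module.End.mul_apply, delbar_mulY_pow, hh, map_zero, zero_add, map_smul,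
      ih, smul_smul, Nat.factorial_succ, pow_succ]
    congr 1
    push_cast
    ring

/-- A smooth solution of `∂̄^n f = 0` is a polynomial in `y` of degree less than `n` with
holomorphic coefficients. -/
theorem exists_eq_sum_mulY_pow {n : ℕ} {f : smoothFun} (hf : (delbar ^ n) f = 0) :
    ∃ h : ℕ → smoothFun, (∀ q, delbar (h q) = 0) ∧
      f = ∑ q ∈ Finset.range n, (mulY ^ q) (h q) := by
  induction n generalizing f with
  | zero => exact ⟨0, fun q => map_zero _, by simpa using hf⟩
  | succ n ih =>
    have h1 : delbar ((delbar ^ n) f) = 0 := by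
      rw [← Module.End.mul_apply, ← pow_succ', hf]
    set c : ℂ := n.factorial * (I / 2) ^ n
    have hc : c ≠ 0 := mul_ne_zero (by exact_mod_cast n.factorial_ne_zero)
      (pow_ne_zero n (by simp))
    obtain ⟨h, hh, hsum⟩ := ih (f := f - (mulY ^ n) (c⁻¹ • (delbar ^ n) f)) (by
      rw [map_sub, delbar_pow_mulY_pow_self (by rw [map_smul, h1, smul_zero]), smul_smul,
        mul_inv_cancel₀ hc, one_smul, sub_self])
    refine ⟨fun q => if q < n then h q else c⁻¹ • (delbar ^ n) f, fun q => ?_, ?_⟩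
    · simp only
      split_ifs
      · exact hh q
      · rw [map_smul, h1, smul_zero]
    · simp only
      rw [Finset.sum_range_succ, if_neg (lt_irrefl n), ← sub_eq_iff_eq_add, hsum]
      exact Finset.sum_congr rfl fun q hq => by rw [if_pos (Finset.mem_range.1 hq)]

/-- The functions on the unit disk that are polynomials in `w̄` of degree less than `n` with
holomorphic coefficients. -/
def PolyanalyticOnDisk (n : ℕ) (U : ℂ → ℂ) : Prop :=
  ∃ g : ℕ → ℂ → ℂ, (∀ q, DifferentiableOn ℂ (g q) (Metric.ball 0 1)) ∧
    ∀ w ∈ Metric.ball (0 : ℂ) 1, U w = ∑ q ∈ Finset.range n, (starRingEnd ℂ) w ^ q * g q w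

namespace PolyanalyticOnDisk

theorem add {n : ℕ} {U V : ℂ → ℂ} (hU : PolyanalyticOnDisk n U) (hV : PolyanalyticOnDisk n V) :
    PolyanalyticOnDisk n fun w => U w + V w := by
  obtain ⟨g, hg, hUg⟩ := hU
  obtain ⟨g', hg', hVg⟩ := hV
  refine ⟨fun q w => g q w + g' q w, fun q => (hg q).add (hg' q), fun w hw => ?_⟩
  simp only
  rw [hUg w hw, hVg w hw, ← Finset.sum_add_distrib]
  exact Finset.sum_congr rfl fun q _ => by ring

theorem zero (n : ℕ) : PolyanalyticOnDisk n fun _ => 0 :=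
  ⟨fun _ _ => 0, fun _ => differentiableOn_const 0, fun w _ => by simp⟩

theorem sum {ι : Type*} {n : ℕ} {s : Finset ι} {U : ι → ℂ → ℂ}
    (hU : ∀ i ∈ s, PolyanalyticOnDisk n (U i)) :
    PolyanalyticOnDisk n fun w => ∑ i ∈ s, U i w := by
  classical
  induction s using Finset.induction_on with
  | empty => simpa using zero n
  | insert i s hi ih =>
    simp only [Finset.sum_insert hi]
    exact (hU i (Finset.mem_insert_self i s)).add
      (ih fun k hk => hU k (Finset.mem_insert_of_mem hk))

theorem congr {n : ℕ} {U V : ℂ → ℂ} (hU : PolyanalyticOnDisk n U)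
    (h : ∀ w ∈ Metric.ball (0 : ℂ) 1, V w = U w) : PolyanalyticOnDisk n V := by
  obtain ⟨g, hg, hUg⟩ := hU
  exact ⟨g, hg, fun w hw => (h w hw).trans (hUg w hw)⟩

theorem of_differentiableOn {g : ℂ → ℂ} (hg : DifferentiableOn ℂ g (Metric.ball 0 1)) :
    PolyanalyticOnDisk 1 g :=
  ⟨fun _ => g, fun _ => hg, fun w _ => by simp⟩

/-- Multiplication by a factor affine in `w̄` raises the order by one. -/
theorem affine_mul {n : ℕ} {U : ℂ → ℂ} (hU : PolyanalyticOnDisk n U) {a b : ℂ → ℂ}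
    (ha : Differentiable ℂ a) (hb : Differentiable ℂ b) :
    PolyanalyticOnDisk (n + 1) fun w => (a w - b w * (starRingEnd ℂ) w) * U w := by
  obtain ⟨g, hg, hUg⟩ := hU
  have h1 : PolyanalyticOnDisk (n + 1) fun w => a w * U w := by
    refine ⟨fun q w => if q < n then a w * g q w else 0, fun q => ?_, fun w hw => ?_⟩
    · simp only
      split_ifs
      · exact ha.differentiableOn.mul (hg q)
      · exact differentiableOn_const 0
    · simp only
      rw [Finset.sum_range_succ, if_neg (lt_irrefl n), mul_zero, add_zero, hUg w hw,
        Finset.mul_sum]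
      refine Finset.sum_congr rfl fun q hq => ?_
      rw [if_pos (Finset.mem_range.1 hq)]
      ring
  have h2 : PolyanalyticOnDisk (n + 1) fun w => -b w * (starRingEnd ℂ) w * U w := by
    refine ⟨fun q w => if q = 0 then 0 else -b w * g (q - 1) w, fun q => ?_, fun w hw => ?_⟩
    · simp only
      split_ifs
      · exact differentiableOn_const 0
      · exact hb.neg.differentiableOn.mul (hg _)
    · simp only
      rw [Finset.sum_range_succ', hUg w hw, Finset.mul_sum]
      simp only [Nat.add_eq_zero_iff, one_ne_zero, and_false, if_false, if_true,
        Nat.add_sub_cancel, mul_zero, add_zero]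
      refine Finset.sum_congr rfl fun q _ => ?_
      ring
  exact (h1.add h2).congr fun w _ => by ring

theorem affine_pow_mul {n : ℕ} {U : ℂ → ℂ} (hU : PolyanalyticOnDisk n U) {a b : ℂ → ℂ}
    (ha : Differentiable ℂ a) (hb : Differentiable ℂ b) (k : ℕ) :
    PolyanalyticOnDisk (n + k) fun w => (a w - b w * (starRingEnd ℂ) w) ^ k * U w := by
  induction k with
  | zero => simpa using hU
  | succ k ih =>
    exact (ih.affine_mul ha hb).congr fun w _ => by ring

end PolyanalyticOnDisk

/-- The span of the functions `y^s (z + i)^(-a)` with `s ≤ m` and `a ≥ s + d`. -/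
def ratSpan (m d : ℕ) : Submodule ℂ smoothFun :=
  Submodule.span ℂ {f | ∃ s a, s ≤ m ∧ s + d ≤ a ∧ f = ratFun s a}

theorem ratFun_mem_ratSpan {m d s a : ℕ} (hs : s ≤ m) (ha : s + d ≤ a) :
    ratFun s a ∈ ratSpan m d := Submodule.subset_span ⟨s, a, hs, ha, rfl⟩

/-- If multiplication by `F` maps the generators of one span of rational functions to another such
span, then it does so for all elements. -/
theorem exists_mem_ratSpan_mul {m d m' d' : ℕ} {F : ℂ → ℂ}
    (h : ∀ s a, s ≤ m → s + d ≤ a → ∃ g ∈ ratSpan m' d',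
      ∀ z ∈ halfPlane, (g : ℂ → ℂ) z = F z * (ratFun s a : ℂ → ℂ) z)
    {f : smoothFun} (hf : f ∈ ratSpan m d) :
    ∃ g ∈ ratSpan m' d', ∀ z ∈ halfPlane, (g : ℂ → ℂ) z = F z * (f : ℂ → ℂ) z := by
  induction hf using Submodule.span_induction with
  | mem f hf =>
    obtain ⟨s, a, hs, ha, rfl⟩ := hf
    exact h s a hs ha
  | zero => exact ⟨0, zero_mem _, fun z _ => by simp⟩
  | add f f' _ _ ih ih' =>
    obtain ⟨g, hg, hgf⟩ := ih
    obtain ⟨g', hg', hgf'⟩ := ih'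
    exact ⟨g + g', add_mem hg hg', fun z hz => by simp [hgf z hz, hgf' z hz, mul_add]⟩
  | smul c f _ ih =>
    obtain ⟨g, hg, hgf⟩ := ih
    refine ⟨c • g, Submodule.smul_mem _ c hg, fun z hz => ?_⟩
    simp only [Submodule.coe_smul, Pi.smul_apply, smul_eq_mul, hgf z hz]
    ring

/-- Multiplication by `(z - i) / (z + i)`, which is `w` on the disk. -/
theorem exists_ratSpan_mul_mobius {m d : ℕ} {f : smoothFun} (hf : f ∈ ratSpan m d) :
    ∃ g ∈ ratSpan m d, ∀ z ∈ halfPlane, (g : ℂ → ℂ) z = (z - I) / (z + I) * (f : ℂ → ℂ) z := by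
  refine exists_mem_ratSpan_mul (fun s a hs ha => ?_) hf
  refine ⟨ratFun s a - (2 * I) • ratFun s (a + 1), sub_mem (ratFun_mem_ratSpan hs ha)
    (Submodule.smul_mem _ _ (ratFun_mem_ratSpan hs (by omega))), fun z hz => ?_⟩
  have h0 := add_I_ne_zero (le_of_lt (mem_halfPlane.1 hz))
  simp only [Submodule.coe_sub, Submodule.coe_smul, Pi.sub_apply, Pi.smul_apply, smul_eq_mul,
    ratFun_apply _ _ hz, pole]
  field_simp
  ring

/-- Multiplication by `z̄ + c = (z + i) - 2iy + (c - i)`. -/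
theorem exists_ratSpan_mul_conj_add {m d : ℕ} (c : ℂ) {f : smoothFun}
    (hf : f ∈ ratSpan m (d + 1)) :
    ∃ g ∈ ratSpan (m + 1) d, ∀ z ∈ halfPlane,
      (g : ℂ → ℂ) z = ((starRingEnd ℂ) z + c) * (f : ℂ → ℂ) z := by
  refine exists_mem_ratSpan_mul (fun s a hs ha => ?_) hf
  obtain ⟨b, rfl⟩ := Nat.exists_eq_add_of_le' (show 1 ≤ a by omega)
  refine ⟨ratFun s b - (2 * I) • ratFun (s + 1) (b + 1) + (c - I) • ratFun s (b + 1),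
    add_mem (sub_mem (ratFun_mem_ratSpan (by omega) (by omega))
      (Submodule.smul_mem _ _ (ratFun_mem_ratSpan (by omega) (by omega))))
    (Submodule.smul_mem _ _ (ratFun_mem_ratSpan (by omega) (by omega))), fun z hz => ?_⟩
  have h0 := add_I_ne_zero (le_of_lt (mem_halfPlane.1 hz))
  have h1 : (starRingEnd ℂ) z = (z + I) - 2 * I * z.im - I := by
    rw [Complex.im_eq_sub_conj]
    field_simp
    ring
  rw [h1]
  simp only [Submodule.coe_add, Submodule.coe_sub, Submodule.coe_smul, Pi.add_apply, Pi.sub_apply,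
    Pi.smul_apply, smul_eq_mul, ratFun_apply _ _ hz, pole, pow_succ, mul_inv]
  have h2 : (z + I) * (z + I)⁻¹ = 1 := mul_inv_cancel₀ h0
  linear_combination (-(z.im : ℂ) ^ s * ((z + I) ^ b)⁻¹) * h2

/-- The functions that correspond to the monomials `w^p w̄^q` on the disk are spanned by
`y^s (z + i)^(-a)`. -/
theorem exists_ratSpan_monomial (N p q : ℕ) (hq : q ≤ N) :
    ∃ v ∈ ratSpan N 2, ∀ z ∈ halfPlane, (v : ℂ → ℂ) z = ((starRingEnd ℂ) z + I) ^ q *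
      ((starRingEnd ℂ) z - I) ^ (N - q) * (((z - I) / (z + I)) ^ p * pole (N + 2) z) := by
  have h1 : ∀ p, ∃ v ∈ ratSpan 0 (N + 2), ∀ z ∈ halfPlane,
      (v : ℂ → ℂ) z = ((z - I) / (z + I)) ^ p * pole (N + 2) z := by
    intro p
    induction p with
    | zero =>
      exact ⟨ratFun 0 (N + 2), ratFun_mem_ratSpan le_rfl (by omega), fun z hz => by
        simp [ratFun_apply _ _ hz]⟩
    | succ p ih =>
      obtain ⟨v, hv, hvz⟩ := ih
      obtain ⟨g, hg, hgz⟩ := exists_ratSpan_mul_mobius hv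
      exact ⟨g, hg, fun z hz => by rw [hgz z hz, hvz z hz, pow_succ]; ring⟩
  have hmul : ∀ (c : ℂ) (k m d : ℕ) (f : smoothFun), f ∈ ratSpan m (d + k) →
      ∃ g ∈ ratSpan (m + k) d, ∀ z ∈ halfPlane,
        (g : ℂ → ℂ) z = ((starRingEnd ℂ) z + c) ^ k * (f : ℂ → ℂ) z := by
    intro c k
    induction k with
    | zero => exact fun m d f hf => ⟨f, hf, fun z _ => by simp⟩
    | succ k ih =>
      intro m d f hf
      obtain ⟨g, hg, hgz⟩ := exists_ratSpan_mul_conj_add c (d := d + k) (by rwa [add_assoc])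
      obtain ⟨g', hg', hgz'⟩ := ih (m + 1) d g hg
      refine ⟨g', by rwa [add_assoc, add_comm 1 k] at hg', fun z hz => ?_⟩
      rw [hgz' z hz, hgz z hz]
      ring
  obtain ⟨v, hv, hvz⟩ := h1 p
  obtain ⟨i, rfl⟩ := Nat.exists_eq_add_of_le hq
  obtain ⟨v', hv', hvz'⟩ := hmul (-I) i 0 (2 + q) v (by
    rwa [show 2 + q + i = q + i + 2 by ring])
  obtain ⟨v'', hv'', hvz''⟩ := hmul I q _ 2 v' hv'
  refine ⟨v'', by rwa [show 0 + i + q = q + i by ring] at hv'', fun z hz => ?_⟩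
  rw [hvz'' z hz, hvz' z hz, hvz z hz, Nat.add_sub_cancel_left]
  ring

theorem ratSpan_le_smoothL2 (m : ℕ) : ratSpan m 2 ≤ smoothL2 := by
  refine Submodule.span_le.2 ?_
  rintro _ ⟨s, a, -, ha, rfl⟩
  exact ratFun_mem_smoothL2 ha

theorem differentiableOn_comp_cayley {h : smoothFun} (hh : delbar h = 0) :
    DifferentiableOn ℂ (fun w => (h : ℂ → ℂ) (cayley w)) (Metric.ball 0 1) :=
  ((delbar_eq_zero_iff h).1 hh).comp
    (fun _ hw => (hasDerivAt_cayley hw).differentiableAt.differentiableWithinAt)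
    fun _ hw => cayley_mem_halfPlane hw

theorem differentiableOn_one_sub_pow_inv (k : ℕ) :
    DifferentiableOn ℂ (fun w : ℂ => ((1 - w) ^ k)⁻¹) (Metric.ball 0 1) := by
  refine DifferentiableOn.inv (by fun_prop) fun w hw => pow_ne_zero k ?_
  exact one_sub_ne_zero_of_mem_ball hw

/-- The pullback of a function on `Π` to the disk, with a factor of modulus `|cayley'| / 2` that
makes it polyanalytic of order `N + 1` if the given function is. -/
def diskPullback (N : ℕ) (f : smoothFun) (w : ℂ) : ℂ :=
  (f : ℂ → ℂ) (cayley w) * (1 - (starRingEnd ℂ) w) ^ N * ((1 - w) ^ (N + 2))⁻¹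

theorem polyanalyticOnDisk_diskPullback {N : ℕ} {f : smoothFun} (hf : (delbar ^ (N + 1)) f = 0) :
    PolyanalyticOnDisk (N + 1) (diskPullback N f) := by
  obtain ⟨h, hh, hsum⟩ := exists_eq_sum_mulY_pow hf
  have h1 : ∀ q ∈ Finset.range (N + 1), PolyanalyticOnDisk (N + 1) fun w =>
      (1 - 1 * (starRingEnd ℂ) w) ^ (N - q) * ((1 - w * (starRingEnd ℂ) w) ^ q *
        (((h q : ℂ → ℂ) (cayley w)) * ((1 - w) ^ (q + N + 2))⁻¹)) := by
    intro q hq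
    have hq' : q ≤ N := Nat.lt_succ_iff.1 (Finset.mem_range.1 hq)
    have h2 := PolyanalyticOnDisk.of_differentiableOn
      ((differentiableOn_comp_cayley (hh q)).mul (differentiableOn_one_sub_pow_inv (q + N + 2)))
    have h3 := (h2.affine_pow_mul (a := fun _ => 1) (b := fun w => w) (differentiable_const 1)
      differentiable_id q).affine_pow_mul (a := fun _ => 1) (b := fun _ => 1)
      (differentiable_const 1) (differentiable_const 1) (N - q)
    rwa [show 1 + q + (N - q) = N + 1 by omega] at h3
  refine (PolyanalyticOnDisk.sum h1).congr fun w hw => ?_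
  have hz := cayley_mem_halfPlane hw
  have e1 := one_sub_ne_zero_of_mem_ball hw
  have e2 := one_sub_conj_ne_zero_of_mem_ball hw
  rw [diskPullback, hsum]
  simp only [Submodule.coe_sum, Finset.sum_apply, Finset.sum_mul]
  refine Finset.sum_congr rfl fun q hq => ?_
  obtain ⟨i, rfl⟩ := Nat.exists_eq_add_of_le (Nat.lt_succ_iff.1 (Finset.mem_range.1 hq))
  rw [mulY_pow_apply _ _ hz, im_cayley hw, Nat.add_sub_cancel_left, div_pow, mul_pow]
  simp only [one_mul, pow_add]
  field_simp

theorem norm_diskPullback (N : ℕ) (f : smoothFun) {w : ℂ} (hw : w ∈ Metric.ball (0 : ℂ) 1) :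
    ‖diskPullback N f w‖ ^ 2 =
      1 / 4 * (‖2 * I / (1 - w) ^ 2‖ ^ 2 • ‖(f : ℂ → ℂ) (cayley w)‖ ^ 2) := by
  have e1 : ‖1 - w‖ ≠ 0 := norm_ne_zero_iff.2 (one_sub_ne_zero_of_mem_ball hw)
  have e2 : ‖1 - (starRingEnd ℂ) w‖ = ‖1 - w‖ := by
    rw [← RCLike.norm_conj (1 - w), map_sub, map_one]
  rw [diskPullback, norm_mul, norm_mul, norm_inv, norm_pow, norm_pow, e2, norm_div, norm_pow,
    norm_mul, norm_I, smul_eq_mul, Complex.norm_two]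
  field_simp
  ring

theorem integrableOn_diskPullback {N : ℕ} {f : smoothFun} (hf : f ∈ smoothL2) :
    IntegrableOn (diskPullback N f) (Metric.ball 0 1) := by
  have hcont : ContinuousOn (diskPullback N f) (Metric.ball 0 1) := by
    refine ((f.2.1.continuousOn.comp (fun w hw =>
      (hasDerivAt_cayley hw).continuousAt.continuousWithinAt)
      fun w hw => cayley_mem_halfPlane hw).mul ?_).mul
      (differentiableOn_one_sub_pow_inv (N + 2)).continuousOn
    exact ((continuous_const.sub Complex.continuous_conj).pow N).continuousOn
  have hmeas := hcont.aestronglyMeasurable (μ := volume) Metric.isOpen_ball.measurableSet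
  have h1 := (memLp_two_iff_integrable_sq_norm (aestronglyMeasurable_smoothFun f)).1 hf
  have h2 := ((integrable_area_iff _).1 h1).const_mul (1 / 4 : ℝ)
  have h3 : MemLp (diskPullback N f) 2 (volume.restrict (Metric.ball (0 : ℂ) 1)) := by
    rw [memLp_two_iff_integrable_sq_norm hmeas]
    refine Integrable.congr h2 ?_
    filter_upwards [ae_restrict_mem Metric.isOpen_ball.measurableSet] with w hw
    exact (norm_diskPullback N f hw).symm
  have : IsFiniteMeasure (volume.restrict (Metric.ball (0 : ℂ) 1)) :=
    ⟨by rw [Measure.restrict_apply_univ]; exact measure_ball_lt_top⟩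
  exact h3.integrable (by norm_num)

/-- The functions `y^s (z + i)^(-a)`, `s ≤ N`, are total in the poly-Bergman space of order
`N + 1`. -/
theorem eq_zero_of_inner_ratFun {N : ℕ} {f : smoothFun} (hf : (delbar ^ (N + 1)) f = 0)
    (hf2 : f ∈ smoothL2) (h : ∀ s a (ha : s + 2 ≤ a), s ≤ N →
      ⟪toL2 ⟨ratFun s a, ratFun_mem_smoothL2 ha⟩, toL2 ⟨f, hf2⟩⟫_ℂ = 0) : f = 0 := by
  have hspan : ∀ v (hv : v ∈ ratSpan N 2),
      ⟪toL2 ⟨v, ratSpan_le_smoothL2 N hv⟩, toL2 ⟨f, hf2⟩⟫_ℂ = 0 := by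
    intro v hv
    induction hv using Submodule.span_induction with
    | mem v hv =>
      obtain ⟨s, a, hs, ha, rfl⟩ := hv
      exact h s a ha hs
    | zero =>
      have : toL2 ⟨0, ratSpan_le_smoothL2 N (zero_mem _)⟩ = 0 := map_zero toL2
      rw [this, inner_zero_left]
    | add v v' hv hv' ih ih' =>
      have : toL2 ⟨v + v', ratSpan_le_smoothL2 N (add_mem hv hv')⟩ =
          toL2 ⟨v, ratSpan_le_smoothL2 N hv⟩ + toL2 ⟨v', ratSpan_le_smoothL2 N hv'⟩ :=
        map_add toL2 ⟨v, _⟩ ⟨v', _⟩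
      rw [this, inner_add_left, ih, ih', add_zero]
    | smul c v hv ih =>
      have : toL2 ⟨c • v, ratSpan_le_smoothL2 N (Submodule.smul_mem _ c hv)⟩ =
          c • toL2 ⟨v, ratSpan_le_smoothL2 N hv⟩ := map_smul toL2 c ⟨v, _⟩
      rw [this, inner_smul_left, ih, mul_zero]
  obtain ⟨g, hg, hUg⟩ := polyanalyticOnDisk_diskPullback hf
  have horth : ∀ p q, q < N + 1 → ∫ w in Metric.ball 0 1,
      (∑ q ∈ Finset.range (N + 1), (starRingEnd ℂ) w ^ q * g q w) *
        ((starRingEnd ℂ) w ^ p * w ^ q) = 0 := by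
    intro p q hq
    obtain ⟨i, rfl⟩ := Nat.exists_eq_add_of_le (Nat.lt_succ_iff.1 hq)
    obtain ⟨v, hv, hvz⟩ := exists_ratSpan_monomial (q + i) p q (by omega)
    have h1 := hspan v hv
    rw [inner_toL2, integral_area_eq_integral_disk] at h1
    -- in the disk variable, pairing with `v` is pairing with `w^p w̄^q`, up to a constant
    have h2 : ∀ w ∈ Metric.ball (0 : ℂ) 1, ‖2 * I / (1 - w) ^ 2‖ ^ 2 •
        (mulConj f v : ℂ → ℂ) (cayley w) = (4 * (2 * I) ^ (q + i) * ((-2 * I) ^ (q + i + 2))⁻¹) *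
        ((∑ k ∈ Finset.range (q + i + 1), (starRingEnd ℂ) w ^ k * g k w) *
        ((starRingEnd ℂ) w ^ p * w ^ q)) := by
      intro w hw
      have hz := cayley_mem_halfPlane hw
      have e1 := one_sub_ne_zero_of_mem_ball hw
      have e2 := one_sub_conj_ne_zero_of_mem_ball hw
      have e3 : (starRingEnd ℂ) 2 = 2 := map_ofNat _ 2
      have e4 : (cayley w - I) / (cayley w + I) = w := by
        rw [cayley_add_I hw, cayley_sub_I hw]
        field_simp
      have e5 : (starRingEnd ℂ) ((starRingEnd ℂ) (cayley w) + I) = w * (2 * I / (1 - w)) := by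
        rw [← cayley_sub_I hw]
        simp
        ring
      have e6 : (starRingEnd ℂ) ((starRingEnd ℂ) (cayley w) - I) = 2 * I / (1 - w) := by
        rw [← cayley_add_I hw]
        simp
      have e7 : ((‖2 * I / (1 - w) ^ 2‖ ^ 2 : ℝ) : ℂ) =
          4 / ((1 - w) ^ 2 * (1 - (starRingEnd ℂ) w) ^ 2) := by
        rw [← Complex.normSq_eq_norm_sq, ← Complex.mul_conj]
        simp only [map_div₀, map_mul, map_pow, map_sub, map_one, conj_I, e3]
        field_simp
        linear_combination (-4 : ℂ) * I_sq
      rw [← hUg w hw, mulConj_apply _ _ hz, hvz _ hz, diskPullback, Complex.real_smul, e7, e4,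
        pole, cayley_add_I hw, Nat.add_sub_cancel_left]
      simp only [map_mul, map_pow, map_inv₀, e5, e6]
      simp only [map_div₀, map_mul, map_sub, map_one, conj_I, e3]
      have e8 : (I : ℂ) ≠ 0 := I_ne_zero
      simp only [div_pow, mul_pow, pow_add, neg_mul, mul_neg]
      field_simp
    rw [setIntegral_congr_fun Metric.isOpen_ball.measurableSet h2, integral_const_mul] at h1
    refine (mul_eq_zero.1 h1).resolve_left ?_
    simp
  have hint : IntegrableOn (fun w => ∑ q ∈ Finset.range (N + 1), (starRingEnd ℂ) w ^ q * g q w)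
      (Metric.ball 0 1) :=
    (integrableOn_diskPullback hf2).congr_fun hUg Metric.isOpen_ball.measurableSet
  -- the point `i` corresponds to the origin of the disk
  have hzero : ∀ z ∈ halfPlane, z ≠ I → (f : ℂ → ℂ) z = 0 := by
    intro z hz hzI
    obtain ⟨w, hw, rfl⟩ : z ∈ cayley '' Metric.ball (0 : ℂ) 1 := by rw [cayley_image]; exact hz
    have hw0 : w ≠ 0 := by
      rintro rfl
      exact hzI (by simp [cayley])
    have h1 := polyanalytic_eq_zero_of_orthogonal hg rfl hint horth hw0 hw
    simp only [← hUg w hw, diskPullback] at h1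
    have e1 := one_sub_ne_zero_of_mem_ball hw
    have e2 := one_sub_conj_ne_zero_of_mem_ball hw
    simpa [e1, e2] using h1
  refine eq_of_ae_eq ?_
  have hI : ∀ᵐ z ∂area, z ≠ I := by
    refine ae_restrict_of_ae ?_
    rw [ae_iff]
    simp
  filter_upwards [hI, ae_restrict_mem measurableSet_halfPlane] with z h1 h2
  exact hzero z h2 h1

/-! ### Interior estimates and limits of holomorphic functions in `L²` -/

open scoped Pointwise in
theorem setIntegral_ball_eq_unit_ball (F : ℂ → ℂ) (z : ℂ) {R : ℝ} (hR : 0 < R) :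
    ∫ w in Metric.ball z R, F w = R ^ 2 * ∫ w in Metric.ball 0 1, F (z + R * w) := by
  have h1 := (measurePreserving_add_left (volume : Measure ℂ) z).setIntegral_preimage_emb
    (measurableEmbedding_addLeft z) F (Metric.ball z R)
  have h2 : (fun w => z + w) ⁻¹' Metric.ball z R = R • Metric.ball (0 : ℂ) 1 := by
    rw [smul_unitBall_of_pos hR]
    ext w
    simp
  have h3 := Measure.setIntegral_comp_smul_of_pos (volume : Measure ℂ) (fun w => F (z + w))
    (Metric.ball (0 : ℂ) 1) hR
  rw [h2] at h1
  rw [← h1, finrank_real_complex] at *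
  simp only [Complex.real_smul] at h3
  have hR' : (R : ℂ) ≠ 0 := by exact_mod_cast hR.ne'
  rw [h3]
  push_cast
  field_simp

/-- The area mean value property. -/
theorem setIntegral_ball_of_differentiableOn {F : ℂ → ℂ} {z : ℂ} {R : ℝ} (hR : 0 < R)
    (hF : DifferentiableOn ℂ F (Metric.closedBall z R)) :
    ∫ w in Metric.ball z R, F w = Real.pi * R ^ 2 * F z := by
  have hmaps : Set.MapsTo (fun w : ℂ => z + R * w) (Metric.closedBall 0 1)
      (Metric.closedBall z R) := fun w hw => by
    have hw' : ‖w‖ ≤ 1 := by simpa using hw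
    simp only [Metric.mem_closedBall, dist_self_add_left, norm_mul, Complex.norm_real,
      Real.norm_of_nonneg hR.le]
    nlinarith
  have hg : DifferentiableOn ℂ (fun w => F (z + R * w)) (Metric.closedBall 0 1) :=
    hF.comp (by fun_prop) hmaps
  have hint : IntegrableOn (fun w => F (z + R * w)) (Metric.ball 0 1) :=
    (hg.continuousOn.integrableOn_compact (isCompact_closedBall 0 1)).mono_set
      Metric.ball_subset_closedBall
  have h1 := integral_disk_mul_monomial hint 0 0
  simp only [pow_zero, mul_one, Nat.cast_zero, sub_zero, zero_add, pow_one] at h1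
  have h2 : ∀ r ∈ Set.Ioo (0 : ℝ) 1, (r : ℂ) * circleMode (fun w => F (z + R * w)) 0 r =
      (2 * Real.pi * F z) * (r : ℂ) := fun r hr => by
    have h := circleMode_natCast (g := fun w => F (z + R * w)) hr.1
      (hg.mono (Metric.closure_ball_subset_closedBall.trans
        (Metric.closedBall_subset_closedBall hr.2.le))).diffContOnCl 0
    simp only [Nat.cast_zero, iteratedDeriv_zero, mul_zero, add_zero, Nat.factorial_zero,
      Nat.cast_one, div_one, pow_zero, mul_one] at h
    rw [h]
    ring
  rw [setIntegral_ball_eq_unit_ball F z hR, h1, setIntegral_congr_fun measurableSet_Ioo h2,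
    integral_const_mul, ← integral_Ioc_eq_integral_Ioo,
    ← intervalIntegral.integral_of_le zero_le_one, intervalIntegral.integral_ofReal, integral_id]
  push_cast
  ring

/-- The interior estimate: a consequence of the mean value property and the Cauchy–Schwarz
inequality. -/
theorem norm_apply_le_of_closedBall_subset {z : ℂ} {R : ℝ} (hR : 0 < R)
    (hz : Metric.closedBall z R ⊆ halfPlane) {f : smoothL2} (hf : delbar (f : smoothFun) = 0) :
    Real.pi * R ^ 2 * ‖((f : smoothFun) : ℂ → ℂ) z‖ ≤ (Real.pi * R ^ 2) ^ (1 / 2 : ℝ) *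
      ‖toL2 f‖ := by
  have hsub : Metric.ball z R ⊆ halfPlane := Metric.ball_subset_closedBall.trans hz
  have hvol : area (Metric.ball z R) = volume (Metric.ball z R) := by
    rw [Measure.restrict_apply Metric.isOpen_ball.measurableSet, Set.inter_eq_left.2 hsub]
  have hfin : area (Metric.ball z R) ≠ ⊤ := by rw [hvol]; exact measure_ball_lt_top.ne
  -- the mean value of `f` over the ball is its inner product with an indicator function
  have h1 := L2.inner_indicatorConstLp_one (𝕜 := ℂ) (Metric.isOpen_ball.measurableSet) hfin
    (toL2 f)
  have h2 : ∫ w in Metric.ball z R, (toL2 f : ℂ → ℂ) w ∂area =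
      ∫ w in Metric.ball z R, ((f : smoothFun) : ℂ → ℂ) w := by
    rw [integral_congr_ae (ae_restrict_of_ae (coeFn_toL2 f)),
      Measure.restrict_restrict Metric.isOpen_ball.measurableSet, Set.inter_eq_left.2 hsub]
  rw [h2, setIntegral_ball_of_differentiableOn hR (((delbar_eq_zero_iff _).1 hf).mono hz)] at h1
  have h3 := norm_inner_le_norm (𝕜 := ℂ)
    (indicatorConstLp 2 (Metric.isOpen_ball.measurableSet) hfin (1 : ℂ)) (toL2 f)
  rw [h1, norm_indicatorConstLp (by simp) (by simp)] at h3
  have h4 : area.real (Metric.ball z R) = Real.pi * R ^ 2 := by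
    rw [measureReal_def, hvol, Complex.volume_ball]
    simp [hR.le]
    ring
  rw [h4] at h3
  simpa [abs_of_pos Real.pi_pos] using h3

/-- Evaluation at a point is continuous on the holomorphic functions in `L²(Π)`, locally uniformly
in the point. -/
theorem exists_norm_apply_le {z₀ : ℂ} (hz₀ : z₀ ∈ halfPlane) :
    ∃ t ∈ nhds z₀, t ⊆ halfPlane ∧ ∃ C : ℝ, 0 ≤ C ∧ ∀ z ∈ t, ∀ f : smoothL2,
      delbar (f : smoothFun) = 0 → ‖((f : smoothFun) : ℂ → ℂ) z‖ ≤ C * ‖toL2 f‖ := by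
  have h0 : 0 < z₀.im := hz₀
  have hR : 0 < z₀.im / 3 := by positivity
  have hsub : ∀ z ∈ Metric.ball z₀ (z₀.im / 3),
      Metric.closedBall z (z₀.im / 3) ⊆ halfPlane := fun z hz w hw => by
    have h1 := (Complex.abs_im_le_norm (z - z₀)).trans_lt (mem_ball_iff_norm.1 hz)
    have h2 := (Complex.abs_im_le_norm (w - z)).trans (mem_closedBall_iff_norm.1 hw)
    rw [Complex.sub_im, abs_lt] at h1
    rw [Complex.sub_im, abs_le] at h2
    rw [SetLike.mem_coe, mem_halfPlane]
    linarith
  have hp : 0 < Real.pi * (z₀.im / 3) ^ 2 := by positivity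
  -- for `z` within `Im z₀ / 3` of `z₀`, the closed ball of that radius about `z` lies in `Π`
  refine ⟨_, Metric.ball_mem_nhds z₀ hR, fun z hz => hsub z hz (Metric.mem_closedBall_self hR.le),
    (Real.pi * (z₀.im / 3) ^ 2)⁻¹ * (Real.pi * (z₀.im / 3) ^ 2) ^ (1 / 2 : ℝ), by positivity,
    fun z hz f hf => ?_⟩
  rw [mul_assoc, ← div_eq_inv_mul, le_div_iff₀ hp, mul_comm]
  exact norm_apply_le_of_closedBall_subset hR (hsub z hz) hf

/-- A limit in `L²(Π)` of holomorphic functions is holomorphic, and the derivatives converge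
pointwise. -/
theorem exists_holomorphic_limit {F : ℕ → smoothL2} (hF : ∀ n, delbar (F n : smoothFun) = 0)
    {u : L2} (hu : Filter.Tendsto (fun n => toL2 (F n)) Filter.atTop (nhds u)) :
    ∃ f : smoothL2, delbar (f : smoothFun) = 0 ∧ toL2 f = u ∧ ∀ k, ∀ z ∈ halfPlane,
      Filter.Tendsto (fun n => ((del ^ k) (F n : smoothFun) : ℂ → ℂ) z) Filter.atTop
        (nhds (((del ^ k) (f : smoothFun) : ℂ → ℂ) z)) := by
  have hcauchy : ∀ z₀ ∈ halfPlane, ∃ t ∈ nhds z₀, t ⊆ halfPlane ∧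
      UniformCauchySeqOn (fun n => ((F n : smoothFun) : ℂ → ℂ)) Filter.atTop t := by
    intro z₀ hz₀
    obtain ⟨t, ht, htH, C, hC, hb⟩ := exists_norm_apply_le hz₀
    refine ⟨t, ht, htH, Metric.uniformCauchySeqOn_iff.2 fun ε hε => ?_⟩
    obtain ⟨N, hN⟩ := Metric.cauchySeq_iff.1 hu.cauchySeq (ε / (C + 1)) (by positivity)
    refine ⟨N, fun m hm n hn z hz => ?_⟩
    have h1 := hb z hz (F m - F n) (by
      rw [Submodule.coe_sub, map_sub, hF, hF, sub_zero])
    rw [toL2_sub, ← dist_eq_norm, Submodule.coe_sub, Submodule.coe_sub,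
      Pi.sub_apply, ← dist_eq_norm] at h1
    have h2 := hN m hm n hn
    rw [lt_div_iff₀ (by positivity)] at h2
    have h3 : (0 : ℝ) ≤ dist (toL2 (F m)) (toL2 (F n)) := dist_nonneg
    refine lt_of_le_of_lt h1 ?_
    nlinarith
  have hlim : ∀ z ∈ halfPlane, ∃ c, Filter.Tendsto (fun n => ((F n : smoothFun) : ℂ → ℂ) z)
      Filter.atTop (nhds c) := fun z hz => by
    obtain ⟨t, ht, -, hc⟩ := hcauchy z hz
    exact cauchySeq_tendsto_of_complete (hc.cauchySeq (mem_of_mem_nhds ht))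
  choose! g hg using hlim
  have hloc : TendstoLocallyUniformlyOn (fun n => ((F n : smoothFun) : ℂ → ℂ)) g Filter.atTop
      halfPlane := by
    rw [Metric.tendstoLocallyUniformlyOn_iff]
    intro ε hε z₀ hz₀
    obtain ⟨t, ht, htH, hc⟩ := hcauchy z₀ hz₀
    exact ⟨t, mem_nhdsWithin_of_mem_nhds ht, Metric.tendstoUniformlyOn_iff.1
      (hc.tendstoUniformlyOn_of_tendsto fun z hz => hg z (htH hz)) ε hε⟩
  have hdiff : DifferentiableOn ℂ g halfPlane := hloc.differentiableOn
    (Filter.Eventually.of_forall fun n => (delbar_eq_zero_iff _).1 (hF n)) halfPlane.isOpen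
  -- `L²` convergence gives almost everywhere convergence along a subsequence
  have hae : (u : ℂ → ℂ) =ᵐ[area] smoothFun.ofHolo g hdiff := by
    obtain ⟨ns, hns, hlim⟩ := (tendstoInMeasure_of_tendsto_Lp hu).exists_seq_tendsto_ae
    have hall := ae_all_iff.2 fun n => coeFn_toL2 (F n)
    filter_upwards [hlim, hall, ae_restrict_mem measurableSet_halfPlane] with z h1 h2 hz
    rw [smoothFun.ofHolo_apply _ hz]
    simp only [h2] at h1
    exact tendsto_nhds_unique h1 ((hg z hz).comp hns.tendsto_atTop)
  have hmem : smoothFun.ofHolo g hdiff ∈ smoothL2 :=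
    mem_smoothL2.2 ((memLp_congr_ae hae).1 (Lp.memLp u))
  have hk : ∀ k, TendstoLocallyUniformlyOn (fun n => ((del ^ k) (F n : smoothFun) : ℂ → ℂ))
      ((del ^ k) (smoothFun.ofHolo g hdiff) : smoothFun) Filter.atTop halfPlane := by
    intro k
    induction k with
    | zero => exact hloc.congr_right fun z hz => (smoothFun.ofHolo_apply hdiff hz).symm
    | succ k ih =>
      have h1 := ih.deriv (Filter.Eventually.of_forall fun n =>
        (delbar_eq_zero_iff _).1 (delbar_del_pow (hF n) k)) halfPlane.isOpen
      simp only [pow_succ' del, Module.End.mul_apply]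
      refine (h1.congr_right fun z hz => (del_eq_deriv (delbar_del_pow (delbar_ofHolo hdiff) k)
        hz).symm).congr fun n z hz => (del_eq_deriv (delbar_del_pow (hF n) k) hz).symm
  exact ⟨⟨_, hmem⟩, delbar_ofHolo hdiff, toL2_eq_iff.2 hae, fun k z hz =>
    (hk k).tendsto_at hz⟩

/-! ### Orthogonality to the rational functions -/

theorem exists_rep_of_mem_polyBergman {n : ℕ} {u : L2} (hu : u ∈ polyBergman n) :
    ∃ f : smoothL2, (delbar ^ n) (f : smoothFun) = 0 ∧ toL2 f = u := by
  obtain ⟨f, hf, huf⟩ := hu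
  have hmem : f ∈ smoothL2 := mem_smoothL2.2 ((memLp_congr_ae huf).1 (Lp.memLp u))
  exact ⟨⟨f, hmem⟩, hf, toL2_eq_iff.2 huf⟩

theorem toL2_mem_polyBergman {n : ℕ} {f : smoothL2} (hf : (delbar ^ n) (f : smoothFun) = 0) :
    toL2 f ∈ polyBergman n := ⟨f, hf, coeFn_toL2 f⟩

theorem creationSpan_mem_polyBergman {k n : ℕ} (h : k < n) (f : basisSpan) :
    creationSpan k f ∈ polyBergman n :=
  toL2_mem_polyBergman (delbar_pow_creation (delbar_eq_zero_of_mem_basisSpan f.2) h)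

/-- The ranges of `S^k`, `k < n`, on the span of the standard basis are total in `A_n`. -/
theorem eq_zero_of_inner_creationSpan {n : ℕ} {u : L2} (hu : u ∈ polyBergman n)
    (h : ∀ k < n, ∀ f : basisSpan, ⟪creationSpan k f, u⟫_ℂ = 0) : u = 0 := by
  obtain ⟨f, hf, rfl⟩ := exists_rep_of_mem_polyBergman hu
  cases n with
  | zero =>
    have hf0 : f = 0 := Subtype.ext (by simpa using hf)
    rw [hf0, map_zero]
  | succ N =>
    -- the smooth functions in `L²(Π)` that are orthogonal to the given one
    let M : Submodule ℂ smoothFun :=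
      { carrier := {g | ∃ hg : g ∈ smoothL2, ⟪toL2 ⟨g, hg⟩, toL2 f⟫_ℂ = 0}
        add_mem' := fun {g g'} ⟨hg, h1⟩ ⟨hg', h1'⟩ => ⟨add_mem hg hg', by
          have : toL2 ⟨g + g', add_mem hg hg'⟩ = toL2 ⟨g, hg⟩ + toL2 ⟨g', hg'⟩ := rfl
          rw [this, inner_add_left, h1, h1', add_zero]⟩
        zero_mem' := ⟨zero_mem _, by
          have : toL2 ⟨0, zero_mem _⟩ = 0 := rfl
          rw [this, inner_zero_left]⟩
        smul_mem' := fun c g ⟨hg, h1⟩ => ⟨Submodule.smul_mem _ c hg, by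
          have : toL2 ⟨c • g, Submodule.smul_mem _ c hg⟩ = c • toL2 ⟨g, hg⟩ := rfl
          rw [this, inner_smul_left, h1, mul_zero]⟩ }
    have hM : ⨆ k ∈ Finset.range (N + 1), basisSpan.map (creation k) ≤ M := by
      refine iSup₂_le fun k hk => ?_
      rintro _ ⟨g, hg, rfl⟩
      exact ⟨creation_mem_smoothL2 k hg, h k (Finset.mem_range.1 hk) ⟨g, hg⟩⟩
    have hf0 : (f : smoothFun) = 0 := eq_zero_of_inner_ratFun hf f.2 fun s a ha hs =>
      (hM (ratFun_mem_iSup_creation (Nat.lt_succ_of_le hs) ha)).2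
    have : f = 0 := Subtype.ext hf0
    rw [this, map_zero]

/-! ### Density of the span of the standard basis -/

theorem exists_seq_of_mem_closure {u : L2}
    (hu : u ∈ (LinearMap.range (creationSpan 0)).topologicalClosure) :
    ∃ F : ℕ → basisSpan, Filter.Tendsto (fun n => creationSpan 0 (F n)) Filter.atTop (nhds u) := by
  obtain ⟨x, hx, hxu⟩ := mem_closure_iff_seq_limit.1 hu
  choose F hF using hx
  exact ⟨F, by simpa only [hF] using hxu⟩

theorem creationSpan_zero_apply (f : basisSpan) :
    creationSpan 0 f = toL2 ⟨f, mem_smoothL2_of_mem_basisSpan f.2⟩ := by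
  rw [creationSpan_apply]
  congr 2
  rw [creation_zero, Module.End.one_apply]

/-- The span of the standard basis is dense in `A_1`, and `A_1` is closed. -/
theorem trueBergman_one_eq_closure :
    trueBergman (0 + 1) = (LinearMap.range (creationSpan 0)).topologicalClosure := by
  rw [zero_add, trueBergman_one]
  have hle : (LinearMap.range (creationSpan 0)).topologicalClosure ≤ polyBergman 1 := by
    intro u hu
    obtain ⟨F, hF⟩ := exists_seq_of_mem_closure hu
    simp only [creationSpan_zero_apply] at hF
    obtain ⟨f, hf, rfl, -⟩ := exists_holomorphic_limit
      (F := fun n => ⟨F n, mem_smoothL2_of_mem_basisSpan (F n).2⟩)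
      (fun n => delbar_eq_zero_of_mem_basisSpan (F n).2) hF
    exact toL2_mem_polyBergman (by rw [pow_one, hf])
  refine le_antisymm (fun u hu => ?_) hle
  set K := (LinearMap.range (creationSpan 0)).topologicalClosure
  have h0 : u - K.starProjection u = 0 := by
    refine eq_zero_of_inner_creationSpan
      (sub_mem hu (hle (Submodule.starProjection_apply_mem K u))) fun k hk f => ?_
    obtain rfl : k = 0 := by omega
    exact K.sub_starProjection_mem_orthogonal u _
      (Submodule.le_topologicalClosure _ (LinearMap.mem_range_self _ f))
  rw [sub_eq_zero.1 h0]
  exact Submodule.starProjection_apply_mem K u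

instance : CompleteSpace (trueBergman (0 + 1)) := by
  rw [trueBergman_one_eq_closure]
  infer_instance

/-- The inclusion of the span of the standard basis in `A_1`. -/
def spanIncl : basisSpan →ₗ[ℂ] trueBergman (0 + 1) :=
  (creationSpan 0).codRestrict _ fun f => by
    rw [zero_add, trueBergman_one]
    exact creationSpan_mem_polyBergman one_pos f

theorem denseRange_spanIncl : DenseRange spanIncl := by
  intro u
  obtain ⟨F, hF⟩ := exists_seq_of_mem_closure (trueBergman_one_eq_closure.le u.2)
  exact mem_closure_of_tendsto (tendsto_subtype_rng.2 hF)
    (Filter.Eventually.of_forall fun n => Set.mem_range_self (F n))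

/-! ### The isometries `S^k` and the orthogonal decomposition -/

theorem norm_creationSpan (k : ℕ) (f : basisSpan) : ‖creationSpan k f‖ = ‖spanIncl f‖ := by
  change _ = ‖creationSpan 0 f‖
  rw [@norm_eq_sqrt_re_inner ℂ, @norm_eq_sqrt_re_inner ℂ,
    inner_creationSpan, if_pos rfl]

/-- Continuous extension from a dense subspace. The space `E` is an additive monoid, and acquires
its subtraction from the scalars, so that it applies to nested submodules. -/
theorem exists_continuousLinearMap_of_denseRange {E H F : Type*} [AddCommMonoid E] [Module ℂ E]
    [NormedAddCommGroup H] [NormedSpace ℂ H] [NormedAddCommGroup F] [NormedSpace ℂ F]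
    [CompleteSpace F] {σ : ℂ →+* ℂ} (f : E →ₛₗ[σ] F) (e : E →ₗ[ℂ] H) (he : DenseRange e) {C : ℝ}
    (h : ∀ x, ‖f x‖ ≤ C * ‖e x‖) :
    ∃ T : H →SL[σ] F, (∀ x, T (e x) = f x) ∧ ∀ x, ‖T x‖ ≤ C * ‖x‖ := by
  let : AddCommGroup E := Module.addCommMonoidToAddCommGroup ℂ
  exact ⟨f.extendOfNorm e, f.extendOfNorm_eq he ⟨C, h⟩, f.norm_extendOfNorm_apply_le he C h⟩

theorem exists_continuousLinearMap_creationSpan (k : ℕ) :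
    ∃ T : trueBergman (0 + 1) →L[ℂ] L2, ∀ f, T (spanIncl f) = creationSpan k f :=
  (exists_continuousLinearMap_of_denseRange (C := 1) (creationSpan k) spanIncl denseRange_spanIncl
    fun f => by rw [one_mul, norm_creationSpan]).imp fun _ h => h.1

/-- The operator `S^k` on `A_1`, as the continuous extension from the span of the standard
basis. -/
def creationCLM (k : ℕ) : trueBergman (0 + 1) →L[ℂ] L2 :=
  (exists_continuousLinearMap_creationSpan k).choose

theorem creationCLM_spanIncl (k : ℕ) (f : basisSpan) :
    creationCLM k (spanIncl f) = creationSpan k f :=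
  (exists_continuousLinearMap_creationSpan k).choose_spec f

theorem inner_creationCLM (j k : ℕ) (u v : trueBergman (0 + 1)) :
    ⟪creationCLM k v, creationCLM j u⟫_ℂ = if j = k then ⟪v, u⟫_ℂ else 0 := by
  refine denseRange_spanIncl.induction_on₂ (p := fun u v =>
    ⟪creationCLM k v, creationCLM j u⟫_ℂ = if j = k then ⟪v, u⟫_ℂ else 0) ?_ (fun f g => ?_) u v
  · refine isClosed_eq (by fun_prop) ?_
    split_ifs
    · exact Continuous.inner (𝕜 := ℂ) (f := fun q : trueBergman (0 + 1) × trueBergman (0 + 1) => q.2)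
        (g := fun q => q.1) (by fun_prop) (by fun_prop)
    · exact continuous_const
  · rw [creationCLM_spanIncl, creationCLM_spanIncl, inner_creationSpan]
    rfl

/-- The operator `S^k` as a linear isometry on `A_1`. -/
def creationIsometry (k : ℕ) : trueBergman (0 + 1) →ₗᵢ[ℂ] L2 where
  toLinearMap := creationCLM k
  norm_map' u := by
    change ‖creationCLM k u‖ = ‖u‖
    rw [@norm_eq_sqrt_re_inner ℂ, @norm_eq_sqrt_re_inner ℂ, inner_creationCLM, if_pos rfl]

/-- The isometry is given by the differential operator `S^k`: the derivatives of a sequence of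
holomorphic functions which converges in `L²(Π)` converge pointwise. -/
theorem creationIsometry_ae_eq (k : ℕ) (u : trueBergman (0 + 1)) {f : smoothFun}
    (hf : ((u : L2) : ℂ → ℂ) =ᵐ[area] f) :
    (creationIsometry k u : ℂ → ℂ) =ᵐ[area] creation k f := by
  obtain ⟨F, hF⟩ := exists_seq_of_mem_closure (trueBergman_one_eq_closure.le u.2)
  have hF' := hF
  simp only [creationSpan_zero_apply] at hF'
  obtain ⟨g, -, hg, hlim⟩ := exists_holomorphic_limit
    (F := fun n => ⟨F n, mem_smoothL2_of_mem_basisSpan (F n).2⟩)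
    (fun n => delbar_eq_zero_of_mem_basisSpan (F n).2) hF'
  obtain rfl : (g : smoothFun) = f := eq_of_ae_eq ((toL2_eq_iff.1 hg).symm.trans hf)
  have h1 : Filter.Tendsto (fun n => creationSpan k (F n)) Filter.atTop
      (nhds (creationIsometry k u)) := by
    have h2 := ((creationIsometry k).continuous.tendsto u).comp
      (tendsto_subtype_rng.2 hF : Filter.Tendsto (fun n => spanIncl (F n)) _ _)
    exact h2.congr fun n => creationCLM_spanIncl k (F n)
  obtain ⟨ns, hns, hae⟩ := (tendstoInMeasure_of_tendsto_Lp h1).exists_seq_tendsto_ae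
  have hall := ae_all_iff.2 fun n => coeFn_creationSpan k (F n)
  filter_upwards [hae, hall, ae_restrict_mem measurableSet_halfPlane] with z h2 h3 hz
  simp only [h3] at h2
  refine tendsto_nhds_unique h2 ?_
  simp only [creation_eq_sum, Submodule.coe_sum, Submodule.coe_smul, Finset.sum_apply,
    Pi.smul_apply, mulY_pow_apply _ _ hz]
  exact tendsto_finsetSum _ fun l _ =>
    (((hlim l z hz).comp hns.tendsto_atTop).const_mul _).const_smul _

/-- The space `S^k A_1`. -/
def creationRange (k : ℕ) : Submodule ℂ L2 := LinearMap.range (creationIsometry k).toLinearMap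

instance (k : ℕ) : CompleteSpace (creationRange k) :=
  ((creationIsometry k).isometry.isUniformInducing.isComplete_range).completeSpace_coe

theorem creationRange_le_polyBergman {k n : ℕ} (h : k < n) : creationRange k ≤ polyBergman n := by
  rintro _ ⟨u, rfl⟩
  obtain ⟨f, hf, huf⟩ := trueBergman_one.le u.2
  rw [pow_one] at hf
  exact ⟨creation k f, delbar_pow_creation hf h, creationIsometry_ae_eq k u huf⟩

theorem inner_creationRange {j k : ℕ} (h : j ≠ k) {u v : L2} (hu : u ∈ creationRange j)
    (hv : v ∈ creationRange k) : ⟪v, u⟫_ℂ = 0 := by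
  obtain ⟨u, rfl⟩ := hu
  obtain ⟨v, rfl⟩ := hv
  exact (inner_creationCLM j k u v).trans (if_neg h)

/-- The orthogonal decomposition `A_n = A_1 ⊕ S A_1 ⊕ … ⊕ S^(n-1) A_1`. -/
theorem eq_sum_starProjection {n : ℕ} {u : L2} (hu : u ∈ polyBergman n) :
    u = ∑ k ∈ Finset.range n, (creationRange k).starProjection u := by
  refine sub_eq_zero.1 (eq_zero_of_inner_creationSpan (sub_mem hu (Submodule.sum_mem _
    fun k hk => creationRange_le_polyBergman (Finset.mem_range.1 hk)
      (Submodule.starProjection_apply_mem _ u))) fun k hk f => ?_)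
  have hf : creationSpan k f ∈ creationRange k := ⟨spanIncl f, creationCLM_spanIncl k f⟩
  have h1 := (creationRange k).sub_starProjection_mem_orthogonal u _ hf
  rw [inner_sub_right, inner_sum, Finset.sum_eq_single_of_mem k (Finset.mem_range.2 hk),
    ← inner_sub_right]
  · exact h1
  · exact fun i _ hi => inner_creationRange hi (Submodule.starProjection_apply_mem _ u) hf

theorem creationRange_eq_trueBergman (j : ℕ) : creationRange j = trueBergman (j + 1) := by
  refine le_antisymm (le_inf (creationRange_le_polyBergman j.lt_succ_self) ?_) ?_
  · intro u hu v hv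
    rw [Nat.add_sub_cancel] at hv
    rw [eq_sum_starProjection hv, sum_inner]
    refine Finset.sum_eq_zero fun k hk => inner_creationRange (Finset.mem_range.1 hk).ne' hu
      (Submodule.starProjection_apply_mem _ v)
  · rintro u ⟨hu, hu'⟩
    rw [Nat.add_sub_cancel] at hu'
    rw [eq_sum_starProjection hu, Finset.sum_range_succ, Finset.sum_eq_zero, zero_add]
    · exact Submodule.starProjection_apply_mem _ u
    · intro k hk
      have hmem := Submodule.starProjection_apply_mem (creationRange k) u
      have h1 := hu' _ (creationRange_le_polyBergman (Finset.mem_range.1 hk) hmem)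
      have h2 := (creationRange k).sub_starProjection_mem_orthogonal u _ hmem
      rw [inner_sub_right, h1, zero_sub, neg_eq_zero] at h2
      exact inner_self_eq_zero.1 h2

/-- The unitary operator `S^j` from `A_1` onto `A_(j+1)`. -/
def creationUnitary (j : ℕ) : trueBergman (0 + 1) ≃ₗᵢ[ℂ] trueBergman (j + 1) :=
  (creationIsometry j).equivRange.trans
    (LinearIsometryEquiv.ofEq _ _ (creationRange_eq_trueBergman j))

theorem creationUnitary_ae_eq (j : ℕ) (u : trueBergman (0 + 1)) (f : smoothFun)
    (hf : ((u : L2) : ℂ → ℂ) =ᵐ[area] f) :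
    ((creationUnitary j u : L2) : ℂ → ℂ) =ᵐ[area] creation j f :=
  creationIsometry_ae_eq j u hf

/-! ### Bounded sesquilinear forms and unitary equivalence -/

/-- A sesquilinear form on a dense subspace of a Hilbert space that is bounded for the norm of the
Hilbert space is given by a bounded operator. -/
theorem exists_inner_eq_of_denseRange {E H : Type*} [AddCommMonoid E] [Module ℂ E]
    [NormedAddCommGroup H] [InnerProductSpace ℂ H] [CompleteSpace H]
    (B : E →ₗ⋆[ℂ] E →ₗ[ℂ] ℂ) (e : E →ₗ[ℂ] H) (he : DenseRange e) {C : ℝ} (hC : 0 ≤ C)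
    (h : ∀ g f, ‖B g f‖ ≤ C * ‖e f‖ * ‖e g‖) :
    ∃ T : H →L[ℂ] H, ∀ f g, ⟪e g, T (e f)⟫_ℂ = B g f := by
  choose L hL hLn using fun g => exists_continuousLinearMap_of_denseRange (B g) e he
    (C := C * ‖e g‖) fun f => (h g f).trans_eq (by ring)
  have hext : ∀ {L₁ L₂ : H →L[ℂ] ℂ}, (∀ f, L₁ (e f) = L₂ (e f)) → L₁ = L₂ := fun {L₁ L₂} h =>
    DFunLike.coe_injective (he.equalizer L₁.continuous L₂.continuous (funext h))
  let M : E →ₗ⋆[ℂ] (H →L[ℂ] ℂ) :=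
    { toFun := L
      map_add' := fun g g' => hext fun f => by simp [hL]
      map_smul' := fun c g => hext fun f => by simp [hL] }
  obtain ⟨S, hS, -⟩ := exists_continuousLinearMap_of_denseRange M e he (C := C) fun g =>
    (L g).opNorm_le_bound (by positivity) (hLn g)
  refine ⟨ContinuousLinearMap.adjoint (InnerProductSpace.continuousLinearMapOfBilin S),
    fun f g => ?_⟩
  rw [ContinuousLinearMap.adjoint_inner_right,
    InnerProductSpace.continuousLinearMapOfBilin_apply, hS]
  exact hL g f

section UnitaryEquivalence

variable {H K : Type*} [NormedAddCommGroup H] [InnerProductSpace ℂ H] [NormedAddCommGroup K]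
  [InnerProductSpace ℂ K]

/-- The operator `V⁻¹ T V`. -/
def unitaryConj (V : H ≃ₗᵢ[ℂ] K) (T : K →L[ℂ] K) : H →L[ℂ] H :=
  (V.symm : K →L[ℂ] H) ∘L T ∘L (V : H →L[ℂ] K)

theorem unitaryConj_apply (V : H ≃ₗᵢ[ℂ] K) (T : K →L[ℂ] K) (u : H) :
    unitaryConj V T u = V.symm (T (V u)) := rfl

theorem unitaryConj_symm (V : H ≃ₗᵢ[ℂ] K) (T : K →L[ℂ] K) :
    unitaryConj V.symm (unitaryConj V T) = T := by
  ext u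
  simp [unitaryConj_apply]

theorem unitaryConj_sub (V : H ≃ₗᵢ[ℂ] K) (T T' : K →L[ℂ] K) :
    unitaryConj V (T - T') = unitaryConj V T - unitaryConj V T' := by
  ext u
  simp [unitaryConj_apply]

theorem norm_unitaryConj (V : H ≃ₗᵢ[ℂ] K) (T : K →L[ℂ] K) : ‖unitaryConj V T‖ = ‖T‖ := by
  rw [unitaryConj, ContinuousLinearMap.opNorm_linearIsometryEquiv_comp,
    ContinuousLinearMap.opNorm_comp_linearIsometryEquiv]

theorem range_unitaryConj (V : H ≃ₗᵢ[ℂ] K) (T : K →L[ℂ] K) :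
    LinearMap.range (unitaryConj V T : H →ₗ[ℂ] H) =
      (LinearMap.range (T : K →ₗ[ℂ] K)).map (V.symm.toLinearEquiv : K →ₗ[ℂ] H) := by
  ext u
  constructor
  · rintro ⟨v, rfl⟩
    exact ⟨T (V v), ⟨V v, rfl⟩, rfl⟩
  · rintro ⟨_, ⟨v, rfl⟩, rfl⟩
    exact ⟨V.symm v, by
      change V.symm (T (V (V.symm v))) = _
      rw [V.apply_symm_apply]
      rfl⟩

theorem IsFiniteRank.unitaryConj {T : K →L[ℂ] K} (hT : IsFiniteRank T) (V : H ≃ₗᵢ[ℂ] K) :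
    IsFiniteRank (unitaryConj V T) := by
  have : FiniteDimensional ℂ (LinearMap.range (T : K →ₗ[ℂ] K)) := hT
  rw [IsFiniteRank, range_unitaryConj]
  infer_instance

theorem finrank_range_unitaryConj (V : H ≃ₗᵢ[ℂ] K) (T : K →L[ℂ] K) :
    Module.finrank ℂ (LinearMap.range (unitaryConj V T : H →ₗ[ℂ] H)) =
      Module.finrank ℂ (LinearMap.range (T : K →ₗ[ℂ] K)) := by
  rw [range_unitaryConj]
  exact LinearEquiv.finrank_map_eq V.symm.toLinearEquiv _

theorem isFiniteRank_unitaryConj_iff (V : H ≃ₗᵢ[ℂ] K) (T : K →L[ℂ] K) :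
    IsFiniteRank (unitaryConj V T) ↔ IsFiniteRank T :=
  ⟨fun h => by simpa only [unitaryConj_symm] using h.unitaryConj V.symm, fun h => h.unitaryConj V⟩

theorem singularNumber_unitaryConj (V : H ≃ₗᵢ[ℂ] K) (T : K →L[ℂ] K) (n : ℕ) :
    singularNumber (unitaryConj V T) n = singularNumber T n := by
  refine congrArg sInf (Set.ext fun r => ⟨?_, ?_⟩)
  · rintro ⟨F, hF, hn, rfl⟩
    refine ⟨unitaryConj V.symm F, hF.unitaryConj _, (finrank_range_unitaryConj _ F).trans_le hn, ?_⟩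
    rw [← norm_unitaryConj V.symm, unitaryConj_sub, unitaryConj_symm]
  · rintro ⟨F, hF, hn, rfl⟩
    refine ⟨unitaryConj V F, hF.unitaryConj _, (finrank_range_unitaryConj _ F).trans_le hn, ?_⟩
    rw [← norm_unitaryConj V, unitaryConj_sub]

theorem isSchatten_unitaryConj_iff (p : ℝ) (V : H ≃ₗᵢ[ℂ] K) (T : K →L[ℂ] K) :
    IsSchatten p (unitaryConj V T) ↔ IsSchatten p T := by
  simp only [IsSchatten, singularNumber_unitaryConj]

theorem isCompactOperator_unitaryConj {T : K →L[ℂ] K} (hT : IsCompactOperator T)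
    (V : H ≃ₗᵢ[ℂ] K) : IsCompactOperator (unitaryConj V T) :=
  (hT.comp_clm (V : H →L[ℂ] K)).continuous_comp V.symm.continuous

theorem isCompactOperator_unitaryConj_iff (V : H ≃ₗᵢ[ℂ] K) (T : K →L[ℂ] K) :
    IsCompactOperator (unitaryConj V T) ↔ IsCompactOperator T :=
  ⟨fun h => by simpa only [unitaryConj_symm] using isCompactOperator_unitaryConj h V.symm,
    fun h => isCompactOperator_unitaryConj h V⟩

theorem unitaryConj_eq_zero_iff (V : H ≃ₗᵢ[ℂ] K) (T : K →L[ℂ] K) :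
    unitaryConj V T = 0 ↔ T = 0 := by
  rw [← norm_eq_zero, norm_unitaryConj, norm_eq_zero]

end UnitaryEquivalence

/-! ### Toeplitz operators -/

theorem linearPMap_congr_apply {E F : Type*} [AddCommGroup E] [Module ℂ E] [AddCommGroup F]
    [Module ℂ F] (a : E →ₗ.[ℂ] F) {x y : E} (h : x = y) (hx : x ∈ a.domain) (hy : y ∈ a.domain) :
    a ⟨x, hx⟩ = a ⟨y, hy⟩ := by
  subst h
  rfl

theorem eLpNorm_creation (j : ℕ) (f : basisSpan) :
    eLpNorm (creation j f : ℂ → ℂ) 2 area = ‖spanIncl f‖ₑ := by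
  rw [← ofReal_norm, ← norm_creationSpan j, ofReal_norm, creationSpan_apply, enorm_toL2]

theorem spanIncl_ae_eq (f : basisSpan) : ((spanIncl f : L2) : ℂ → ℂ) =ᵐ[area] (f : smoothFun) := by
  have h := coeFn_creationSpan 0 f
  rwa [creation_zero] at h

theorem creationUnitary_zero (u : trueBergman (0 + 1)) : creationUnitary 0 u = u := by
  obtain ⟨f, -, hf⟩ := trueBergman_one.le u.2
  have h := creationUnitary_ae_eq 0 u f hf
  rw [creation_zero] at h
  exact Subtype.ext (Lp.ext (h.trans hf.symm))

/-- It suffices to test the Toeplitz operator on the images under the unitary operator `S^j` of the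
span of the standard basis. -/
theorem isToeplitz_iff {j : ℕ} {a : smoothFun →ₗ.[ℂ] ℂ}
    {T : trueBergman (j + 1) →L[ℂ] trueBergman (j + 1)} :
    IsToeplitz j a T ↔ ∀ f g : basisSpan,
      ∃ h : mulConj (creation j f) (creation j g) ∈ a.domain,
        ⟪creationUnitary j (spanIncl g), T (creationUnitary j (spanIncl f))⟫_ℂ =
          a ⟨mulConj (creation j f) (creation j g), h⟩ := by
  have h0 : ∀ f : basisSpan, ((creationUnitary j (spanIncl f) : L2) : ℂ → ℂ) =ᵐ[area]
      creation j f := fun f => creationUnitary_ae_eq j _ _ (spanIncl_ae_eq f)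
  refine ⟨fun H f g => H f f.2 g g.2 _ _ (h0 f) (h0 g), fun H f hf g hg u v hu hv => ?_⟩
  obtain rfl : u = creationUnitary j (spanIncl ⟨f, hf⟩) :=
    Subtype.ext (Lp.ext (hu.trans (h0 ⟨f, hf⟩).symm))
  obtain rfl : v = creationUnitary j (spanIncl ⟨g, hg⟩) :=
    Subtype.ext (Lp.ext (hv.trans (h0 ⟨g, hg⟩).symm))
  exact H ⟨f, hf⟩ ⟨g, hg⟩

theorem isToeplitz_zero_iff {b : smoothFun →ₗ.[ℂ] ℂ}
    {T : trueBergman (0 + 1) →L[ℂ] trueBergman (0 + 1)} :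
    IsToeplitz 0 b T ↔ ∀ f g : basisSpan,
      ∃ h : mulConj (creation 0 f) (creation 0 g) ∈ b.domain,
        ⟪spanIncl g, T (spanIncl f)⟫_ℂ = b ⟨mulConj (creation 0 f) (creation 0 g), h⟩ := by
  simp only [isToeplitz_iff, creationUnitary_zero]

theorem IsToeplitz.eq {b : smoothFun →ₗ.[ℂ] ℂ}
    {T T' : trueBergman (0 + 1) →L[ℂ] trueBergman (0 + 1)} (hT : IsToeplitz 0 b T)
    (hT' : IsToeplitz 0 b T') : T = T' := by
  rw [isToeplitz_zero_iff] at hT hT'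
  refine DFunLike.coe_injective (denseRange_spanIncl.equalizer T.continuous T'.continuous
    (funext fun f => denseRange_spanIncl.eq_of_inner_right ℂ fun g => ?_))
  obtain ⟨h, h1⟩ := hT f g
  obtain ⟨_, h2⟩ := hT' f g
  exact h1.trans h2.symm

/-- A bounded form gives rise to a Toeplitz operator. -/
theorem exists_isToeplitz {b : smoothFun →ₗ.[ℂ] ℂ} (hb : FormBounded 0 b) :
    ∃ T, IsToeplitz 0 b T := by
  obtain ⟨C, hC⟩ := hb
  have hdom : ∀ f g : basisSpan, mulConj (creation 0 f) (creation 0 g) ∈ b.domain :=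
    fun f g => (hC f f.2 g g.2).1
  let B : basisSpan →ₗ⋆[ℂ] basisSpan →ₗ[ℂ] ℂ := LinearMap.mk₂'ₛₗ (starRingEnd ℂ) (RingHom.id ℂ)
    (fun g f => b ⟨mulConj (creation 0 f) (creation 0 g), hdom f g⟩)
    (fun g g' f => by
      rw [← b.map_add]
      exact linearPMap_congr_apply b (by
        rw [Submodule.coe_add, map_add, mulConj_add_right]) _ _)
    (fun c g f => by
      rw [← b.map_smul]
      exact linearPMap_congr_apply b (by
        rw [Submodule.coe_smul, map_smul, mulConj_smul_right]) _ _)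
    (fun g f f' => by
      rw [← b.map_add]
      exact linearPMap_congr_apply b (by
        rw [Submodule.coe_add, map_add, mulConj_add_left]) _ _)
    (fun c g f => by
      rw [← b.map_smul]
      exact linearPMap_congr_apply b (by
        rw [Submodule.coe_smul, map_smul, mulConj_smul_left]; rfl) _ _)
  obtain ⟨T, hT⟩ := exists_inner_eq_of_denseRange B spanIncl denseRange_spanIncl (C := C)
    C.coe_nonneg fun g f => by
      have h := (hC f f.2 g g.2).2
      rw [eLpNorm_creation, eLpNorm_creation] at h
      simp only [enorm_eq_nnnorm] at h
      exact_mod_cast h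
  exact ⟨T, isToeplitz_zero_iff.2 fun f g => ⟨hdom f g, hT f g⟩⟩

theorem mulConj_creation_mem_domain {a : smoothFun →ₗ.[ℂ] ℂ} (ha : IsSymbol a) (j : ℕ)
    {f g : smoothFun} (hf : f ∈ basisSpan) (hg : g ∈ basisSpan) :
    mulConj (creation j f) (creation j g) ∈ a.domain :=
  ha.le_domain (mulConj_mem_smoothL1 (creation_mem_closureL2 j hf) (creation_mem_closureL2 j hg))

/-- `(a, S^j f \overline{S^j g}) = (K_(j) a, f ḡ)`. -/
theorem exists_polyAct_creationPoly_eq {a : smoothFun →ₗ.[ℂ] ℂ} (ha : IsSymbol a) (j : ℕ)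
    {f g : smoothFun} (hf : f ∈ basisSpan) (hg : g ∈ basisSpan) :
    ∃ (h : mulConj (creation j f) (creation j g) ∈ a.domain)
      (h' : mulConj f g ∈ (polyAct (creationPoly j) a).domain),
      a ⟨mulConj (creation j f) (creation j g), h⟩ =
        polyAct (creationPoly j) a ⟨mulConj f g, h'⟩ := by
  have h := mulConj_creation_mem_domain ha j hf hg
  have h1 := polyTranspose_creationPoly j (delbar_eq_zero_of_mem_basisSpan hf)
    (delbar_eq_zero_of_mem_basisSpan hg)
  have h' : polyTranspose (creationPoly j) (mulConj f g) ∈ a.domain := by rwa [h1]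
  exact ⟨h, h', linearPMap_congr_apply a h1.symm h h'⟩

/-- The same identity with `f` and `g` written as `S^0 f` and `S^0 g`, as they occur in the form of
the Toeplitz operator on `A_1`. -/
theorem exists_polyAct_creation_zero_eq {a : smoothFun →ₗ.[ℂ] ℂ} (ha : IsSymbol a) (j : ℕ)
    (f g : basisSpan) :
    ∃ (h : mulConj (creation j f) (creation j g) ∈ a.domain)
      (h' : mulConj (creation 0 f) (creation 0 g) ∈ (polyAct (creationPoly j) a).domain),
      a ⟨mulConj (creation j f) (creation j g), h⟩ =
        polyAct (creationPoly j) a ⟨mulConj (creation 0 f) (creation 0 g), h'⟩ := by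
  rw [creation_zero]
  exact exists_polyAct_creationPoly_eq ha j f.2 g.2

theorem formBounded_iff {a : smoothFun →ₗ.[ℂ] ℂ} (ha : IsSymbol a) (j : ℕ) :
    FormBounded j a ↔ FormBounded 0 (polyAct (creationPoly j) a) := by
  refine exists_congr fun C => ⟨fun H f hf g hg => ?_, fun H f hf g hg => ?_⟩
  all_goals
    obtain ⟨h, h', e⟩ := exists_polyAct_creation_zero_eq ha j ⟨f, hf⟩ ⟨g, hg⟩
    have n := fun k => eLpNorm_creation k ⟨f, hf⟩
    have n' := fun k => eLpNorm_creation k ⟨g, hg⟩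
    obtain ⟨_, hb⟩ := H f hf g hg
    simp only at n n' e h h'
    rw [n, n'] at hb
  · exact ⟨h', by rw [n, n', ← e]; exact hb⟩
  · exact ⟨h, by rw [n, n', e]; exact hb⟩

theorem isToeplitz_iff_unitaryConj {a : smoothFun →ₗ.[ℂ] ℂ} (ha : IsSymbol a) (j : ℕ)
    (T : trueBergman (j + 1) →L[ℂ] trueBergman (j + 1)) :
    IsToeplitz j a T ↔
      IsToeplitz 0 (polyAct (creationPoly j) a) (unitaryConj (creationUnitary j) T) := by
  rw [isToeplitz_iff, isToeplitz_zero_iff]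
  refine forall₂_congr fun f g => ?_
  obtain ⟨h, h', e⟩ := exists_polyAct_creation_zero_eq ha j f g
  have h1 : ⟪spanIncl g, unitaryConj (creationUnitary j) T (spanIncl f)⟫_ℂ =
      ⟪creationUnitary j (spanIncl g), T (creationUnitary j (spanIncl f))⟫_ℂ := by
    rw [unitaryConj_apply, ← (creationUnitary j).inner_map_map,
      LinearIsometryEquiv.apply_symm_apply]
  rw [h1]
  exact ⟨fun ⟨_, H⟩ => ⟨h', H.trans e⟩, fun ⟨_, H⟩ => ⟨h, H.trans e.symm⟩⟩

end PolyBergman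

end

theorem mainTheorem3 (j : ℕ) :
    ∃ V : trueBergman (0 + 1) ≃ₗᵢ[ℂ] trueBergman (j + 1),
      (∀ (u : trueBergman (0 + 1)) (f : smoothFun), ((u : L2) : ℂ → ℂ) =ᵐ[area] f →
        ((V u : L2) : ℂ → ℂ) =ᵐ[area] creation j f) ∧
      ∃ P : FreeAlgebra ℂ (Fin 3), ncDegree P = j ∧
        ∀ a : smoothFun →ₗ.[ℂ] ℂ, IsSymbol a →
          (∀ f ∈ basisSpan, ∀ g ∈ basisSpan,
            ∃ (h : mulConj (creation j f) (creation j g) ∈ a.domain)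
              (h' : mulConj f g ∈ (polyAct P a).domain),
              a ⟨mulConj (creation j f) (creation j g), h⟩ = polyAct P a ⟨mulConj f g, h'⟩) ∧
          (FormBounded j a ↔ FormBounded 0 (polyAct P a)) ∧
          (FormBounded j a →
            (∃! T, IsToeplitz j a T) ∧ (∃! T', IsToeplitz 0 (polyAct P a) T') ∧
            ∀ T T', IsToeplitz j a T → IsToeplitz 0 (polyAct P a) T' →
              (∀ u, T (V u) = V (T' u)) ∧
              (IsCompactOperator T ↔ IsCompactOperator T') ∧
              (∀ p : ℝ, 0 < p → (IsSchatten p T ↔ IsSchatten p T')) ∧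
              (IsFiniteRank T ↔ IsFiniteRank T') ∧
              (T = 0 ↔ T' = 0)) := by
  refine ⟨creationUnitary j, creationUnitary_ae_eq j, creationPoly j, ncDegree_creationPoly j,
    fun a ha => ⟨fun f hf g hg => exists_polyAct_creationPoly_eq ha j hf hg,
      formBounded_iff ha j, fun hb => ?_⟩⟩
  obtain ⟨T₀, hT₀⟩ := exists_isToeplitz ((formBounded_iff ha j).1 hb)
  refine ⟨⟨unitaryConj (creationUnitary j).symm T₀, ?_, fun T hT => ?_⟩,
    ⟨T₀, hT₀, fun T' hT' => hT'.eq hT₀⟩, fun T T' hT hT' => ?_⟩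
  · refine (isToeplitz_iff_unitaryConj ha j _).2 ?_
    have h := unitaryConj_symm (creationUnitary j).symm T₀
    rw [LinearIsometryEquiv.symm_symm] at h
    rwa [h]
  · rw [← ((isToeplitz_iff_unitaryConj ha j T).1 hT).eq hT₀, unitaryConj_symm]
  · obtain rfl := ((isToeplitz_iff_unitaryConj ha j T).1 hT).eq hT'
    refine ⟨fun u => ?_, (isCompactOperator_unitaryConj_iff _ T).symm,
      fun p _ => (isSchatten_unitaryConj_iff p _ T).symm, (isFiniteRank_unitaryConj_iff _ T).symm,
      (unitaryConj_eq_zero_iff _ T).symm⟩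
    rw [unitaryConj_apply, LinearIsometryEquiv.apply_symm_apply]
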